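/- Let $N\ge 2$ and $p>p_c=1+\frac{4}{N-1}$, with $p<p_S=1+\frac{4}{N-2}$ if $N\ge3$. Let $u$ be a (finite energy) blow-up solution of $\partial_t^2u=\Delta u+|u|^{p-1}u$ with initial data in $H^1_{loc}(\mathbb R^N)\times L^2_{loc}(\mathbb R^N)$ and with blow-up graph $\{(x,T(x))\}$: $T(x)<\infty$ is, for each $x\in\mathbb R^N$, the supremum of the times $t_0$ such that the solution exists on the backward light cone with vertex $(x,t_0)$, and $u$ is defined on $D=\{(x,t): 0\le t<T(x)\}$. Let $x_0$ be a non-characteristic point with slope $\delta_0\in(0,1)$, i.e. for some $t_1<T(x_0)$ all $(x,t)$ with $t_1\le t<T(x_0)-\delta_0|x-x_0|$ satisfy $t<T(x)$. Let $B$ be the open unit ball of $\mathbb R^N$, and for $x\in\mathbb R^N$ and $0<T'\le T(x)$ define $w_{x,T'}$ by $$u(\xi,t)=(T'-t)^{-\frac2{p-1}}\,w_{x,T'}(y,s),\qquad y=\frac{\xi-x}{T'-t},\quad s=-\log(T'-t),\qquad y\in B,\ s\ge-\log T'.$$ Let $\varepsilon>0$ and $\rho_\varepsilon(y)=(1-|y|^2)^\varepsilon$.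 Then there is a constant $C>0$ depending only on $N$, $p$ and $\varepsilon$ (in particular not on $u$, $x_0$, $\delta_0$, $T_0$, $x$ or $s$) such that, for every $T_0\in(0,T(x_0)]$: (i) for $w=w_{x_0,T_0}$ and all $s\ge-\log T_0+2$, $$\int_s^{s+1}\!\int_B|w|^{p+1}\frac{\rho_\varepsilon}{\sqrt{1-|y|^2}}\,dy\,d\tau\le C\int_{s-2}^{s+3}\!\int_B\big(|\nabla w|^2+(\partial_sw)^2+w^2+|w|^{p+1}\big)\rho_\varepsilon\,dy\,d\tau;$$ (ii) more generally, the same inequality holds for $w=w_{x,T^*(x)}$, where $T^*(x)=T_0-\delta_0|x-x_0|$, for all $x\in\mathbb R^N$ with $0<T^*(x)\le T(x)$ and all $s\ge-\log T^*(x)+2$ with $|x-x_0|\le e^{-s}/\delta_0$. -/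

import Mathlib

open MeasureTheory Set Filter Topology
open scoped ENNReal ContDiff Laplacian Gradient

noncomputable section

/-- The space `ℝ^N` with its Euclidean norm. -/
abbrev Space (N : ℕ) : Type := EuclideanSpace ℝ (Fin N)

/-- A real function of `(x, t) ∈ ℝ^N × ℝ` together with its first-order (weak) derivatives: the
function, its spatial gradient and its time derivative, defined up to null sets. That `grad` and
`dt` are the weak derivatives of `val` is not part of this structure; it is forced, on the domain
of the solution, by `IsStrongSolutionOnCone`. -/
structure WaveField (N : ℕ) where
  val : Space N → ℝ → ℝ
  grad : Space N → ℝ → Space N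
  dt : Space N → ℝ → ℝ

/-- A classically differentiable function with its classical derivatives. -/
def classicalField {N : ℕ} (v : Space N → ℝ → ℝ) : WaveField N where
  val := v
  grad := fun x t => ∇ (fun ξ => v ξ t) x
  dt := fun x t => deriv (fun τ => v x τ) t

/-- `∂_t² v - Δ v - |v|^{p-1} v` at `(x, t)`, for a function of class `C²`. -/
def waveResidual {N : ℕ} (p : ℝ) (v : Space N → ℝ → ℝ) (x : Space N) (t : ℝ) : ℝ :=
  iteratedDeriv 2 (fun τ => v x τ) t - (Δ (fun ξ => v ξ t)) x - |v x t| ^ (p - 1) * v x t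

/-- Distance of two fields at time `t`, on the ball `B(x, r)`, in the energy space
`(H¹ ∩ L^{p+1}) × L²`. (For Sobolev-subcritical `p` the `L^{p+1}` part is controlled by the
`H¹` part.) -/
def energyDist {N : ℕ} (p : ℝ) (V U : WaveField N) (x : Space N) (r t : ℝ) : ℝ≥0∞ :=
  ∫⁻ ξ in Metric.ball x r,
    (‖V.grad ξ t - U.grad ξ t‖ₑ ^ 2 + ‖V.dt ξ t - U.dt ξ t‖ₑ ^ 2
      + ‖V.val ξ t - U.val ξ t‖ₑ ^ 2 + ‖V.val ξ t - U.val ξ t‖ₑ ^ (p + 1))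

/-- `U` is a strong (finite energy) solution of `∂_t² u = Δ u + |u|^{p-1} u` on the backward light
cone `{(ξ, τ) : 0 ≤ τ ≤ t₀, |ξ - x| < t₀ - τ}`: there are functions `v n` of class `C²` which
converge to `U`, together with their first-order derivatives, in the energy space, uniformly in
time, and which solve the equation up to an error tending to `0` in `L¹_t L²_x` of the cone.
In particular `U.val` is continuous in time with values in `H¹`, `U.grad` and `U.dt` are its weak
derivatives, `U.dt` is continuous in time with values in `L²`, and the equation holds in the sense
of distributions. -/
def IsStrongSolutionOnCone {N : ℕ} (p : ℝ) (U : WaveField N) (x : Space N) (t₀ : ℝ) : Prop :=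
  ∃ v : ℕ → Space N → ℝ → ℝ,
    (∀ n, ContDiff ℝ 2 (fun z : Space N × ℝ => v n z.1 z.2)) ∧
    Tendsto (fun n => ⨆ t ∈ Icc (0 : ℝ) t₀, energyDist p (classicalField (v n)) U x (t₀ - t) t)
      atTop (𝓝 0) ∧
    Tendsto (fun n => ∫⁻ t in Icc (0 : ℝ) t₀,
        (∫⁻ ξ in Metric.ball x (t₀ - t), ‖waveResidual p (v n) ξ t‖ₑ ^ 2) ^ (1 / 2 : ℝ))
      atTop (𝓝 0)

/-- The three components are (jointly) measurable. -/
def WaveField.IsMeasurable {N : ℕ} (U : WaveField N) : Prop :=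
  Measurable (fun z : Space N × ℝ => U.val z.1 z.2) ∧
  Measurable (fun z : Space N × ℝ => U.grad z.1 z.2) ∧
  Measurable (fun z : Space N × ℝ => U.dt z.1 z.2)

/-- `U` solves the Cauchy problem with data `(u₀, u₁)` at time `0` on the backward light cone with
vertex `(x, t₀)`. -/
def SolvesCauchyOnCone {N : ℕ} (p : ℝ) (u₀ u₁ : Space N → ℝ) (U : WaveField N)
    (x : Space N) (t₀ : ℝ) : Prop :=
  IsStrongSolutionOnCone p U x t₀ ∧
  (∀ᵐ ξ ∂(volume.restrict (Metric.ball x t₀)), U.val ξ 0 = u₀ ξ ∧ U.dt ξ 0 = u₁ ξ)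

/-- `f ∈ L²_loc(ℝ^N)`. -/
def MemL2loc {N : ℕ} {F : Type*} [NormedAddCommGroup F] (f : Space N → F) : Prop :=
  ∀ r : ℝ, MemLp f 2 (volume.restrict (Metric.ball 0 r))

/-- `f ∈ H¹_loc(ℝ^N)`: `f` and its weak gradient are in `L²_loc`. -/
def MemH1loc {N : ℕ} (f : Space N → ℝ) : Prop :=
  MemL2loc f ∧ ∃ g : Space N → Space N, MemL2loc g ∧
    ∀ φ : Space N → ℝ, ContDiff ℝ ∞ φ → HasCompactSupport φ →
      ∫ x, f x • ∇ φ x = - ∫ x, φ x • g x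

/-- `U` is a blow-up solution of the Cauchy problem
`∂_t² u = Δ u + |u|^{p-1} u`, `(u, ∂_t u)(0) = (u₀, u₁) ∈ H¹_loc × L²_loc`,
with blow-up graph `{(x, T x)}`: for every `x`, `T x` is the supremum (assumed finite) of the times
`t₀` such that a solution exists on the backward light cone with vertex `(x, t₀)`, and `U` is the
solution on the maximal influence domain `{(x, t) : 0 ≤ t < T x}`, the union of these cones. -/
structure IsBlowupSolution {N : ℕ} (p : ℝ) (u₀ u₁ : Space N → ℝ) (U : WaveField N)
    (T : Space N → ℝ) : Prop where
  data_val : MemH1loc u₀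
  data_dt : MemL2loc u₁
  measurable : U.IsMeasurable
  graph : ∀ x, IsLUB {t₀ : ℝ | 0 < t₀ ∧
    ∃ V : WaveField N, V.IsMeasurable ∧ SolvesCauchyOnCone p u₀ u₁ V x t₀} (T x)
  solves : ∀ x t₀, 0 < t₀ → t₀ < T x → SolvesCauchyOnCone p u₀ u₁ U x t₀

/-- `x₀` is a non-characteristic point of the domain `{(x, t) : t < T x}` with slope `δ₀`: the part
`t ≥ t₁` of the cone `{t < T x₀ - δ₀ |x - x₀|}` is contained in the domain, for some
`t₁ < T x₀`. -/
def IsNonCharacteristic {N : ℕ} (T : Space N → ℝ) (x₀ : Space N) (δ₀ : ℝ) : Prop :=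
  0 < δ₀ ∧ δ₀ < 1 ∧ ∃ t₁ : ℝ, t₁ < T x₀ ∧
    ∀ (x : Space N) (t : ℝ), t₁ ≤ t → t < T x₀ - δ₀ * ‖x - x₀‖ → t < T x

/-- The self-similar transform `w(y, s) = (T₀ - t)^{2/(p-1)} u(x, t)`, `y = (x - x₀) / (T₀ - t)`,
`s = - log (T₀ - t)`, and its first-order derivatives `∇ w` and `∂_s w` in the variables `(y, s)`,
given by the chain rule from those of `u`. -/
def selfSimilar {N : ℕ} (p : ℝ) (U : WaveField N) (x₀ : Space N) (T₀ : ℝ) : WaveField N where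
  val := fun y s =>
    Real.exp (-s) ^ (2 / (p - 1)) * U.val (x₀ + Real.exp (-s) • y) (T₀ - Real.exp (-s))
  grad := fun y s =>
    (Real.exp (-s) ^ (2 / (p - 1)) * Real.exp (-s)) •
      U.grad (x₀ + Real.exp (-s) • y) (T₀ - Real.exp (-s))
  dt := fun y s =>
    Real.exp (-s) ^ (2 / (p - 1)) *
      (-(2 / (p - 1)) * U.val (x₀ + Real.exp (-s) • y) (T₀ - Real.exp (-s))
        + Real.exp (-s) * (U.dt (x₀ + Real.exp (-s) • y) (T₀ - Real.exp (-s))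
          - inner ℝ y (U.grad (x₀ + Real.exp (-s) • y) (T₀ - Real.exp (-s)))))

/-- The weight `ρ_ε(y) = (1 - |y|²)^ε`. -/
def rho {N : ℕ} (ε : ℝ) (y : Space N) : ℝ := (1 - ‖y‖ ^ 2) ^ ε

/-- `∫_a^b ∫_B |w|^{p+1} ρ_ε / √(1 - |y|²) dy dτ`, with `B` the open unit ball. -/
def singularIntegral {N : ℕ} (p ε : ℝ) (W : WaveField N) (a b : ℝ) : ℝ≥0∞ :=
  ∫⁻ τ in Icc a b, ∫⁻ y in Metric.ball (0 : Space N) 1,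
    ENNReal.ofReal (|W.val y τ| ^ (p + 1) * (rho ε y / √(1 - ‖y‖ ^ 2)))

/-- `∫_a^b ∫_B (|∇w|² + (∂_s w)² + w² + |w|^{p+1}) ρ_ε dy dτ`, with `B` the open unit ball. -/
def weightedEnergyIntegral {N : ℕ} (p ε : ℝ) (W : WaveField N) (a b : ℝ) : ℝ≥0∞ :=
  ∫⁻ τ in Icc a b, ∫⁻ y in Metric.ball (0 : Space N) 1,
    ENNReal.ofReal
      ((‖W.grad y τ‖ ^ 2 + W.dt y τ ^ 2 + W.val y τ ^ 2 + |W.val y τ| ^ (p + 1)) * rho ε y)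

end

/-! Write σ = 1 - |y|² and a = 2/(p-1). In similarity variables the equation is (∂_s + y·∇)²w - Δw +
(2a+1)(∂_s + y·∇)w + a(a+1)w = |w|^{p-1}w, which degenerates at |y| = 1. The estimate comes from
multiplier identities whose weights are powers of σ, chosen so that the dangerous boundary terms
cancel.

Energy and Hardy (`multiplier_dS`, `radial_identity`, `energy_hardy_estimate`). Take the multiplier
∂_s w with weight σ^ε. The derivative of the weight gives (∂_s w)² with weight |y|²σ^{ε-1} and a
definite sign, while the cross terms ∂_s w (y·∇w) combine into one with the harmless weight σ^ε. The
divergence of σ^ε w² y does the same for w². Hence ∫ ((∂_s w)² + w²) σ^{ε-1} is bounded by the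
energy with weight σ^ε.

Pohozaev (`multiplier_self`, `multiplier_dR`, `pohozaev_estimate`). The multiplier w with weight f
of size σ^{ε-1/2} produces the wanted |w|^{p+1}σ^{ε-1/2}, but also -|∇w|²σ^{ε-1/2}, which is not
controlled. Subtract the identity for y·∇w with a weight F, of size σ^{ε+1/2}, whose derivative in σ
is f. All squares of derivatives then gain a factor σ, and |w|^{p+1} keeps the coefficient 1 -
2|y|²/(p+1) ≥ (p-1)/(p+1) > 0. The remaining products of y·∇w with ∂_s w or w carry the weight
σ^{ε-1/2}, the geometric mean of σ^ε and σ^{ε-1}, so Cauchy-Schwarz and the first estimate absorb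
them.

To make this rigorous the weights are truncated at σ = δ, with bounds independent of δ, and the
identities are applied to C² approximations, with the residual as an error. The constant in front of
the energy does not depend on δ; the factors of the approximation errors may. Thus the approximation
is removed first at fixed δ, and then δ tends to 0 by monotone convergence
(`singular_estimate_innerCylinder`, `singularIntegral_le`). The argument works at every vertex below
which the solution exists on all smaller cones, which gives (i) and (ii) at once. -/

/-! ### Differential operators on space-time and the divergence theorem. -/

noncomputable section SpaceTimeCalculus

variable {N : ℕ}

/-- The derivative in the time direction of a function on space-time. -/
def dS (F : Space N × ℝ → ℝ) (z : Space N × ℝ) : ℝ := fderiv ℝ F z (0, 1)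

/-- The `i`-th spatial derivative of a function on space-time. -/
def dI (i : Fin N) (F : Space N × ℝ → ℝ) (z : Space N × ℝ) : ℝ :=
  fderiv ℝ F z (EuclideanSpace.single i 1, 0)

/-- The radial derivative `y · ∇F`. -/
def dR (F : Space N × ℝ → ℝ) (z : Space N × ℝ) : ℝ := fderiv ℝ F z (z.1, 0)

/-- The spatial gradient of `w`, as a vector in space-time. -/
def gradVec (w : Space N × ℝ → ℝ) (z : Space N × ℝ) : Space N × ℝ :=
  ∑ i, dI i w z • ((EuclideanSpace.single i 1, 0) : Space N × ℝ)

/-- The derivative `∇w · ∇F`. -/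
def dG (w F : Space N × ℝ → ℝ) (z : Space N × ℝ) : ℝ := fderiv ℝ F z (gradVec w z)

/-- `|∇w|²`. -/
def gradSq (w : Space N × ℝ → ℝ) (z : Space N × ℝ) : ℝ := ∑ i, dI i w z ^ 2

/-- The spatial Laplacian `Δw`. -/
def lap (w : Space N × ℝ → ℝ) (z : Space N × ℝ) : ℝ := ∑ i, dI i (dI i w) z

lemma dG_eq_sum (w F : Space N × ℝ → ℝ) (z : Space N × ℝ) :
    dG w F z = ∑ i, dI i w z * dI i F z := by
  simp only [dG, gradVec, map_sum, map_smul, smul_eq_mul, dI]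

lemma space_time_fst_eq_sum (z : Space N × ℝ) :
    ((z.1, 0) : Space N × ℝ) =
      ∑ i, z.1 i • ((EuclideanSpace.single i 1, 0) : Space N × ℝ) := by
  refine Prod.ext ?_ ?_
  · ext j
    simp [Prod.fst_sum, Finset.sum_apply, Pi.single_apply]
  · simp [Prod.snd_sum]

lemma dR_eq_sum (F : Space N × ℝ → ℝ) (z : Space N × ℝ) :
    dR F z = ∑ i, z.1 i * dI i F z := by
  rw [dR, space_time_fst_eq_sum]
  simp only [map_sum, map_smul, smul_eq_mul, dI]

lemma dG_self (w : Space N × ℝ → ℝ) (z : Space N × ℝ) : dG w w z = gradSq w z := by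
  simp [dG_eq_sum, gradSq, sq]

lemma hasFDerivAt_coord (i : Fin N) (z : Space N × ℝ) :
    HasFDerivAt (fun z : Space N × ℝ => z.1 i)
      ((EuclideanSpace.proj (𝕜 := ℝ) i).comp (ContinuousLinearMap.fst ℝ (Space N) ℝ)) z :=
  ((EuclideanSpace.proj (𝕜 := ℝ) i).comp (ContinuousLinearMap.fst ℝ (Space N) ℝ)).hasFDerivAt

lemma contDiff_coord {n : WithTop ℕ∞} (i : Fin N) :
    ContDiff ℝ n (fun z : Space N × ℝ => z.1 i) :=
  ((EuclideanSpace.proj (𝕜 := ℝ) i).comp (ContinuousLinearMap.fst ℝ (Space N) ℝ)).contDiff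

section Regularity

variable {w : Space N × ℝ → ℝ}

lemma ContDiff.dS_of_two (hw : ContDiff ℝ 2 w) : ContDiff ℝ 1 (dS w) :=
  (hw.fderiv_right (m := 1) (by norm_num)).clm_apply contDiff_const

lemma ContDiff.dI_of_two (hw : ContDiff ℝ 2 w) (i : Fin N) : ContDiff ℝ 1 (dI i w) :=
  (hw.fderiv_right (m := 1) (by norm_num)).clm_apply contDiff_const

lemma ContDiff.dR_of_two (hw : ContDiff ℝ 2 w) : ContDiff ℝ 1 (dR w) :=
  (hw.fderiv_right (m := 1) (by norm_num)).clm_apply (contDiff_fst.prodMk contDiff_const)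

lemma ContDiff.gradSq_of_two (hw : ContDiff ℝ 2 w) : ContDiff ℝ 1 (gradSq w) :=
  ContDiff.sum fun i _ => (hw.dI_of_two i).pow 2

lemma ContDiff.continuous_dS (hw : ContDiff ℝ 1 w) : Continuous (dS w) :=
  (hw.continuous_fderiv one_ne_zero).clm_apply continuous_const

lemma ContDiff.continuous_dI (hw : ContDiff ℝ 1 w) (i : Fin N) : Continuous (dI i w) :=
  (hw.continuous_fderiv one_ne_zero).clm_apply continuous_const

lemma ContDiff.continuous_dR (hw : ContDiff ℝ 1 w) : Continuous (dR w) :=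
  (hw.continuous_fderiv one_ne_zero).clm_apply (continuous_fst.prodMk continuous_const)

lemma ContDiff.continuous_gradSq (hw : ContDiff ℝ 1 w) : Continuous (gradSq w) :=
  continuous_finsetSum _ fun i _ => (hw.continuous_dI i).pow 2

lemma ContDiff.continuous_lap (hw : ContDiff ℝ 2 w) : Continuous (lap w) :=
  continuous_finsetSum _ fun i _ => (hw.dI_of_two i).continuous_dI i

lemma hasFDerivAt_fderiv_apply (hw : ContDiff ℝ 2 w) (v z : Space N × ℝ) :
    HasFDerivAt (fun z => fderiv ℝ w z v) ((fderiv ℝ (fderiv ℝ w) z).flip v) z := by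
  have h := ((hw.fderiv_right (m := 1) (by norm_num)).differentiable one_ne_zero z).hasFDerivAt
  exact h.clm_apply (hasFDerivAt_const v z) |>.congr_fderiv (by ext <;> simp)

lemma fderiv_fderiv_comm (hw : ContDiff ℝ 2 w) (z v v' : Space N × ℝ) :
    fderiv ℝ (fun z => fderiv ℝ w z v) z v' = fderiv ℝ (fun z => fderiv ℝ w z v') z v := by
  rw [(hasFDerivAt_fderiv_apply hw v z).fderiv, (hasFDerivAt_fderiv_apply hw v' z).fderiv]
  have := (hw.contDiffAt (x := z)).isSymmSndFDerivAt (by simp)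
  exact this v' v

lemma dS_dI (hw : ContDiff ℝ 2 w) (i : Fin N) (z : Space N × ℝ) :
    dS (dI i w) z = dI i (dS w) z :=
  fderiv_fderiv_comm hw z _ _

lemma hasFDerivAt_dR (hw : ContDiff ℝ 2 w) (z : Space N × ℝ) :
    HasFDerivAt (dR w) (∑ i, (z.1 i • fderiv ℝ (dI i w) z + dI i w z •
      ((EuclideanSpace.proj (𝕜 := ℝ) i).comp (ContinuousLinearMap.fst ℝ (Space N) ℝ)))) z := by
  have : dR w = fun z => ∑ i, z.1 i * dI i w z := funext (dR_eq_sum w)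
  rw [this]
  exact HasFDerivAt.fun_sum fun i _ => (hasFDerivAt_coord i z).mul
    ((hw.dI_of_two i).differentiable one_ne_zero z).hasFDerivAt

lemma dS_dR (hw : ContDiff ℝ 2 w) (z : Space N × ℝ) : dS (dR w) z = dR (dS w) z := by
  rw [dR_eq_sum (dS w), dS, (hasFDerivAt_dR hw z).fderiv]
  simp only [← dS_dI hw]
  simp [dS]

/-- The commutator of ∂_i with y·∇ is ∂_i, since the coefficients of y·∇ are linear. -/
lemma dI_dR (hw : ContDiff ℝ 2 w) (i : Fin N) (z : Space N × ℝ) :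
    dI i (dR w) z = dI i w z + dR (dI i w) z := by
  have hc : ∀ j, dI j (dI i w) z = dI i (dI j w) z := fun j => fderiv_fderiv_comm hw z _ _
  rw [dR_eq_sum (dI i w), dI, (hasFDerivAt_dR hw z).fderiv]
  simp only [hc]
  simp [dI, Finset.sum_add_distrib, add_comm, PiLp.single_apply]

lemma dG_dR (hw : ContDiff ℝ 2 w) (z : Space N × ℝ) :
    dG w (dR w) z = gradSq w z + ∑ i, dI i w z * dR (dI i w) z := by
  simp only [dG_eq_sum, gradSq, dI_dR hw, mul_add, Finset.sum_add_distrib, sq]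

lemma hasFDerivAt_gradSq (hw : ContDiff ℝ 2 w) (z : Space N × ℝ) :
    HasFDerivAt (gradSq w) (∑ i, (2 * dI i w z) • fderiv ℝ (dI i w) z) z := by
  refine HasFDerivAt.fun_sum fun i _ => ?_
  simpa using ((hw.dI_of_two i).differentiable one_ne_zero z).hasFDerivAt.pow 2

/-- The correction by `gradSq` is the commutator of `dI_dR`; it becomes the term -φ|∇w|² of
`multiplier_dR`. -/
lemma dR_gradSq (hw : ContDiff ℝ 2 w) (z : Space N × ℝ) :
    dR (gradSq w) z = 2 * (dG w (dR w) z - gradSq w z) := by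
  rw [dG_dR hw, dR, (hasFDerivAt_gradSq hw z).fderiv]
  simp [dR, Finset.mul_sum, mul_assoc]

lemma dS_gradSq (hw : ContDiff ℝ 2 w) (z : Space N × ℝ) :
    dS (gradSq w) z = 2 * dG w (dS w) z := by
  rw [dG_eq_sum, dS, (hasFDerivAt_gradSq hw z).fderiv]
  simp only [← dS_dI hw]
  simp [dS, Finset.mul_sum, mul_assoc]

lemma sq_dR_le (w : Space N × ℝ → ℝ) (z : Space N × ℝ) :
    dR w z ^ 2 ≤ ‖z.1‖ ^ 2 * gradSq w z := by
  rw [dR_eq_sum, EuclideanSpace.norm_sq_eq]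
  simpa [gradSq] using Finset.sum_mul_sq_le_sq_mul_sq Finset.univ (fun i => z.1 i)
    (fun i => dI i w z)

end Regularity

section Divergence

lemma HasCompactSupport.integrable_fderiv_apply {F : Space N × ℝ → ℝ} (hF : ContDiff ℝ 1 F)
    (hc : HasCompactSupport F) (v : Space N × ℝ) : Integrable (fun z => fderiv ℝ F z v) :=
  ((hF.continuous_fderiv one_ne_zero).clm_apply continuous_const).integrable_of_hasCompactSupport
    (hc.fderiv_apply (𝕜 := ℝ) v)

instance isAddHaarMeasure_space_time :
    (volume : Measure (Space N × ℝ)).IsAddHaarMeasure :=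
  inferInstanceAs ((volume : Measure (Space N)).prod volume).IsAddHaarMeasure

/-- Integration by parts against the constant 1. -/
lemma integral_fderiv_apply_eq_zero {F : Space N × ℝ → ℝ} (hF : ContDiff ℝ 1 F)
    (hc : HasCompactSupport F) (v : Space N × ℝ) : ∫ z, fderiv ℝ F z v = 0 := by
  have h := integral_mul_fderiv_eq_neg_fderiv_mul_of_integrable (μ := volume)
    (f := fun _ : Space N × ℝ => (1 : ℝ)) (g := F) (v := v) (by simp)
    (by simpa using hc.integrable_fderiv_apply hF v)
    (by simpa using hF.continuous.integrable_of_hasCompactSupport hc)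
    (fun _ _ => differentiableAt_const _) (fun z _ => hF.differentiable one_ne_zero z)
  simpa using h

/-- The integral of the divergence of a compactly supported field vanishes. -/
lemma integral_sum_dI_eq_zero {F : Fin N → Space N × ℝ → ℝ} (hF : ∀ i, ContDiff ℝ 1 (F i))
    (hc : ∀ i, HasCompactSupport (F i)) :
    Integrable (fun z => ∑ i, dI i (F i) z) ∧ ∫ z, ∑ i, dI i (F i) z = 0 := by
  have hi : ∀ i ∈ Finset.univ, Integrable (fun z => dI i (F i) z) := fun i _ =>
    (hc i).integrable_fderiv_apply (hF i) _
  refine ⟨integrable_finsetSum _ hi, ?_⟩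
  rw [integral_finsetSum _ hi]
  exact Finset.sum_eq_zero fun i _ => integral_fderiv_apply_eq_zero (hF i) (hc i) _

/-- The divergence theorem for `A ∂_s + B y·∇ - H ∇w`. -/
lemma integral_divergence_eq_zero {w A B H G : Space N × ℝ → ℝ}
    {A' B' H' : Space N × ℝ → (Space N × ℝ →L[ℝ] ℝ)} (hw : ContDiff ℝ 2 w)
    (hA : ContDiff ℝ 1 A) (hB : ContDiff ℝ 1 B) (hH : ContDiff ℝ 1 H)
    (cA : HasCompactSupport A) (cB : HasCompactSupport B) (cH : HasCompactSupport H)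
    (dA : ∀ z, HasFDerivAt A (A' z) z) (dB : ∀ z, HasFDerivAt B (B' z) z)
    (dH : ∀ z, HasFDerivAt H (H' z) z)
    (hG : ∀ z, G z = A' z (0, 1) + (B' z (z.1, 0) + N * B z)
      - (H z * lap w z + H' z (gradVec w z))) :
    Integrable G ∧ ∫ z, G z = 0 := by
  -- The divergence of y B is y·∇B + N B; this is where the dimension enters.
  have h1 := integral_sum_dI_eq_zero (F := fun i z => z.1 i * B z)
    (fun i => (contDiff_coord i).mul hB) (fun i => cB.mul_left)
  have h2 := integral_sum_dI_eq_zero (F := fun i z => dI i w z * H z)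
    (fun i => (hw.dI_of_two i).mul hH) (fun i => cH.mul_left)
  have e1 : ∀ z, ∑ i, dI i (fun z => z.1 i * B z) z = dR B z + N * B z := by
    intro z
    have : ∀ i, dI i (fun z => z.1 i * B z) z = z.1 i * dI i B z + B z := by
      intro i
      rw [dI, ((hasFDerivAt_coord i z).fun_mul (hB.differentiable one_ne_zero z).hasFDerivAt).fderiv]
      simp [dI]
    simp [this, Finset.sum_add_distrib, dR_eq_sum]
  have e2 : ∀ z, ∑ i, dI i (fun z => dI i w z * H z) z = H z * lap w z + dG w H z := by
    intro z
    have : ∀ i, dI i (fun z => dI i w z * H z) z =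
        dI i w z * dI i H z + H z * dI i (dI i w) z := by
      intro i
      rw [dI, (((hw.dI_of_two i).differentiable one_ne_zero z).hasFDerivAt.fun_mul
        (hH.differentiable one_ne_zero z).hasFDerivAt).fderiv]
      simp [dI]
    simp only [this, Finset.sum_add_distrib, dG_eq_sum, lap, Finset.mul_sum]
    ring
  simp only [e1] at h1
  simp only [e2] at h2
  have h0 : Integrable (fun z => dS A z) := cA.integrable_fderiv_apply hA _
  have eG : G = fun z => dS A z + (dR B z + N * B z) - (H z * lap w z + dG w H z) := by
    funext z
    rw [hG, dS, dR, dG, (dA z).fderiv, (dB z).fderiv, (dH z).fderiv]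
  rw [eG]
  refine ⟨(h0.add h1.1).sub h2.1, ?_⟩
  have := integral_sub (h0.add h1.1) h2.1
  have h4 := integral_add h0 h1.1
  simp only [Pi.add_apply] at this
  rw [this, h4, h1.2, h2.2]
  simp [dS, integral_fderiv_apply_eq_zero hA cA]

end Divergence

/-! ### The multiplier identities. -/

section MultiplierIdentities

variable {p : ℝ} {w φ : Space N × ℝ → ℝ}

lemma hasFDerivAt_abs_rpow_comp (hp : 1 < p) (hw : ContDiff ℝ 1 w) (z : Space N × ℝ) :
    HasFDerivAt (fun z => |w z| ^ (p + 1)) (((p + 1) * (|w z| ^ (p - 1) * w z)) • fderiv ℝ w z)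
      z := by
  have h := (hasDerivAt_abs_rpow (w z) (p := p + 1) (by linarith)).comp_hasFDerivAt z
    (hw.differentiable one_ne_zero z).hasFDerivAt
  refine h.congr_fderiv ?_
  rw [show p + 1 - 2 = p - 1 by ring, mul_assoc]

lemma contDiff_abs_rpow_comp (hp : 1 < p) (hw : ContDiff ℝ 1 w) :
    ContDiff ℝ 1 (fun z => |w z| ^ (p + 1)) :=
  (contDiff_norm_rpow (E := ℝ) (p := p + 1) (by linarith)).comp hw

/-- The left-hand side of the equation in similarity variables, without the damping terms. -/
def waveOp (w : Space N × ℝ → ℝ) (z : Space N × ℝ) : ℝ :=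
  dS (dS w) z + 2 * dS (dR w) z + dR (dR w) z - lap w z

/-- The identity obtained with the multiplier `φ ∂_s w`. -/
lemma multiplier_dS (hp : 1 < p) (c : ℝ) (hw : ContDiff ℝ 2 w) (hφ : ContDiff ℝ 1 φ)
    (hc : HasCompactSupport φ) :
    let G := fun z => φ z * dS w z * (waveOp w z + c * w z - |w z| ^ (p - 1) * w z)
        + dS φ z * ((dS w z ^ 2 - dR w z ^ 2 + gradSq w z + c * w z ^ 2) / 2
          - |w z| ^ (p + 1) / (p + 1))
        + (dR φ z + N * φ z) * (dS w z ^ 2 + dR w z * dS w z) - dS w z * dG w φ z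
    Integrable G ∧ ∫ z, G z = 0 := by
  intro G
  have hw1 : ContDiff ℝ 1 w := hw.of_le (by norm_num)
  have hpw := contDiff_abs_rpow_comp hp hw1
  have dφ := fun z => (hφ.differentiable one_ne_zero z).hasFDerivAt
  have d0 := fun z => (hw1.differentiable one_ne_zero z).hasFDerivAt
  have ds := fun z => (hw.dS_of_two.differentiable one_ne_zero z).hasFDerivAt
  have dr := fun z => (hw.dR_of_two.differentiable one_ne_zero z).hasFDerivAt
  have dq := fun z => (hw.gradSq_of_two.differentiable one_ne_zero z).hasFDerivAt
  have dp := hasFDerivAt_abs_rpow_comp hp hw1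
  -- Each term of ∂_s w times the equation without damping is a divergence; for instance ∂_s w
  -- (y·∇)²w = y·∇(∂_s w y·∇w) - ∂_s (y·∇w)²/2. What survives comes from derivatives of φ and from
  -- div y = N.
  refine integral_divergence_eq_zero hw
    (A := fun z => φ z * ((dS w z ^ 2 - dR w z ^ 2 + gradSq w z + c * w z ^ 2) * 2⁻¹
          - |w z| ^ (p + 1) * (p + 1)⁻¹))
    (B := fun z => φ z * (dS w z ^ 2 + dR w z * dS w z)) (H := fun z => φ z * dS w z)
    (hφ.mul ((((((hw.dS_of_two.pow 2).sub (hw.dR_of_two.pow 2)).add hw.gradSq_of_two).add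
      (contDiff_const.mul (hw1.pow 2))).mul contDiff_const).sub (hpw.mul contDiff_const)))
    (hφ.mul ((hw.dS_of_two.pow 2).add (hw.dR_of_two.mul hw.dS_of_two)))
    (hφ.mul hw.dS_of_two) hc.mul_right hc.mul_right hc.mul_right
    (fun z => (dφ z).mul (((((((ds z).pow 2).sub ((dr z).pow 2)).add (dq z)).add
      (((d0 z).pow 2).const_mul c)).mul_const 2⁻¹).sub ((dp z).mul_const (p + 1)⁻¹)))
    (fun z => (dφ z).mul (((ds z).pow 2).add ((dr z).mul (ds z))))
    (fun z => (dφ z).mul (ds z)) (fun z => ?_)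
  have q1 : fderiv ℝ (gradSq w) z (0, 1) = 2 * dG w (dS w) z := dS_gradSq hw z
  have q2 : fderiv ℝ (dR w) z (0, 1) = dR (dS w) z := dS_dR hw z
  have hp1 : p + 1 ≠ 0 := by linarith
  simp only [G, waveOp, dS_dR hw, add_apply, sub_apply,
    smul_apply, smul_eq_mul, q1, q2, nsmul_eq_mul,
    Nat.cast_ofNat]
  simp only [← dS.eq_1, ← dR.eq_1, ← dG.eq_1]
  field_simp
  ring

/-- The identity obtained with the multiplier `φ y·∇w`. -/
lemma multiplier_dR (hp : 1 < p) (hw : ContDiff ℝ 2 w) (hφ : ContDiff ℝ 1 φ)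
    (hc : HasCompactSupport φ) :
    let G := fun z => φ z * dR w z * (waveOp w z - |w z| ^ (p - 1) * w z)
        + dS φ z * (dS w z * dR w z + dR w z ^ 2)
        + (dR φ z + N * φ z) * ((gradSq w z + dR w z ^ 2 - dS w z ^ 2) / 2
          - |w z| ^ (p + 1) / (p + 1)) - dR w z * dG w φ z - φ z * gradSq w z
    Integrable G ∧ ∫ z, G z = 0 := by
  intro G
  have hw1 : ContDiff ℝ 1 w := hw.of_le (by norm_num)
  have hpw := contDiff_abs_rpow_comp hp hw1
  have dφ := fun z => (hφ.differentiable one_ne_zero z).hasFDerivAt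
  have ds := fun z => (hw.dS_of_two.differentiable one_ne_zero z).hasFDerivAt
  have dr := fun z => (hw.dR_of_two.differentiable one_ne_zero z).hasFDerivAt
  have dq := fun z => (hw.gradSq_of_two.differentiable one_ne_zero z).hasFDerivAt
  have dp := hasFDerivAt_abs_rpow_comp hp hw1
  -- The nonlinearity is now y·∇ of its primitive, so |w|^{p+1}/(p+1) meets the divergence of φ y
  -- and no longer ∂_s φ.
  refine integral_divergence_eq_zero hw
    (A := fun z => φ z * (dS w z * dR w z + dR w z ^ 2))
    (B := fun z => φ z * ((gradSq w z + dR w z ^ 2 - dS w z ^ 2) * 2⁻¹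
          - |w z| ^ (p + 1) * (p + 1)⁻¹)) (H := fun z => φ z * dR w z)
    (hφ.mul ((hw.dS_of_two.mul hw.dR_of_two).add (hw.dR_of_two.pow 2)))
    (hφ.mul ((((hw.gradSq_of_two.add (hw.dR_of_two.pow 2)).sub (hw.dS_of_two.pow 2)).mul
      contDiff_const).sub (hpw.mul contDiff_const)))
    (hφ.mul hw.dR_of_two) hc.mul_right hc.mul_right hc.mul_right
    (fun z => (dφ z).mul (((ds z).mul (dr z)).add ((dr z).pow 2)))
    (fun z => (dφ z).mul (((((dq z).add ((dr z).pow 2)).sub ((ds z).pow 2)).mul_const 2⁻¹).sub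
      ((dp z).mul_const (p + 1)⁻¹)))
    (fun z => (dφ z).mul (dr z)) (fun z => ?_)
  have q1 : fderiv ℝ (gradSq w) z (z.1, 0) = 2 * (dG w (dR w) z - gradSq w z) := dR_gradSq hw z
  have q2 : fderiv ℝ (dR w) z (0, 1) = dR (dS w) z := dS_dR hw z
  have hp1 : p + 1 ≠ 0 := by linarith
  simp only [G, waveOp, dS_dR hw, add_apply, sub_apply,
    smul_apply, smul_eq_mul, q1, q2,
    nsmul_eq_mul, Nat.cast_ofNat]
  simp only [← dS.eq_1, ← dR.eq_1, ← dG.eq_1]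
  field_simp
  ring

/-- The identity obtained with the multiplier `φ w`. -/
lemma multiplier_self (hw : ContDiff ℝ 2 w) (hφ : ContDiff ℝ 1 φ) (hc : HasCompactSupport φ) :
    let G := fun z => φ z * w z * waveOp w z
        + φ z * (dS w z ^ 2 + 2 * dR w z * dS w z + dR w z ^ 2 - gradSq w z)
        + dS φ z * (w z * dS w z + 2 * (dR w z * w z))
        + (dR φ z + N * φ z) * (dR w z * w z) - w z * dG w φ z
    Integrable G ∧ ∫ z, G z = 0 := by
  intro G
  have hw1 : ContDiff ℝ 1 w := hw.of_le (by norm_num)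
  have dφ := fun z => (hφ.differentiable one_ne_zero z).hasFDerivAt
  have d0 := fun z => (hw1.differentiable one_ne_zero z).hasFDerivAt
  have ds := fun z => (hw.dS_of_two.differentiable one_ne_zero z).hasFDerivAt
  have dr := fun z => (hw.dR_of_two.differentiable one_ne_zero z).hasFDerivAt
  -- With the multiplier w the nonlinearity is not a divergence. It enters only when `waveOp w` is
  -- replaced through the equation, and then yields φ|w|^{p+1}.
  refine integral_divergence_eq_zero hw
    (A := fun z => φ z * (w z * dS w z + 2 * (dR w z * w z)))
    (B := fun z => φ z * (dR w z * w z)) (H := fun z => φ z * w z)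
    (hφ.mul ((hw1.mul hw.dS_of_two).add (contDiff_const.mul (hw.dR_of_two.mul hw1))))
    (hφ.mul (hw.dR_of_two.mul hw1)) (hφ.mul hw1) hc.mul_right hc.mul_right hc.mul_right
    (fun z => (dφ z).mul (((d0 z).mul (ds z)).add (((dr z).mul (d0 z)).const_mul 2)))
    (fun z => (dφ z).mul ((dr z).mul (d0 z))) (fun z => (dφ z).mul (d0 z)) (fun z => ?_)
  have q2 : fderiv ℝ (dR w) z (0, 1) = dR (dS w) z := dS_dR hw z
  have q3 : fderiv ℝ w z (gradVec w z) = gradSq w z := dG_self w z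
  simp only [G, waveOp, dS_dR hw, add_apply, smul_apply,
    smul_eq_mul, q2, q3]
  simp only [← dS.eq_1, ← dR.eq_1, ← dG.eq_1]
  ring

/-- The identity behind the Hardy inequality. -/
lemma radial_identity (hw : ContDiff ℝ 2 w) (hφ : ContDiff ℝ 1 φ) (hc : HasCompactSupport φ) :
    let G := fun z => (dR φ z + N * φ z) * w z ^ 2 + 2 * φ z * (w z * dR w z)
    Integrable G ∧ ∫ z, G z = 0 := by
  intro G
  have hw1 : ContDiff ℝ 1 w := hw.of_le (by norm_num)
  have dφ := fun z => (hφ.differentiable one_ne_zero z).hasFDerivAt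
  have d0 := fun z => (hw1.differentiable one_ne_zero z).hasFDerivAt
  refine integral_divergence_eq_zero hw
    (A := fun _ => 0) (B := fun z => φ z * w z ^ 2) (H := fun _ => 0)
    contDiff_const (hφ.mul (hw1.pow 2)) contDiff_const HasCompactSupport.zero hc.mul_right
    HasCompactSupport.zero (fun z => hasFDerivAt_const _ z)
    (fun z => (dφ z).mul ((d0 z).pow 2)) (fun z => hasFDerivAt_const _ z) (fun z => ?_)
  simp only [G, add_apply, smul_apply, smul_eq_mul,
    zero_apply, nsmul_eq_mul, Nat.cast_ofNat]
  simp only [← dR.eq_1]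
  ring

end MultiplierIdentities
end SpaceTimeCalculus

/-! ### Time cutoffs and truncated powers of the distance to the boundary. -/

section Cutoffs

lemma smoothTransition_contDiff_two : ContDiff ℝ 2 Real.smoothTransition :=
  Real.smoothTransition.contDiff (n := 2)

lemma deriv_smoothTransition_contDiff_one : ContDiff ℝ 1 (deriv Real.smoothTransition) :=
  ((contDiff_succ_iff_deriv (n := 1)).1 smoothTransition_contDiff_two).2.2

lemma deriv_smoothTransition_nonneg (u : ℝ) : 0 ≤ deriv Real.smoothTransition u :=
  Real.smoothTransition.monotone.deriv_nonneg

/-- At these points, endpoints included, the transition function attains its global minimum or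
maximum. -/
lemma deriv_smoothTransition_eq_zero {u : ℝ} (hu : u ≤ 0 ∨ 1 ≤ u) :
    deriv Real.smoothTransition u = 0 := by
  rcases hu with hu | hu
  · refine IsLocalMin.deriv_eq_zero (Eventually.of_forall fun v => ?_)
    rw [Real.smoothTransition.zero_of_nonpos hu]
    exact Real.smoothTransition.nonneg v
  · refine IsLocalMax.deriv_eq_zero (Eventually.of_forall fun v => ?_)
    rw [Real.smoothTransition.one_of_one_le hu]
    exact Real.smoothTransition.le_one v

lemma deriv_deriv_smoothTransition_eq_zero {u : ℝ} (hu : u ≤ 0 ∨ 1 ≤ u) :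
    deriv (deriv Real.smoothTransition) u = 0 := by
  refine IsLocalMin.deriv_eq_zero (Eventually.of_forall fun v => ?_)
  rw [deriv_smoothTransition_eq_zero hu]
  exact deriv_smoothTransition_nonneg v

lemma exists_bound_of_eq_zero_off_Icc {h : ℝ → ℝ} (hc : Continuous h)
    (h0 : ∀ u, u ≤ 0 ∨ 1 ≤ u → h u = 0) : ∃ M : ℝ, 0 ≤ M ∧ ∀ u, |h u| ≤ M := by
  obtain ⟨M, hM⟩ := isCompact_Icc.exists_bound_of_continuousOn (s := Icc (0 : ℝ) 1)
    hc.continuousOn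
  have hM0 : 0 ≤ M := (norm_nonneg _).trans (hM 0 (by simp))
  refine ⟨M, hM0, fun u => ?_⟩
  by_cases hu : u ∈ Icc (0 : ℝ) 1
  · exact hM u hu
  · rw [h0 u]
    · simpa using hM0
    · by_contra! hcon
      exact hu ⟨hcon.1.le, hcon.2.le⟩

lemma exists_deriv_smoothTransition_bound :
    ∃ M : ℝ, 0 ≤ M ∧ ∀ u, |deriv Real.smoothTransition u| ≤ M :=
  exists_bound_of_eq_zero_off_Icc deriv_smoothTransition_contDiff_one.continuous
    fun _ => deriv_smoothTransition_eq_zero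

lemma exists_deriv_deriv_smoothTransition_bound :
    ∃ M : ℝ, 0 ≤ M ∧ ∀ u, |deriv (deriv Real.smoothTransition) u| ≤ M :=
  exists_bound_of_eq_zero_off_Icc (deriv_smoothTransition_contDiff_one.continuous_deriv le_rfl)
    fun _ => deriv_deriv_smoothTransition_eq_zero

lemma hasDerivAt_smoothTransition (u : ℝ) :
    HasDerivAt Real.smoothTransition (deriv Real.smoothTransition u) u :=
  (smoothTransition_contDiff_two.differentiable two_ne_zero u).hasDerivAt

lemma hasDerivAt_deriv_smoothTransition (u : ℝ) :
    HasDerivAt (deriv Real.smoothTransition) (deriv (deriv Real.smoothTransition) u) u :=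
  (deriv_smoothTransition_contDiff_one.differentiable one_ne_zero u).hasDerivAt

/-- Cutoff functions in time, with a uniform bound for the derivative. -/
lemma exists_time_cutoff : ∃ D : ℝ, 1 ≤ D ∧ ∀ α β : ℝ, ∃ χ χ' : ℝ → ℝ,
    (∀ τ, HasDerivAt χ (χ' τ) τ) ∧ Continuous χ' ∧ (∀ τ, 0 ≤ χ τ ∧ χ τ ≤ 1) ∧
    (∀ τ, |χ' τ| ≤ D) ∧ (∀ τ, α + 1 ≤ τ → τ ≤ β - 1 → χ τ = 1) ∧
    (∀ τ, τ ∉ Icc α β → χ τ = 0 ∧ χ' τ = 0) := by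
  obtain ⟨M, hM0, hM⟩ := exists_deriv_smoothTransition_bound
  -- Each of the two transitions contributes at most M to the derivative; the 1 secures `1 ≤ D`.
  refine ⟨2 * M + 1, by linarith, fun α β => ?_⟩
  have b0 := Real.smoothTransition.nonneg
  have b1 := Real.smoothTransition.le_one
  refine ⟨fun τ => Real.smoothTransition (τ - α) * Real.smoothTransition (β - τ),
    fun τ => deriv Real.smoothTransition (τ - α) * Real.smoothTransition (β - τ)
      - Real.smoothTransition (τ - α) * deriv Real.smoothTransition (β - τ), ?_, ?_, ?_, ?_, ?_, ?_⟩
  · intro τ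
    have h1 := (hasDerivAt_smoothTransition (τ - α)).comp τ ((hasDerivAt_id τ).sub_const α)
    have h2 := (hasDerivAt_smoothTransition (β - τ)).comp τ ((hasDerivAt_id τ).const_sub β)
    refine (h1.mul h2).congr_deriv ?_
    simp only [Function.comp, id]
    ring
  · have c := deriv_smoothTransition_contDiff_one.continuous
    have c' := Real.smoothTransition.continuous
    fun_prop
  · exact fun τ => ⟨mul_nonneg (b0 _) (b0 _), mul_le_one₀ (b1 _) (b0 _) (b1 _)⟩
  · intro τ
    have k1 : |deriv Real.smoothTransition (τ - α) * Real.smoothTransition (β - τ)| ≤ M := by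
      rw [abs_mul, abs_of_nonneg (b0 (β - τ))]
      exact (mul_le_of_le_one_right (abs_nonneg _) (b1 _)).trans (hM _)
    have k2 : |Real.smoothTransition (τ - α) * deriv Real.smoothTransition (β - τ)| ≤ M := by
      rw [mul_comm, abs_mul, abs_of_nonneg (b0 (τ - α))]
      exact (mul_le_of_le_one_right (abs_nonneg _) (b1 _)).trans (hM _)
    have := abs_sub (deriv Real.smoothTransition (τ - α) * Real.smoothTransition (β - τ))
      (Real.smoothTransition (τ - α) * deriv Real.smoothTransition (β - τ))
    linarith
  · intro τ h1 h2
    simp only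
    rw [Real.smoothTransition.one_of_one_le (by linarith),
      Real.smoothTransition.one_of_one_le (by linarith), one_mul]
  · intro τ hτ
    have : τ - α ≤ 0 ∨ β - τ ≤ 0 := by
      by_contra! hcon
      exact hτ ⟨by linarith, by linarith⟩
    rcases this with h | h
    · simp [Real.smoothTransition.zero_of_nonpos h, deriv_smoothTransition_eq_zero (Or.inl h)]
    · simp [Real.smoothTransition.zero_of_nonpos h, deriv_smoothTransition_eq_zero (Or.inl h)]

/-- Truncations of the power `σ ^ b` near `σ = 0` with scale invariant bounds. -/
lemma exists_truncated_power (b : ℝ) (hb : 0 < b) : ∃ C : ℝ, 1 ≤ C ∧ ∀ δ : ℝ, 0 < δ →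
    ∃ f f' f'' : ℝ → ℝ, (∀ x, HasDerivAt f (f' x) x) ∧ (∀ x, HasDerivAt f' (f'' x) x) ∧
      Continuous f'' ∧ (∀ x, x ≤ δ → f x = 0 ∧ f' x = 0 ∧ f'' x = 0) ∧
      (∀ x, 0 < x → (0 ≤ f x ∧ f x ≤ C * x ^ b) ∧ (0 ≤ f' x ∧ x * f' x ≤ C * x ^ b) ∧
        |x ^ 2 * f'' x| ≤ C * x ^ b) ∧
      (∀ x, 2 * δ ≤ x → b * x ^ b ≤ x * f' x) := by
  obtain ⟨M, hM0, hM⟩ := exists_deriv_smoothTransition_bound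
  obtain ⟨M', hM0', hM'⟩ := exists_deriv_deriv_smoothTransition_bound
  -- The truncation is x^b κ(x/δ), where κ rises from 0 to 1 on [1, 2]. Where the derivatives of κ
  -- live, x/δ ≤ 2; hence (x/δ)κ' ≤ 2M and (x/δ)²|κ''| ≤ 4M', free of δ. The constant sums the
  -- bounds for f, x f' and x² f''.
  refine ⟨1 + b + 2 * M + b * |b - 1| + 4 * b * M + 4 * M', ?_, fun δ hδ => ?_⟩
  · have := mul_nonneg hb.le (abs_nonneg (b - 1))
    nlinarith [mul_nonneg hb.le hM0]
  set κ := fun u : ℝ => Real.smoothTransition (u - 1) with hκ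
  set κ' := fun u : ℝ => deriv Real.smoothTransition (u - 1) with hκ'
  set κ'' := fun u : ℝ => deriv (deriv Real.smoothTransition) (u - 1) with hκ''
  have dκ : ∀ x, HasDerivAt (fun x => κ (x / δ)) (κ' (x / δ) / δ) x := fun x => by
    have := (hasDerivAt_smoothTransition (x / δ - 1)).comp x
      (((hasDerivAt_id x).div_const δ).sub_const 1)
    exact this.congr_deriv (by simp [κ', div_eq_mul_inv])
  have dκ' : ∀ x, HasDerivAt (fun x => κ' (x / δ)) (κ'' (x / δ) / δ) x := fun x => by
    have := (hasDerivAt_deriv_smoothTransition (x / δ - 1)).comp x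
      (((hasDerivAt_id x).div_const δ).sub_const 1)
    exact this.congr_deriv (by simp [κ'', div_eq_mul_inv])
  have z0 : ∀ u, u ≤ 1 → κ u = 0 := fun u hu =>
    Real.smoothTransition.zero_of_nonpos (by linarith)
  have z1 : ∀ u, u ≤ 1 ∨ 2 ≤ u → κ' u = 0 := fun u hu => deriv_smoothTransition_eq_zero
    (hu.imp (fun h => by linarith) (fun h => by linarith))
  have z2 : ∀ u, u ≤ 1 ∨ 2 ≤ u → κ'' u = 0 := fun u hu => deriv_deriv_smoothTransition_eq_zero
    (hu.imp (fun h => by linarith) (fun h => by linarith))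
  set f := fun x : ℝ => x ^ b * κ (x / δ) with hf
  set f' := fun x : ℝ => b * x ^ (b - 1) * κ (x / δ) + x ^ b * (κ' (x / δ) / δ) with hf'
  set f'' := fun x : ℝ => b * ((b - 1) * x ^ (b - 1 - 1)) * κ (x / δ)
    + b * x ^ (b - 1) * (κ' (x / δ) / δ)
    + (b * x ^ (b - 1) * (κ' (x / δ) / δ) + x ^ b * (κ'' (x / δ) / δ / δ)) with hf''
  have small : ∀ x, x ≤ δ → x / δ ≤ 1 := fun x hx => (div_le_one hδ).2 hx
  have zf : ∀ x, x ≤ δ → f x = 0 := fun x hx => by simp [hf, z0 _ (small x hx)]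
  have zf' : ∀ x, x ≤ δ → f' x = 0 := fun x hx => by
    simp [hf', z0 _ (small x hx), z1 _ (Or.inl (small x hx))]
  have zf'' : ∀ x, x ≤ δ → f'' x = 0 := fun x hx => by
    simp [hf'', z0 _ (small x hx), z1 _ (Or.inl (small x hx)), z2 _ (Or.inl (small x hx))]
  -- The real power may be singular at x ≤ 0, but κ vanishes in a neighbourhood of such points.
  have near : ∀ x, ¬ 0 < x → ∀ᶠ t in 𝓝 x, t ≤ δ := fun x hx =>
    (Iio_mem_nhds (show x < δ by linarith)) |> fun h => by
      filter_upwards [h] with t ht using le_of_lt ht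
  refine ⟨f, f', f'', ?_, ?_, ?_, fun x hx => ⟨zf x hx, zf' x hx, zf'' x hx⟩, ?_, ?_⟩
  · intro x
    by_cases hx : 0 < x
    · exact (Real.hasDerivAt_rpow_const (p := b) (Or.inl hx.ne')).mul (dκ x)
    · rw [zf' x (by linarith)]
      exact (hasDerivAt_const x (0 : ℝ)).congr_of_eventuallyEq ((near x hx).mono zf)
  · intro x
    by_cases hx : 0 < x
    · exact (((Real.hasDerivAt_rpow_const (p := b - 1) (Or.inl hx.ne')).const_mul b).mul
        (dκ x)).add ((Real.hasDerivAt_rpow_const (p := b) (Or.inl hx.ne')).mul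
          ((dκ' x).div_const δ))
    · rw [zf'' x (by linarith)]
      exact (hasDerivAt_const x (0 : ℝ)).congr_of_eventuallyEq ((near x hx).mono zf')
  · rw [continuous_iff_continuousAt]
    intro x
    by_cases hx : 0 < x
    · have r : ∀ q : ℝ, ContinuousAt (fun x : ℝ => x ^ q) x := fun q =>
        Real.continuousAt_rpow_const x q (Or.inl hx.ne')
      have c0 : Continuous (fun x => κ (x / δ)) := by
        have := Real.smoothTransition.continuous
        fun_prop
      have c1 : Continuous (fun x => κ' (x / δ)) := by
        have := deriv_smoothTransition_contDiff_one.continuous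
        fun_prop
      have c2 : Continuous (fun x => κ'' (x / δ)) := by
        have := deriv_smoothTransition_contDiff_one.continuous_deriv le_rfl
        fun_prop
      have c0' := c0.continuousAt (x := x)
      have c1' := c1.continuousAt (x := x)
      have c2' := c2.continuousAt (x := x)
      have r1 := r (b - 1 - 1)
      have r2 := r (b - 1)
      have r3 := r b
      exact (((continuousAt_const.mul (continuousAt_const.mul r1)).mul c0').add
        ((continuousAt_const.mul r2).mul (c1'.div_const δ))).add
        (((continuousAt_const.mul r2).mul (c1'.div_const δ)).add
          (r3.mul ((c2'.div_const δ).div_const δ)))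
    · exact continuousAt_const.congr ((near x hx).mono fun t ht => (zf'' t ht).symm)
  · intro x hx
    have k0 : 0 ≤ κ (x / δ) := Real.smoothTransition.nonneg _
    have k1 : κ (x / δ) ≤ 1 := Real.smoothTransition.le_one _
    have X0 : 0 < x ^ b := Real.rpow_pos_of_pos hx b
    have e1 : x * x ^ (b - 1) = x ^ b := by
      rw [← Real.rpow_one_add' hx.le (by linarith)]; congr 1; ring
    have e2 : x ^ 2 * x ^ (b - 1 - 1) = x ^ b := by
      rw [← Real.rpow_natCast x 2, ← Real.rpow_add hx]; congr 1; push_cast; ring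
    have u1 : |x / δ * κ' (x / δ)| ≤ 2 * M := by
      by_cases h : x / δ ≤ 1 ∨ 2 ≤ x / δ
      · rw [z1 _ h]; simp; exact hM0
      · push Not at h
        rw [abs_mul, abs_of_pos (by linarith : 0 < x / δ)]
        exact mul_le_mul h.2.le (hM _) (abs_nonneg _) (by norm_num)
    have u2 : |(x / δ) ^ 2 * κ'' (x / δ)| ≤ 4 * M' := by
      by_cases h : x / δ ≤ 1 ∨ 2 ≤ x / δ
      · rw [z2 _ h]; simp; exact hM0'
      · push Not at h
        rw [abs_mul, abs_of_nonneg (sq_nonneg _)]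
        exact mul_le_mul (by nlinarith) (hM' _) (abs_nonneg _) (by norm_num)
    have u1' : 0 ≤ κ' (x / δ) := deriv_smoothTransition_nonneg _
    have E1 : x * f' x = x ^ b * (b * κ (x / δ) + x / δ * κ' (x / δ)) := by
      simp only [hf']; rw [← e1]; ring
    have E2 : x ^ 2 * f'' x = x ^ b * (b * (b - 1) * κ (x / δ) + 2 * b * (x / δ * κ' (x / δ))
        + (x / δ) ^ 2 * κ'' (x / δ)) := by
      have : x ^ 2 * f'' x = b * (b - 1) * (x ^ 2 * x ^ (b - 1 - 1)) * κ (x / δ)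
        + 2 * b * (x * x ^ (b - 1)) * (x / δ * κ' (x / δ))
        + x ^ b * ((x / δ) ^ 2 * κ'' (x / δ)) := by
        simp only [hf'']; ring
      rw [this, e1, e2]; ring
    have hbb := mul_nonneg hb.le (abs_nonneg (b - 1))
    have hbM := mul_nonneg hb.le hM0
    refine ⟨⟨by positivity, ?_⟩, ⟨?_, ?_⟩, ?_⟩
    · simp only [hf]
      rw [mul_comm]
      exact mul_le_mul_of_nonneg_right (by nlinarith) X0.le
    · simp only [hf']; positivity
    · rw [E1, mul_comm]
      refine mul_le_mul_of_nonneg_right ?_ X0.le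
      have := le_abs_self (x / δ * κ' (x / δ))
      nlinarith
    · rw [E2, abs_mul, abs_of_pos X0, mul_comm]
      refine mul_le_mul_of_nonneg_right ?_ X0.le
      refine (abs_add_three _ _ _).trans ?_
      have a1 : |b * (b - 1) * κ (x / δ)| ≤ b * |b - 1| := by
        rw [abs_mul, abs_mul, abs_of_pos hb, abs_of_nonneg k0]
        exact mul_le_of_le_one_right hbb k1
      have a2 : |2 * b * (x / δ * κ' (x / δ))| ≤ 4 * b * M := by
        rw [abs_mul, abs_of_pos (by linarith : 0 < 2 * b)]
        nlinarith
      linarith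
  · intro x hx
    have hx0 : 0 < x := by linarith
    have h2 : 2 ≤ x / δ := (le_div_iff₀ hδ).2 hx
    have k : κ (x / δ) = 1 := Real.smoothTransition.one_of_one_le (by linarith)
    have e1 : x * x ^ (b - 1) = x ^ b := by
      rw [← Real.rpow_one_add' hx0.le (by linarith)]; congr 1; ring
    have : x * f' x = b * x ^ b := by
      simp only [hf', k, z1 _ (Or.inr h2)]; rw [← e1]; ring
    exact this.ge

end Cutoffs

/-! ### Weights on the truncated cylinder, and passing from identities to inequalities. -/

noncomputable section WeightedEstimates

variable {N : ℕ}

/-- The part of the space-time cylinder over `[α, β]` at distance from the lateral boundary. -/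
def innerCylinder (N : ℕ) (δ α β : ℝ) : Set (Space N × ℝ) :=
  {z | z.2 ∈ Icc α β ∧ δ ≤ 1 - ‖z.1‖ ^ 2}

lemma isClosed_innerCylinder (δ α β : ℝ) : IsClosed (innerCylinder N δ α β) := by
  refine (isClosed_Icc.preimage continuous_snd).inter
    (isClosed_le (f := fun _ => δ) (g := fun z : Space N × ℝ => 1 - ‖z.1‖ ^ 2) continuous_const ?_)
  fun_prop

lemma measurableSet_innerCylinder (δ α β : ℝ) : MeasurableSet (innerCylinder N δ α β) :=
  (isClosed_innerCylinder δ α β).measurableSet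

lemma isCompact_innerCylinder {δ : ℝ} (hδ : 0 ≤ δ) (α β : ℝ) :
    IsCompact (innerCylinder N δ α β) := by
  refine ((isCompact_closedBall (0 : Space N) 1).prod isCompact_Icc).of_isClosed_subset
    (isClosed_innerCylinder δ α β) fun z hz => ⟨?_, hz.1⟩
  have := hz.2
  rw [mem_closedBall_zero_iff]
  nlinarith [norm_nonneg z.1]

lemma hasFDerivAt_one_sub_norm_sq (z : Space N × ℝ) :
    HasFDerivAt (fun z : Space N × ℝ => 1 - ‖z.1‖ ^ 2)
      (-(2 • (innerSL ℝ z.1).comp (ContinuousLinearMap.fst ℝ (Space N) ℝ))) z :=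
  (hasFDerivAt_fst.norm_sq).const_sub 1

lemma inner_gradVec (w : Space N × ℝ → ℝ) (z : Space N × ℝ) :
    inner ℝ z.1 (gradVec w z).1 = dR w z := by
  simp only [gradVec, Prod.fst_sum, Prod.smul_fst, inner_sum, inner_smul_right,
    EuclideanSpace.inner_single_right, dR_eq_sum]
  simp [mul_comm]

lemma gradVec_snd (w : Space N × ℝ → ℝ) (z : Space N × ℝ) : (gradVec w z).2 = 0 := by
  simp [gradVec, Prod.snd_sum]

section Weight

variable {f f' χ χ' : ℝ → ℝ}

lemma hasFDerivAt_weight (hf : ∀ x, HasDerivAt f (f' x) x) (hχ : ∀ x, HasDerivAt χ (χ' x) x)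
    (z : Space N × ℝ) :
    HasFDerivAt (fun z : Space N × ℝ => f (1 - ‖z.1‖ ^ 2) * χ z.2)
      (f (1 - ‖z.1‖ ^ 2) • (χ' z.2 • ContinuousLinearMap.snd ℝ (Space N) ℝ) +
        χ z.2 • (f' (1 - ‖z.1‖ ^ 2) •
          (-(2 • (innerSL ℝ z.1).comp (ContinuousLinearMap.fst ℝ (Space N) ℝ))))) z :=
  ((hf _).comp_hasFDerivAt z (hasFDerivAt_one_sub_norm_sq z)).mul
    ((hχ _).comp_hasFDerivAt z hasFDerivAt_snd)

lemma dS_weight (hf : ∀ x, HasDerivAt f (f' x) x) (hχ : ∀ x, HasDerivAt χ (χ' x) x)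
    (z : Space N × ℝ) :
    dS (fun z : Space N × ℝ => f (1 - ‖z.1‖ ^ 2) * χ z.2) z = f (1 - ‖z.1‖ ^ 2) * χ' z.2 := by
  rw [dS, (hasFDerivAt_weight hf hχ z).fderiv]
  simp

lemma dR_weight (hf : ∀ x, HasDerivAt f (f' x) x) (hχ : ∀ x, HasDerivAt χ (χ' x) x)
    (z : Space N × ℝ) :
    dR (fun z : Space N × ℝ => f (1 - ‖z.1‖ ^ 2) * χ z.2) z =
      -(2 * ‖z.1‖ ^ 2 * f' (1 - ‖z.1‖ ^ 2) * χ z.2) := by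
  rw [dR, (hasFDerivAt_weight hf hχ z).fderiv]
  simp
  ring

lemma dG_weight (w : Space N × ℝ → ℝ) (hf : ∀ x, HasDerivAt f (f' x) x)
    (hχ : ∀ x, HasDerivAt χ (χ' x) x) (z : Space N × ℝ) :
    dG w (fun z : Space N × ℝ => f (1 - ‖z.1‖ ^ 2) * χ z.2) z =
      -(2 * f' (1 - ‖z.1‖ ^ 2) * χ z.2 * dR w z) := by
  rw [dG, (hasFDerivAt_weight hf hχ z).fderiv]
  simp [inner_gradVec, gradVec_snd]
  ring

lemma contDiff_weight (hf : ∀ x, HasDerivAt f (f' x) x) (hf' : Continuous f')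
    (hχ : ∀ x, HasDerivAt χ (χ' x) x) (hχ' : Continuous χ') :
    ContDiff ℝ 1 (fun z : Space N × ℝ => f (1 - ‖z.1‖ ^ 2) * χ z.2) := by
  have h1 : ContDiff ℝ 1 f := contDiff_one_iff_deriv.2
    ⟨fun x => (hf x).differentiableAt, by rwa [show deriv f = f' from funext fun x => (hf x).deriv]⟩
  have h2 : ContDiff ℝ 1 χ := contDiff_one_iff_deriv.2
    ⟨fun x => (hχ x).differentiableAt, by rwa [show deriv χ = χ' from funext fun x => (hχ x).deriv]⟩
  exact (h1.comp (contDiff_const.sub (contDiff_fst.norm_sq ℝ))).mul (h2.comp contDiff_snd)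

lemma hasCompactSupport_weight {δ α β : ℝ} (hδ : 0 ≤ δ) (hf : ∀ x, x ≤ δ → f x = 0)
    (hχ : ∀ τ, τ ∉ Icc α β → χ τ = 0) :
    HasCompactSupport (fun z : Space N × ℝ => f (1 - ‖z.1‖ ^ 2) * χ z.2) := by
  refine HasCompactSupport.intro (isCompact_innerCylinder (N := N) hδ α β) fun z hz => ?_
  by_cases h : z.2 ∈ Icc α β
  · rw [hf _ (not_lt.1 fun hlt => hz ⟨h, hlt.le⟩), zero_mul]
  · rw [hχ _ h, mul_zero]

end Weight

/-- If `∫ G = 0` then nonnegative lower bounds of `G + B` have integral at most that of `B`. -/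
lemma lintegral_le_of_integral_eq_zero {X : Type*} [MeasurableSpace X] {μ : Measure X}
    {G P B : X → ℝ} (hG : Integrable G μ) (h0 : ∫ x, G x ∂μ = 0) (hB : AEStronglyMeasurable B μ)
    (hP0 : ∀ x, 0 ≤ P x) (hB0 : ∀ x, 0 ≤ B x) (h : ∀ x, P x ≤ G x + B x) :
    ∫⁻ x, ENNReal.ofReal (P x) ∂μ ≤ ∫⁻ x, ENNReal.ofReal (B x) ∂μ := by
  -- An infinite right-hand side is trivial; otherwise B is integrable and G + B has the integral of
  -- B.
  by_cases ht : ∫⁻ x, ENNReal.ofReal (B x) ∂μ = ⊤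
  · rw [ht]; exact le_top
  have hBi : Integrable B μ := ⟨hB, by
    rw [hasFiniteIntegral_iff_ofReal (ae_of_all _ hB0)]; exact lt_top_iff_ne_top.2 ht⟩
  calc ∫⁻ x, ENNReal.ofReal (P x) ∂μ ≤ ∫⁻ x, ENNReal.ofReal (G x + B x) ∂μ :=
        lintegral_mono fun x => ENNReal.ofReal_le_ofReal (h x)
    _ = ENNReal.ofReal (∫ x, (G x + B x) ∂μ) :=
        (ofReal_integral_eq_lintegral_ofReal (hG.add hBi)
          (ae_of_all _ fun x => (hP0 x).trans (h x))).symm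
    _ = ENNReal.ofReal (∫ x, B x ∂μ) := by rw [integral_add hG hBi, h0, zero_add]
    _ = ∫⁻ x, ENNReal.ofReal (B x) ∂μ :=
        ofReal_integral_eq_lintegral_ofReal hBi (ae_of_all _ hB0)

/-- The form suited to cutoffs: on all of K the error B absorbs the negative part of G, while G + B
has to dominate P only on K', where the cutoffs are inactive. -/
lemma setLIntegral_le_of_integral_eq_zero {X : Type*} [MeasurableSpace X] {μ : Measure X}
    {G P B : X → ℝ} {K' K : Set X} (hG : Integrable G μ) (h0 : ∫ x, G x ∂μ = 0)
    (mK' : MeasurableSet K') (mK : MeasurableSet K) (hB : Measurable B)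
    (hP0 : ∀ x ∈ K', 0 ≤ P x) (hB0 : ∀ x ∈ K, 0 ≤ B x)
    (hout : ∀ x ∉ K, G x = 0) (hsub : K' ⊆ K)
    (h1 : ∀ x ∈ K, 0 ≤ G x + B x) (h2 : ∀ x ∈ K', P x ≤ G x + B x) :
    ∫⁻ x in K', ENNReal.ofReal (P x) ∂μ ≤ ∫⁻ x in K, ENNReal.ofReal (B x) ∂μ := by
  have key := lintegral_le_of_integral_eq_zero (P := K'.indicator P) (B := K.indicator B) hG h0
    (hB.indicator mK).aestronglyMeasurable (fun x => indicator_nonneg hP0 x)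
    (fun x => indicator_nonneg hB0 x) (fun x => by
      by_cases hx : x ∈ K
      · by_cases hx' : x ∈ K'
        · simpa [hx, hx'] using h2 x hx'
        · simpa [hx, hx'] using h1 x hx
      · have hx' : x ∉ K' := fun h => hx (hsub h)
        simp [hx, hx', hout x hx])
  rw [← lintegral_indicator mK', ← lintegral_indicator mK]
  convert key using 3 with x x
  · by_cases hx : x ∈ K' <;> simp [hx]
  · by_cases hx : x ∈ K <;> simp [hx]

/-- The unweighted energy density. -/
def energyDensity (p : ℝ) (w : Space N × ℝ → ℝ) (z : Space N × ℝ) : ℝ :=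
  gradSq w z + dS w z ^ 2 + w z ^ 2 + |w z| ^ (p + 1)

/-- The residual of the equation in similarity variables. -/
def similarityResidual (p : ℝ) (w : Space N × ℝ → ℝ) (z : Space N × ℝ) : ℝ :=
  waveOp w z + (2 * (2 / (p - 1)) + 1) * (dS w z + dR w z)
    + 2 / (p - 1) * (2 / (p - 1) + 1) * w z - |w z| ^ (p - 1) * w z

lemma mul_le_mul_of_abs_le {c x k e : ℝ} (hc : |c| ≤ k) (hx : |x| ≤ e) : c * x ≤ k * e :=
  (le_abs_self _).trans (by
    rw [abs_mul]; exact mul_le_mul hc hx (abs_nonneg _) ((abs_nonneg _).trans hc))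

end WeightedEstimates

/-! ### Pointwise inequalities between the terms of the identities. -/

noncomputable section EnergyEstimates

variable {N : ℕ}

/-- Pointwise form of the combined energy and Hardy estimates. -/
lemma energy_hardy_pointwise {ε A c n P C D y σ X Y f f' χ χ' q r s w W V g Q : ℝ} (hε : 0 < ε)
    (hA : 0 ≤ A) (hc : 0 ≤ c) (hn : 0 ≤ n) (hP : 1 ≤ P) (hC : 1 ≤ C) (hD : 1 ≤ D) (hy : 0 ≤ y)
    (hσ : σ = 1 - y) (hσ0 : 0 < σ) (hX : 0 ≤ X) (hXY : σ * Y = X) (hf : 0 ≤ f)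
    (hfC : f ≤ C * X) (hf' : 0 ≤ f') (hfC' : σ * f' ≤ C * X) (hχ : 0 ≤ χ) (hχ1 : χ ≤ 1)
    (hχ' : |χ'| ≤ D) (hr : r ^ 2 ≤ y * q) (hq : 0 ≤ q) (hW : 0 ≤ W)
    (hQ : Q = g - A * (s + r) - c * w + V * w) :
    let G := -(2 * ε)⁻¹ * ((f * χ * s * (Q + c * w - V * w)
      + f * χ' * ((s ^ 2 - r ^ 2 + q + c * w ^ 2) / 2 - W / P)
      + (-(2 * y * f' * χ) + n * (f * χ)) * (s ^ 2 + r * s) - s * -(2 * f' * χ * r))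
      + ((-(2 * y * f' * χ) + n * (f * χ)) * w ^ 2 + 2 * (f * χ) * (w * r)))
    let B := ((2 * A + D * (2 + c) + 5 + 3 * n) * C * (2 * ε)⁻¹ + 1) *
      ((q + s ^ 2 + w ^ 2 + W) * X + |g| * |s| * X)
    0 ≤ B ∧ 0 ≤ G + B ∧ (χ = 1 → ε * Y ≤ f' → (s ^ 2 + w ^ 2) * Y ≤ G + B) := by
  -- In the application y = |y|², X = σ^ε, Y = σ^{ε-1}, q = |∇w|², r = y·∇w, s = ∂_s w, W =
  -- |w|^{p+1}, V = |w|^{p-1}; g is the residual and Q is `waveOp w`.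
  intro G B
  obtain ⟨e, he⟩ : ∃ e, e = q + s ^ 2 + w ^ 2 + W := ⟨_, rfl⟩
  have hy1 : y ≤ 1 := by linarith
  have hrq : r ^ 2 ≤ q := hr.trans (mul_le_of_le_one_left hq hy1)
  have he0 : 0 ≤ e := by rw [he]; positivity
  have hgs : 0 ≤ |g| * |s| * X := by positivity
  have hfχ : 0 ≤ f * χ := mul_nonneg hf hχ
  have hfχC : f * χ ≤ C * X := (mul_le_of_le_one_right hf hχ1).trans hfC
  have afχ : |f * χ| ≤ C * X := by rwa [abs_of_nonneg hfχ]
  have T1 : f * χ * (s * g) ≤ C * X * (|s| * |g|) :=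
    mul_le_mul_of_abs_le afχ (abs_mul s g).le
  have T2 : A * (f * χ) * -(s * (s + r)) ≤ A * (C * X) * (2 * e) := by
    refine mul_le_mul_of_abs_le ?_ ?_
    · rw [abs_mul, abs_of_nonneg hA]; exact mul_le_mul_of_nonneg_left afχ hA
    · rw [abs_neg, abs_le]; constructor <;> linarith [sq_nonneg (s + r), sq_nonneg (s - r), sq_nonneg w, sq_nonneg r, sq_nonneg s]
  have T3 : f * χ' * ((s ^ 2 - r ^ 2 + q + c * w ^ 2) / 2 - W / P) ≤ C * X * D * ((2 + c) * e) := by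
    refine mul_le_mul_of_abs_le ?_ ?_
    · rw [abs_mul, abs_of_nonneg hf]
      exact mul_le_mul hfC hχ' (abs_nonneg _) (by positivity)
    · have w1 : W / P ≤ W := div_le_self hW hP
      have w2 : 0 ≤ W / P := by positivity
      have ce : c * w ^ 2 ≤ c * e := mul_le_mul_of_nonneg_left (by linarith [sq_nonneg s]) hc
      have ce' : 0 ≤ c * w ^ 2 := by positivity
      have ce'' : 0 ≤ c * e := by positivity
      rw [abs_le]; constructor <;> linarith [sq_nonneg s, sq_nonneg w, sq_nonneg r]
  -- The two contributions -2|y|²f'rs and 2f'rs add up to 2σf'rs, and σf' is no more singular than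
  -- X.
  have T4 : σ * f' * χ * (2 * (r * s)) ≤ C * X * e := by
    refine mul_le_mul_of_abs_le ?_ ?_
    · rw [abs_of_nonneg (by positivity)]
      exact (mul_le_of_le_one_right (by positivity) hχ1).trans hfC'
    · rw [abs_le]; constructor <;> linarith [sq_nonneg (s + r), sq_nonneg (s - r), sq_nonneg w, sq_nonneg r, sq_nonneg s]
  have T5 : n * (f * χ) * (s ^ 2 + r * s + w ^ 2) ≤ n * (C * X) * (3 * e) := by
    refine mul_le_mul_of_abs_le ?_ ?_
    · rw [abs_mul, abs_of_nonneg hn]; exact mul_le_mul_of_nonneg_left afχ hn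
    · rw [abs_le]; constructor <;> linarith [sq_nonneg (s + r), sq_nonneg (s - r), sq_nonneg w, sq_nonneg r, sq_nonneg s]
  have T6 : f * χ * (2 * (w * r)) ≤ C * X * e := by
    refine mul_le_mul_of_abs_le afχ ?_
    rw [abs_le]; constructor <;> linarith [sq_nonneg (w + r), sq_nonneg (w - r), sq_nonneg s]
  -- The good term, produced by the derivative of the weight in both identities.
  obtain ⟨M, hM⟩ : ∃ M, M = 2 * y * f' * χ * (s ^ 2 + w ^ 2) := ⟨_, rfl⟩
  have hM0 : 0 ≤ M := by rw [hM]; positivity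
  have hi : 0 < (2 * ε)⁻¹ := by positivity
  have hCX : 0 ≤ C * X := by positivity
  have hR : M - ((2 * A + D * (2 + c) + 5 + 3 * n) * C) * (e * X + |g| * |s| * X) ≤
      -((f * χ * s * (Q + c * w - V * w)
      + f * χ' * ((s ^ 2 - r ^ 2 + q + c * w ^ 2) / 2 - W / P)
      + (-(2 * y * f' * χ) + n * (f * χ)) * (s ^ 2 + r * s) - s * -(2 * f' * χ * r))
      + ((-(2 * y * f' * χ) + n * (f * χ)) * w ^ 2 + 2 * (f * χ) * (w * r))) := by
    have h1 : 0 ≤ (2 * A + D * (2 + c) + 4 + 3 * n) * C * (|g| * |s| * X) := by positivity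
    have h2 : 0 ≤ C * X * e := by positivity
    rw [hQ, hM]
    subst hσ
    linarith
  have hGM : (2 * ε)⁻¹ * M - ((2 * A + D * (2 + c) + 5 + 3 * n) * C * (2 * ε)⁻¹) *
      (e * X + |g| * |s| * X) ≤ G := by
    have := mul_le_mul_of_nonneg_left hR hi.le
    calc _ = _ := ?_
      _ ≤ _ := this
      _ = G := ?_
    · ring
    · simp only [G]; ring
  have hB : B = ((2 * A + D * (2 + c) + 5 + 3 * n) * C * (2 * ε)⁻¹) *
      (e * X + |g| * |s| * X) + (e * X + |g| * |s| * X) := by simp only [B, he]; ring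
  have heX : 0 ≤ e * X := by positivity
  have hiM : 0 ≤ (2 * ε)⁻¹ * M := by positivity
  refine ⟨by rw [hB]; positivity, by rw [hB]; linarith, fun h1 h2 => ?_⟩
  have k1 : (s ^ 2 + w ^ 2) * X ≤ e * X := mul_le_mul_of_nonneg_right (by linarith) hX
  -- M degenerates at the centre of the ball. There σ^{ε-1} = |y|²σ^{ε-1} + σ^ε lets the energy
  -- supply the rest, which is the `+ 1` in the constant of B.
  have k2 : (s ^ 2 + w ^ 2) * Y = y * Y * (s ^ 2 + w ^ 2) + (s ^ 2 + w ^ 2) * X := by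
    rw [← hXY, hσ]; ring
  have k3 : y * Y * (s ^ 2 + w ^ 2) ≤ (2 * ε)⁻¹ * M := by
    have : 2 * ε * (y * Y * (s ^ 2 + w ^ 2)) ≤ M := by
      rw [hM, h1]
      have := mul_le_mul_of_nonneg_left h2 (by positivity : 0 ≤ 2 * y * (s ^ 2 + w ^ 2))
      linarith
    rw [inv_mul_eq_div, le_div_iff₀ (by positivity)]
    linarith
  rw [hB, k2]
  linarith

/-- Used with σ^{ε-1/2} as the geometric mean of σ^ε and σ^{ε-1}: y·∇w keeps the regular weight, and
∂_s w or w takes the singular one, for which the Hardy-type bound is available. -/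
lemma mul_abs_mul_le {X Y Z x y : ℝ} (hX : 0 ≤ X) (hY : 0 ≤ Y) (hZ : 0 ≤ Z)
    (h : Z ^ 2 = X * Y) : Z * |x * y| ≤ (X * x ^ 2 + Y * y ^ 2) / 2 := by
  have : |Z * (x * y)| ≤ (X * x ^ 2 + Y * y ^ 2) / 2 := by
    refine abs_le_of_sq_le_sq ?_ (by positivity)
    have : (Z * (x * y)) ^ 2 = X * Y * (x * y) ^ 2 := by rw [mul_pow, h]
    rw [this]
    nlinarith [sq_nonneg (X * x ^ 2 - Y * y ^ 2)]
  rwa [abs_mul, abs_of_nonneg hZ] at this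

/-- Pointwise form of the estimate of the singular nonlinear term. -/
lemma pohozaev_pointwise {b A c n p C D y σ X Y Z F f f' χ χ' q r s w W V g Q : ℝ} (hb : 0 < b)
    (hA : 0 ≤ A) (hc : 0 ≤ c) (hn : 0 ≤ n) (hp : 1 < p) (hC : 1 ≤ C) (hD : 1 ≤ D) (hy : 0 ≤ y)
    (hσ : σ = 1 - y) (hσ0 : 0 < σ) (hX : 0 ≤ X) (hZ : 0 ≤ Z) (hXZ : X ≤ Z) (hZY : Z ≤ Y)
    (hZ2 : Z ^ 2 = X * Y) (hσZ : σ * Z ≤ X)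
    (hF : 0 ≤ F) (hFC : F ≤ C * X) (hf : 0 ≤ f) (hfC : f ≤ C * Z)
    (hfC' : |σ * f'| ≤ C * Z) (hχ : 0 ≤ χ) (hχ1 : χ ≤ 1)
    (hχ' : |χ'| ≤ D) (hr : r ^ 2 ≤ y * q) (hq : 0 ≤ q) (hW : 0 ≤ W) (hV : V * w ^ 2 = W)
    (hQ : Q = g - A * (s + r) - c * w + V * w) :
    let GW := f * χ * w * Q + f * χ * (s ^ 2 + 2 * r * s + r ^ 2 - q)
        + f * χ' * (w * s + 2 * (r * w))
        + (-(2 * y * f' * χ) + n * (f * χ)) * (r * w) - w * -(2 * f' * χ * r)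
    let GR := F * χ * r * (Q - V * w) + F * χ' * (s * r + r ^ 2)
        + (-(2 * y * f * χ) + n * (F * χ)) * ((q + r ^ 2 - s ^ 2) / 2 - W / (p + 1))
        - r * -(2 * f * χ * r) - F * χ * q
    let m := (p - 1) / (p + 1) * b
    let G := m⁻¹ * (GW - GR)
    let B := m⁻¹ * ((5 * A + 2 * c + 5 * n + 6 * D + 12) * C) *
      ((q + s ^ 2 + w ^ 2 + W) * X + (s ^ 2 + w ^ 2) * Y + |g| * (|w| + |r|) * Z)
    0 ≤ B ∧ 0 ≤ G + B ∧ (χ = 1 → b * Z ≤ f → W * Z ≤ G + B) := by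
  -- Same notation as in `energy_hardy_pointwise`, with Z = σ^{ε-1/2}; F, f, f' are the truncation
  -- of σ^{ε+1/2} and its first two derivatives in σ. The factor m⁻¹ normalises the good term, since
  -- f ≥ bZ and W enters with coefficient at least (p-1)/(p+1).
  intro GW GR m G B
  obtain ⟨e, he⟩ : ∃ e, e = q + s ^ 2 + w ^ 2 + W := ⟨_, rfl⟩
  obtain ⟨E, hE⟩ : ∃ E, E = e * X + (s ^ 2 + w ^ 2) * Y := ⟨_, rfl⟩
  have hY : 0 ≤ Y := hZ.trans hZY
  have hy1 : y ≤ 1 := by linarith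
  have hσ1 : σ ≤ 1 := by linarith
  have hrq : r ^ 2 ≤ q := hr.trans (mul_le_of_le_one_left hq hy1)
  have he0 : 0 ≤ e := by rw [he]; positivity
  have hE0 : 0 ≤ E := by rw [hE]; positivity
  have hm : 0 < m := by simp only [m]; have : 0 < p - 1 := by linarith
                        positivity
  have rX : r ^ 2 * X ≤ e * X := mul_le_mul_of_nonneg_right (by linarith [sq_nonneg s, sq_nonneg w]) hX
  have hfχ : 0 ≤ f * χ := mul_nonneg hf hχ
  have hFχ : 0 ≤ F * χ := mul_nonneg hF hχ
  have afχ : |f * χ| ≤ C * Z := by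
    rw [abs_of_nonneg hfχ]; exact (mul_le_of_le_one_right hf hχ1).trans hfC
  have aFχ : |F * χ| ≤ C * X := by
    rw [abs_of_nonneg hFχ]; exact (mul_le_of_le_one_right hF hχ1).trans hFC
  have afχ' : |f * χ'| ≤ C * Z * D := by
    rw [abs_mul, abs_of_nonneg hf]; exact mul_le_mul hfC hχ' (abs_nonneg _) (by positivity)
  have aFχ' : |F * χ'| ≤ C * X * D := by
    rw [abs_mul, abs_of_nonneg hF]; exact mul_le_mul hFC hχ' (abs_nonneg _) (by positivity)
  have aσf : |σ * f' * χ| ≤ C * Z := by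
    rw [abs_mul, abs_of_nonneg hχ]; exact (mul_le_of_le_one_right (abs_nonneg _) hχ1).trans hfC'
  -- products with the singular weight
  have Zrs : Z * |r * s| ≤ E := by
    have := mul_abs_mul_le (x := r) (y := s) hX hY hZ hZ2
    have k : 0 ≤ w ^ 2 * Y := by positivity
    have k' : 0 ≤ e * X := by positivity
    have k'' : 0 ≤ s ^ 2 * Y := by positivity
    rw [hE]; linarith
  have Zrw : Z * |r * w| ≤ E := by
    have := mul_abs_mul_le (x := r) (y := w) hX hY hZ hZ2
    have k : 0 ≤ s ^ 2 * Y := by positivity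
    have k' : 0 ≤ e * X := by positivity
    have k'' : 0 ≤ w ^ 2 * Y := by positivity
    rw [hE]; linarith
  have Zws : Z * |w * s| ≤ E := by
    have h1 : |w * s| ≤ s ^ 2 + w ^ 2 := by
      rw [abs_le]; constructor <;> linarith [sq_nonneg (w + s), sq_nonneg (w - s)]
    have h2 : Z * |w * s| ≤ Y * (s ^ 2 + w ^ 2) := mul_le_mul hZY h1 (abs_nonneg _) hY
    have k' : 0 ≤ e * X := by positivity
    rw [hE]; linarith
  have Zww : Z * |w * w| ≤ E := by
    have h1 : |w * w| ≤ s ^ 2 + w ^ 2 := by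
      rw [abs_of_nonneg (mul_self_nonneg w)]; linarith [sq_nonneg s]
    have h2 : Z * |w * w| ≤ Y * (s ^ 2 + w ^ 2) := mul_le_mul hZY h1 (abs_nonneg _) hY
    have k' : 0 ≤ e * X := by positivity
    rw [hE]; linarith
  have Xe : X * e ≤ E := by
    have k' : 0 ≤ (s ^ 2 + w ^ 2) * Y := by positivity
    rw [hE]; linarith
  have bnd : ∀ {a x k z E' : ℝ}, |a| ≤ k * z → z * |x| ≤ E' → 0 ≤ k → -(k * E') ≤ a * x := by
    intro a x k z E' h1 h2 hk
    have h3 : |a * x| ≤ k * z * |x| := by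
      rw [abs_mul]; exact mul_le_mul_of_nonneg_right h1 (abs_nonneg _)
    have h4 : k * (z * |x|) ≤ k * E' := mul_le_mul_of_nonneg_left h2 hk
    have := neg_abs_le (a * x)
    linarith
  have hC0 : 0 ≤ C := by linarith
  have hCD : 0 ≤ C * D := by positivity
  have Xle : ∀ {x k : ℝ}, 0 ≤ k → |x| ≤ k * e → X * |x| ≤ k * E := fun {x k} hk h =>
    calc X * |x| ≤ X * (k * e) := mul_le_mul_of_nonneg_left h hX
      _ = k * (X * e) := by ring
      _ ≤ k * E := mul_le_mul_of_nonneg_left Xe hk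
  have S1 := bnd (x := w * s) afχ Zws hC0
  have S2 := bnd (x := r * w) afχ Zrw hC0
  have S3 := bnd (x := w * w) afχ Zww hC0
  have S4 := bnd (x := r * s) afχ Zrs hC0
  have S5 := bnd (x := w * s) (k := C * D) (z := Z) (afχ'.trans_eq (mul_right_comm C _ D)) Zws hCD
  have S6 := bnd (x := r * w) (k := C * D) (z := Z) (afχ'.trans_eq (mul_right_comm C _ D)) Zrw hCD
  have S7 := bnd (x := r * w) aσf Zrw hC0
  have S1' : f * χ * (w * s) ≤ C * E := by
    linarith [bnd (x := -(w * s)) (E' := E) afχ (by rwa [abs_neg]) hC0]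
  have S2' : f * χ * (r * w) ≤ C * E := by
    linarith [bnd (x := -(r * w)) (E' := E) afχ (by rwa [abs_neg]) hC0]
  have S3' : f * χ * (w * w) ≤ C * E := by
    linarith [bnd (x := -(w * w)) (E' := E) afχ (by rwa [abs_neg]) hC0]
  -- products with the regular weight
  have R1 := bnd (x := r * s + r ^ 2) aFχ (Xle (k := 3) (by norm_num) (by
    rw [abs_le]; constructor <;> linarith [sq_nonneg (s + r), sq_nonneg (s - r), sq_nonneg w, sq_nonneg r, sq_nonneg s]))
    hC0
  have R2 := bnd (x := r * w) aFχ (Xle (k := 1) (by norm_num) (by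
    rw [abs_le]; constructor <;> linarith [sq_nonneg (w + r), sq_nonneg (w - r), sq_nonneg s]))
    hC0
  have R3 := bnd (x := -(s * r + r ^ 2)) (k := C * D) (z := X) (aFχ'.trans_eq (mul_right_comm C _ D))
    (Xle (k := 2) (by norm_num) (by
      rw [abs_le]; constructor <;> linarith [sq_nonneg (s + r), sq_nonneg (s - r), sq_nonneg w, sq_nonneg r, sq_nonneg s]))
    hCD
  have Wp : W / (p + 1) ≤ W := div_le_self hW (by linarith)
  have Wp0 : 0 ≤ W / (p + 1) := by positivity
  have R4 := bnd (x := -((q + r ^ 2 - s ^ 2) / 2 - W / (p + 1))) aFχ (Xle (k := 2) (by norm_num) (by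
    rw [abs_le]; constructor <;> linarith [sq_nonneg s, sq_nonneg r, sq_nonneg w])) hC0
  have R5 := bnd (x := q) aFχ (Xle (k := 1) (by norm_num) (by
    rw [abs_of_nonneg hq]; linarith [sq_nonneg s, sq_nonneg w])) hC0
  have aσfχ : |σ * f * χ| ≤ C * X := by
    rw [abs_of_nonneg (by positivity)]
    have h1 : σ * f * χ ≤ σ * f := mul_le_of_le_one_right (by positivity) hχ1
    have h2 : σ * f ≤ σ * (C * Z) := mul_le_mul_of_nonneg_left hfC hσ0.le
    have h3 : C * (σ * Z) ≤ C * X := mul_le_mul_of_nonneg_left hσZ hC0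
    linarith
  have R6 := bnd (x := -q - r ^ 2 + s ^ 2 + 2 * (W / (p + 1))) aσfχ (Xle (k := 2) (by norm_num) (by
    rw [abs_le]; constructor <;> linarith [sq_nonneg s, sq_nonneg r, sq_nonneg w])) hC0
  have g0 : 0 ≤ |g| * (|w| + |r|) * Z := by positivity
  have T1 : -(C * (|g| * |w| * Z)) ≤ f * χ * (w * g) := bnd afχ
    (by rw [abs_mul]; exact le_of_eq (by ring)) hC0
  have T2 : -(C * (|g| * |r| * Z)) ≤ F * χ * -(r * g) := bnd aFχ (by
    rw [abs_neg, abs_mul]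
    have := mul_le_mul_of_nonneg_right hXZ (by positivity : 0 ≤ |r| * |g|)
    linarith) hC0
  obtain ⟨H, hH⟩ : ∃ H, H = |g| * (|w| + |r|) * Z := ⟨_, rfl⟩
  have hHe : H = |g| * |w| * Z + |g| * |r| * Z := by rw [hH]; ring
  have pp : p + 1 ≠ 0 := by linarith
  have key : f * χ * ((p - 1) / (p + 1) * W)
      - (5 * A + 2 * c + 5 * n + 6 * D + 12) * C * (E + H) ≤ GW - GR := by
    -- The cancellation. The coefficients with weight f are -1 + |y|² = -σ for q, 1 + |y|² - 2 = -σ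
    -- for r², 1 - |y|² = σ for s², and 1 - 2|y|²/(p+1) = (p-1)/(p+1) + 2σ/(p+1) for W. The weight
    -- σf is bounded by a multiple of X. Likewise f' occurs only as σf'.
    have expand : GW - GR = f * χ * ((p - 1) / (p + 1) * W)
        + f * χ * (w * g) - A * (f * χ * (w * s)) - A * (f * χ * (r * w)) - c * (f * χ * (w * w))
        + 2 * (f * χ * (r * s)) + f * χ' * (w * s) + 2 * (f * χ' * (r * w))
        + 2 * (σ * f' * χ * (r * w)) + n * (f * χ * (r * w))
        + F * χ * -(r * g) + A * (F * χ * (r * s + r ^ 2)) + c * (F * χ * (r * w))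
        + F * χ' * -(s * r + r ^ 2)
        + n * (F * χ * -((q + r ^ 2 - s ^ 2) / 2 - W / (p + 1)))
        + F * χ * q + σ * f * χ * (-q - r ^ 2 + s ^ 2 + 2 * (W / (p + 1))) := by
      have hW' : W = V * w ^ 2 := hV.symm
      simp only [GW, GR, hQ, hσ]
      have : (p - 1) / (p + 1) * W = W - 2 * (W / (p + 1)) := by field_simp; ring
      rw [this]
      linear_combination (f * χ) * hV
    have a1 := mul_le_mul_of_nonneg_left S1' hA
    have a2 := mul_le_mul_of_nonneg_left S2' hA
    have a3 := mul_le_mul_of_nonneg_left S3' hc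
    have a4 := mul_le_mul_of_nonneg_left S2 hn
    have a5 := mul_le_mul_of_nonneg_left R1 hA
    have a6 := mul_le_mul_of_nonneg_left R2 hc
    have a7 := mul_le_mul_of_nonneg_left R4 hn
    have hH0 : 0 ≤ H := by rw [hH]; exact g0
    have b1 : 0 ≤ (5 * A + 2 * c + 5 * n + 6 * D + 11) * C * H := by positivity
    have b2 : 0 ≤ n * C * E := by positivity
    have b3 : 0 ≤ C * E := by positivity
    have b4 : 0 ≤ C * D * E := by positivity
    have b5 : C * H = C * (|g| * |w| * Z) + C * (|g| * |r| * Z) := by rw [hHe]; ring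
    rw [expand]
    linear_combination T1 + T2 + a1 + a2 + a3 + a4 + a5 + a6 + a7 + 2 * S4 + S5 + 2 * S6 + 2 * S7
      + R3 + R5 + R6 + b1 + 2 * b2 + 5 * b3 + b4 - b5
  have hi : 0 < m⁻¹ := inv_pos.2 hm
  have hB : B = m⁻¹ * ((5 * A + 2 * c + 5 * n + 6 * D + 12) * C * (E + H)) := by
    simp only [B, hE, hH, he]; ring
  have hH0 : 0 ≤ H := by rw [hH]; exact g0
  have hB0 : 0 ≤ B := by rw [hB]; positivity
  have hGB : m⁻¹ * (f * χ * ((p - 1) / (p + 1) * W)) ≤ G + B := by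
    rw [hB]
    have := mul_le_mul_of_nonneg_left key hi.le
    simp only [G]
    linarith
  have pm : 0 ≤ (p - 1) / (p + 1) := div_nonneg (by linarith) (by linarith)
  refine ⟨hB0, le_trans (by positivity) hGB, fun h1 h2 => le_trans ?_ hGB⟩
  rw [inv_mul_eq_div, le_div_iff₀ hm, h1]
  have := mul_le_mul_of_nonneg_left h2 (by positivity : 0 ≤ (p - 1) / (p + 1) * W)
  simp only [m]
  linarith

end EnergyEstimates

/-! ### Integrated estimates for C² functions, with the residual as an error. -/

noncomputable section IntegralEstimates

variable {N : ℕ} {p : ℝ} {w : Space N × ℝ → ℝ}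

lemma innerCylinder_subset {δ δ' α α' β β' : ℝ} (hδ : δ ≤ δ') (hα : α ≤ α') (hβ : β' ≤ β) :
    innerCylinder N δ' α' β' ⊆ innerCylinder N δ α β :=
  fun _ hz => ⟨⟨hα.trans hz.1.1, hz.1.2.trans hβ⟩, hδ.trans hz.2⟩

lemma gradSq_nonneg (w : Space N × ℝ → ℝ) (z : Space N × ℝ) : 0 ≤ gradSq w z :=
  Finset.sum_nonneg fun _ _ => sq_nonneg _

lemma energyDensity_nonneg (p : ℝ) (w : Space N × ℝ → ℝ) (z : Space N × ℝ) :
    0 ≤ energyDensity p w z := by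
  have := gradSq_nonneg w z
  rw [energyDensity]
  positivity

lemma continuous_energyDensity (hp : 1 < p) (hw : ContDiff ℝ 2 w) :
    Continuous (energyDensity p w) := by
  have hw1 : ContDiff ℝ 1 w := hw.of_le (by norm_num)
  exact (((hw1.continuous_gradSq).add (hw1.continuous_dS.pow 2)).add (hw1.continuous.pow 2)).add
    (contDiff_abs_rpow_comp hp hw1).continuous

lemma continuous_similarityResidual (hp : 1 < p) (hw : ContDiff ℝ 2 w) :
    Continuous (similarityResidual p w) := by
  have c0 := hw.continuous
  have cs := hw.dS_of_two.continuous
  have cr := hw.dR_of_two.continuous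
  have cV : Continuous (fun z => |w z| ^ (p - 1)) :=
    c0.abs.rpow_const fun _ => Or.inr (by linarith)
  exact ((((((hw.dS_of_two.continuous_dS).add (continuous_const.mul
    hw.dR_of_two.continuous_dS)).add hw.dR_of_two.continuous_dR).sub hw.continuous_lap).add
    (continuous_const.mul (cs.add cr))).add (continuous_const.mul c0)).sub (cV.mul c0)

lemma measurable_weight (b : ℝ) :
    Measurable (fun z : Space N × ℝ => (1 - ‖z.1‖ ^ 2) ^ b) :=
  (measurable_const.sub (measurable_fst.norm.pow_const 2)).pow_const b

/-- Energy and Hardy estimate: `∂_s w` and `w` are controlled with the weight `ρ_{ε-1}`. -/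
lemma energy_hardy_estimate (N : ℕ) {p ε : ℝ} (hp : 1 < p) (hε : 0 < ε) :
    ∃ K : ℝ, 0 ≤ K ∧ ∀ (w : Space N × ℝ → ℝ), ContDiff ℝ 2 w → ∀ δ α β : ℝ, 0 < δ →
      ∫⁻ z in innerCylinder N (2 * δ) (α + 1) (β - 1),
        ENNReal.ofReal ((dS w z ^ 2 + w z ^ 2) * (1 - ‖z.1‖ ^ 2) ^ (ε - 1)) ≤
      ∫⁻ z in innerCylinder N δ α β, ENNReal.ofReal (K *
        (energyDensity p w z * (1 - ‖z.1‖ ^ 2) ^ ε +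
          |similarityResidual p w z| * |dS w z| * (1 - ‖z.1‖ ^ 2) ^ ε)) := by
  obtain ⟨D, hD, hcut⟩ := exists_time_cutoff
  obtain ⟨C, hC, hpow⟩ := exists_truncated_power ε hε
  have ha : 0 < 2 / (p - 1) := div_pos two_pos (by linarith)
  refine ⟨(2 * (2 * (2 / (p - 1)) + 1) + D * (2 + 2 / (p - 1) * (2 / (p - 1) + 1)) + 5 + 3 * N) *
    C * (2 * ε)⁻¹ + 1, by positivity, fun w hw δ α β hδ => ?_⟩
  obtain ⟨χ, χ', dχ, cχ', hχ, hχ', hχ1, hχ0⟩ := hcut α β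
  obtain ⟨f, f', f'', df, df', -, hf0, hfb, hf2⟩ := hpow δ hδ
  have cf' : Continuous f' := continuous_iff_continuousAt.2 fun x => (df' x).continuousAt
  have hw1 : ContDiff ℝ 1 w := hw.of_le (by norm_num)
  have hφ := contDiff_weight (N := N) df cf' dχ cχ'
  have cφ := hasCompactSupport_weight (N := N) (f := f) (χ := χ) hδ.le (fun x hx => (hf0 x hx).1)
    (fun τ hτ => (hχ0 τ hτ).1)
  obtain ⟨iS, zS⟩ := multiplier_dS hp (2 / (p - 1) * (2 / (p - 1) + 1)) hw hφ cφ
  obtain ⟨iH, zH⟩ := radial_identity hw hφ cφ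
  simp only [dS_weight df dχ, dR_weight df dχ, dG_weight w df dχ] at iS zS iH zH
  have hG := (iS.add iH).const_mul (-(2 * ε)⁻¹)
  have hG0 : ∫ z, _ = (0 : ℝ) :=
    (integral_const_mul (-(2 * ε)⁻¹) _).trans (by
      rw [integral_add' iS iH, zS, zH, add_zero, mul_zero])
  have pos : ∀ z ∈ innerCylinder N δ α β, 0 < 1 - ‖z.1‖ ^ 2 := fun z hz => hδ.trans_le hz.2
  have point := fun (z : Space N × ℝ) (hz : z ∈ innerCylinder N δ α β) =>
    energy_hardy_pointwise (ε := ε) (A := 2 * (2 / (p - 1)) + 1)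
      (c := 2 / (p - 1) * (2 / (p - 1) + 1)) (n := N) (P := p + 1) (C := C) (D := D)
      (y := ‖z.1‖ ^ 2) (σ := 1 - ‖z.1‖ ^ 2) (X := (1 - ‖z.1‖ ^ 2) ^ ε)
      (Y := (1 - ‖z.1‖ ^ 2) ^ (ε - 1)) (f := f (1 - ‖z.1‖ ^ 2)) (f' := f' (1 - ‖z.1‖ ^ 2))
      (χ := χ z.2) (χ' := χ' z.2) (q := gradSq w z) (r := dR w z) (s := dS w z) (w := w z)
      (W := |w z| ^ (p + 1)) (V := |w z| ^ (p - 1)) (g := similarityResidual p w z)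
      (Q := waveOp w z) hε (by positivity) (by positivity) (by positivity) (by linarith) hC hD
      (by positivity) rfl (pos z hz) (Real.rpow_nonneg (pos z hz).le _)
      (by rw [← Real.rpow_one_add' (pos z hz).le (by linarith)]; congr 1; ring)
      (hfb _ (pos z hz)).1.1 (hfb _ (pos z hz)).1.2 (hfb _ (pos z hz)).2.1.1
      (hfb _ (pos z hz)).2.1.2 (hχ _).1 (hχ _).2 (hχ' _) (sq_dR_le w z) (gradSq_nonneg w z)
      (by positivity) (by rw [similarityResidual]; ring)
  have hsub : innerCylinder N (2 * δ) (α + 1) (β - 1) ⊆ innerCylinder N δ α β :=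
    innerCylinder_subset (by linarith) (by linarith) (by linarith)
  refine setLIntegral_le_of_integral_eq_zero hG hG0 (measurableSet_innerCylinder _ _ _)
    (measurableSet_innerCylinder _ _ _) ?_ ?_ ?_ ?_ hsub ?_ ?_
  · have m1 := (continuous_energyDensity hp hw).measurable
    have m2 := (continuous_similarityResidual hp hw).measurable
    have m3 := hw1.continuous_dS.measurable
    have m4 := measurable_weight (N := N) ε
    exact ((m1.mul m4).add ((m2.abs.mul m3.abs).mul m4)).const_mul _
  · intro z hz
    exact mul_nonneg (by positivity) (Real.rpow_nonneg (pos z (hsub hz)).le _)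
  · intro z hz
    exact (point z hz).1
  · intro z hz
    by_cases h : z.2 ∈ Icc α β
    · have h' : 1 - ‖z.1‖ ^ 2 ≤ δ := le_of_not_gt fun hlt => hz ⟨h, hlt.le⟩
      simp [hf0 _ h']
    · simp [hχ0 _ h]
  · intro z hz
    exact (point z hz).2.1
  · intro z hz
    refine (point z (hsub hz)).2.2 (hχ1 _ hz.1.1 hz.1.2) ?_
    have h := hf2 _ hz.2
    have hp := pos z (hsub hz)
    rw [show (1 - ‖z.1‖ ^ 2) ^ ε = (1 - ‖z.1‖ ^ 2) * (1 - ‖z.1‖ ^ 2) ^ (ε - 1) by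
      rw [← Real.rpow_one_add' hp.le (by linarith)]; congr 1; ring] at h
    exact le_of_mul_le_mul_left (by linarith) hp

/-- Estimate of the singular nonlinear term by singular weighted `L²` norms. -/
lemma pohozaev_estimate (N : ℕ) {p ε : ℝ} (hp : 1 < p) (hε : 0 < ε) :
    ∃ K : ℝ, 0 ≤ K ∧ ∀ (w : Space N × ℝ → ℝ), ContDiff ℝ 2 w → ∀ δ α β : ℝ, 0 < δ →
      ∫⁻ z in innerCylinder N (2 * δ) (α + 1) (β - 1),
        ENNReal.ofReal (|w z| ^ (p + 1) * (1 - ‖z.1‖ ^ 2) ^ (ε - 1 / 2)) ≤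
      ∫⁻ z in innerCylinder N δ α β, ENNReal.ofReal (K *
        (energyDensity p w z * (1 - ‖z.1‖ ^ 2) ^ ε
          + (dS w z ^ 2 + w z ^ 2) * (1 - ‖z.1‖ ^ 2) ^ (ε - 1)
          + |similarityResidual p w z| * (|w z| + |dR w z|) * (1 - ‖z.1‖ ^ 2) ^ (ε - 1 / 2))) := by
  obtain ⟨D, hD, hcut⟩ := exists_time_cutoff
  have hb : 0 < ε + 1 / 2 := by linarith
  obtain ⟨C, hC, hpow⟩ := exists_truncated_power (ε + 1 / 2) hb
  have ha : 0 < 2 / (p - 1) := div_pos two_pos (by linarith)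
  have hp1 : 0 < p - 1 := by linarith
  refine ⟨((p - 1) / (p + 1) * (ε + 1 / 2))⁻¹ * ((5 * (2 * (2 / (p - 1)) + 1) +
    2 * (2 / (p - 1) * (2 / (p - 1) + 1)) + 5 * N + 6 * D + 12) * C), by positivity,
    fun w hw δ α β hδ => ?_⟩
  obtain ⟨χ, χ', dχ, cχ', hχ, hχ', hχ1, hχ0⟩ := hcut α β
  -- F weights the multiplier y·∇w and its derivative f the multiplier w; this coupling makes the
  -- gradient terms cancel to leading order.
  obtain ⟨F, f, f', dF, df, cf', hf0, hfb, hf2⟩ := hpow δ hδ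
  have cf : Continuous f := continuous_iff_continuousAt.2 fun x => (df x).continuousAt
  have hw1 : ContDiff ℝ 1 w := hw.of_le (by norm_num)
  have hφ := contDiff_weight (N := N) df cf' dχ cχ'
  have cφ := hasCompactSupport_weight (N := N) (f := f) (χ := χ) hδ.le
    (fun x hx => (hf0 x hx).2.1) (fun τ hτ => (hχ0 τ hτ).1)
  have hψ := contDiff_weight (N := N) dF cf dχ cχ'
  have cψ := hasCompactSupport_weight (N := N) (f := F) (χ := χ) hδ.le
    (fun x hx => (hf0 x hx).1) (fun τ hτ => (hχ0 τ hτ).1)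
  obtain ⟨iW, zW⟩ := multiplier_self hw hφ cφ
  obtain ⟨iR, zR⟩ := multiplier_dR hp hw hψ cψ
  simp only [dS_weight df dχ, dR_weight df dχ, dG_weight w df dχ] at iW zW
  simp only [dS_weight dF dχ, dR_weight dF dχ, dG_weight w dF dχ] at iR zR
  have hG := (iW.sub iR).const_mul ((p - 1) / (p + 1) * (ε + 1 / 2))⁻¹
  have hG0 : ∫ z, _ = (0 : ℝ) :=
    (integral_const_mul ((p - 1) / (p + 1) * (ε + 1 / 2))⁻¹ _).trans (by
      rw [integral_sub' iW iR, zW, zR, sub_zero, mul_zero])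
  have pos : ∀ z ∈ innerCylinder N δ α β, 0 < 1 - ‖z.1‖ ^ 2 := fun z hz => hδ.trans_le hz.2
  have le1 : ∀ z : Space N × ℝ, 1 - ‖z.1‖ ^ 2 ≤ 1 := fun z => by linarith [sq_nonneg ‖z.1‖]
  have point := fun (z : Space N × ℝ) (hz : z ∈ innerCylinder N δ α β) =>
    pohozaev_pointwise (b := ε + 1 / 2) (A := 2 * (2 / (p - 1)) + 1)
      (c := 2 / (p - 1) * (2 / (p - 1) + 1)) (n := N) (p := p) (C := C) (D := D)
      (y := ‖z.1‖ ^ 2) (σ := 1 - ‖z.1‖ ^ 2) (X := (1 - ‖z.1‖ ^ 2) ^ ε)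
      (Y := (1 - ‖z.1‖ ^ 2) ^ (ε - 1)) (Z := (1 - ‖z.1‖ ^ 2) ^ (ε - 1 / 2))
      (F := F (1 - ‖z.1‖ ^ 2)) (f := f (1 - ‖z.1‖ ^ 2)) (f' := f' (1 - ‖z.1‖ ^ 2))
      (χ := χ z.2) (χ' := χ' z.2) (q := gradSq w z) (r := dR w z) (s := dS w z) (w := w z)
      (W := |w z| ^ (p + 1)) (V := |w z| ^ (p - 1)) (g := similarityResidual p w z)
      (Q := waveOp w z) hb (by positivity) (by positivity) (by positivity) hp hC hD
      (by positivity) rfl (pos z hz) (Real.rpow_nonneg (pos z hz).le _)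
      (Real.rpow_nonneg (pos z hz).le _)
      (Real.rpow_le_rpow_of_exponent_ge (pos z hz) (le1 z) (by linarith))
      (Real.rpow_le_rpow_of_exponent_ge (pos z hz) (le1 z) (by linarith))
      (by rw [← Real.rpow_natCast, ← Real.rpow_mul (pos z hz).le, ← Real.rpow_add (pos z hz)]
          congr 1; push_cast; ring)
      (by rw [← Real.rpow_one_add' (pos z hz).le (by linarith)]
          exact Real.rpow_le_rpow_of_exponent_ge (pos z hz) (le1 z) (by linarith))
      (hfb _ (pos z hz)).1.1
      ((hfb _ (pos z hz)).1.2.trans (mul_le_mul_of_nonneg_left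
        (Real.rpow_le_rpow_of_exponent_ge (pos z hz) (le1 z) (by linarith)) (by linarith)))
      (hfb _ (pos z hz)).2.1.1
      (by have h := (hfb _ (pos z hz)).2.1.2
          rw [show ε + 1 / 2 = 1 + (ε - 1 / 2) by ring,
            Real.rpow_one_add' (pos z hz).le (by linarith)] at h
          exact le_of_mul_le_mul_left (by linarith) (pos z hz))
      (by have h := (hfb _ (pos z hz)).2.2
          rw [show ε + 1 / 2 = 1 + (ε - 1 / 2) by ring,
            Real.rpow_one_add' (pos z hz).le (by linarith), sq, mul_assoc, abs_mul,
            abs_of_pos (pos z hz)] at h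
          exact le_of_mul_le_mul_left (by linarith) (pos z hz))
      (hχ _).1 (hχ _).2 (hχ' _) (sq_dR_le w z) (gradSq_nonneg w z)
      (by positivity)
      (by rw [← sq_abs (w z), ← Real.rpow_natCast |w z| 2,
            ← Real.rpow_add_of_nonneg (abs_nonneg _) (by linarith) (by norm_num)]
          congr 1; push_cast; ring)
      (by rw [similarityResidual]; ring)
  have hsub : innerCylinder N (2 * δ) (α + 1) (β - 1) ⊆ innerCylinder N δ α β :=
    innerCylinder_subset (by linarith) (by linarith) (by linarith)
  refine setLIntegral_le_of_integral_eq_zero hG hG0 (measurableSet_innerCylinder _ _ _)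
    (measurableSet_innerCylinder _ _ _) ?_ ?_ ?_ ?_ hsub ?_ ?_
  · have m0 := hw1.continuous.measurable
    have m1 := (continuous_energyDensity hp hw).measurable
    have m2 := (continuous_similarityResidual hp hw).measurable
    have m3 := hw1.continuous_dS.measurable
    have m4 := hw1.continuous_dR.measurable
    exact (((m1.mul (measurable_weight _)).add (((m3.pow_const 2).add (m0.pow_const 2)).mul
      (measurable_weight _))).add ((m2.abs.mul (m0.abs.add m4.abs)).mul
        (measurable_weight _))).const_mul _
  · intro z hz
    exact mul_nonneg (by positivity) (Real.rpow_nonneg (pos z (hsub hz)).le _)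
  · intro z hz
    exact (point z hz).1
  · intro z hz
    by_cases h : z.2 ∈ Icc α β
    · have h' : 1 - ‖z.1‖ ^ 2 ≤ δ := le_of_not_gt fun hlt => hz ⟨h, hlt.le⟩
      simp [hf0 _ h']
    · simp [hχ0 _ h]
  · intro z hz
    exact (point z hz).2.1
  · intro z hz
    refine (point z (hsub hz)).2.2 (hχ1 _ hz.1.1 hz.1.2) ?_
    have h := hf2 _ hz.2
    have hp := pos z (hsub hz)
    rw [show (1 - ‖z.1‖ ^ 2) ^ (ε + 1 / 2) =
      (1 - ‖z.1‖ ^ 2) * (1 - ‖z.1‖ ^ 2) ^ (ε - 1 / 2) by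
      rw [← Real.rpow_one_add' hp.le (by linarith)]; congr 1; ring] at h
    exact le_of_mul_le_mul_left (by linarith) hp

/-- The main estimate for functions of class `C²`, with an error term. -/
lemma singular_estimate_of_contDiff (N : ℕ) {p ε : ℝ} (hp : 1 < p) (hε : 0 < ε) :
    ∃ K : ℝ, 0 ≤ K ∧ ∀ (w : Space N × ℝ → ℝ), ContDiff ℝ 2 w → ∀ δ α β : ℝ, 0 < δ →
      ∫⁻ z in innerCylinder N (4 * δ) (α + 2) (β - 2),
        ENNReal.ofReal (|w z| ^ (p + 1) * (1 - ‖z.1‖ ^ 2) ^ (ε - 1 / 2)) ≤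
      ENNReal.ofReal K * ∫⁻ z in innerCylinder N δ α β, ENNReal.ofReal
        (energyDensity p w z * (1 - ‖z.1‖ ^ 2) ^ ε + |similarityResidual p w z| *
          ((|w z| + |dR w z| + |dS w z|) * (1 - ‖z.1‖ ^ 2) ^ (ε - 1 / 2))) := by
  obtain ⟨K₁, hK₁, h₁⟩ := energy_hardy_estimate N hp hε
  obtain ⟨K₂, hK₂, h₂⟩ := pohozaev_estimate N hp hε
  refine ⟨K₂ + K₂ * K₁, by positivity, fun w hw δ α β hδ => ?_⟩
  have hw1 : ContDiff ℝ 1 w := hw.of_le (by norm_num)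
  have m0 := hw1.continuous.measurable
  have m1 := (continuous_energyDensity hp hw).measurable
  have m2 := (continuous_similarityResidual hp hw).measurable
  have m3 := hw1.continuous_dS.measurable
  have m4 := hw1.continuous_dR.measurable
  have mw := fun b : ℝ => measurable_weight (N := N) b
  have hsub : innerCylinder N (2 * δ) (α + 1) (β - 1) ⊆ innerCylinder N δ α β :=
    innerCylinder_subset (by linarith) (by linarith) (by linarith)
  have pos : ∀ z ∈ innerCylinder N δ α β, 0 < 1 - ‖z.1‖ ^ 2 := fun z hz => hδ.trans_le hz.2
  have le1 : ∀ z : Space N × ℝ, 1 - ‖z.1‖ ^ 2 ≤ 1 := fun z => by linarith [sq_nonneg ‖z.1‖]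
  set R : Space N × ℝ → ℝ := fun z => energyDensity p w z * (1 - ‖z.1‖ ^ 2) ^ ε +
    |similarityResidual p w z| *
      ((|w z| + |dR w z| + |dS w z|) * (1 - ‖z.1‖ ^ 2) ^ (ε - 1 / 2)) with hR
  set S : Space N × ℝ → ℝ := fun z => (dS w z ^ 2 + w z ^ 2) * (1 - ‖z.1‖ ^ 2) ^ (ε - 1) with hS
  have mR : Measurable R := (m1.mul (mw _)).add
    (m2.abs.mul (((m0.abs.add m4.abs).add m3.abs).mul (mw _)))
  have e1 : ∫⁻ z in innerCylinder N (2 * δ) (α + 1) (β - 1), ENNReal.ofReal (S z) ≤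
      ENNReal.ofReal K₁ * ∫⁻ z in innerCylinder N δ α β, ENNReal.ofReal (R z) := by
    refine (h₁ w hw δ α β hδ).trans ?_
    rw [← lintegral_const_mul _ mR.ennreal_ofReal]
    refine setLIntegral_mono' (measurableSet_innerCylinder _ _ _) fun z hz => ?_
    rw [← ENNReal.ofReal_mul hK₁]
    refine ENNReal.ofReal_le_ofReal (mul_le_mul_of_nonneg_left ?_ hK₁)
    have h := Real.rpow_le_rpow_of_exponent_ge (pos z hz) (le1 z) (show ε - 1 / 2 ≤ ε by linarith)
    have h0 := Real.rpow_nonneg (pos z hz).le (ε - 1 / 2)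
    have k1 := mul_le_mul_of_nonneg_left h (by positivity :
      0 ≤ |similarityResidual p w z| * |dS w z|)
    have k2 : 0 ≤ |similarityResidual p w z| * (|w z| + |dR w z|) *
      (1 - ‖z.1‖ ^ 2) ^ (ε - 1 / 2) := by positivity
    simp only [hR]
    linarith
  have e2 : ∫⁻ z in innerCylinder N (4 * δ) (α + 2) (β - 2),
        ENNReal.ofReal (|w z| ^ (p + 1) * (1 - ‖z.1‖ ^ 2) ^ (ε - 1 / 2)) ≤
      ENNReal.ofReal K₂ * (∫⁻ z in innerCylinder N (2 * δ) (α + 1) (β - 1),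
        (ENNReal.ofReal (R z) + ENNReal.ofReal (S z))) := by
    -- Starting from the intermediate cylinder leaves room to absorb the singular quadratic terms by
    -- the first estimate. Two steps cost a factor 4 in δ and two units of time at each end.
    have := h₂ w hw (2 * δ) (α + 1) (β - 1) (by linarith)
    rw [show 2 * (2 * δ) = 4 * δ by ring, show α + 1 + 1 = α + 2 by ring,
      show β - 1 - 1 = β - 2 by ring] at this
    refine this.trans ?_
    have mS : Measurable S := ((m3.pow_const 2).add (m0.pow_const 2)).mul (mw _)
    have mRS : Measurable (fun z => ENNReal.ofReal (R z) + ENNReal.ofReal (S z)) :=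
      mR.ennreal_ofReal.add mS.ennreal_ofReal
    rw [← lintegral_const_mul _ mRS]
    refine setLIntegral_mono' (measurableSet_innerCylinder _ _ _) fun z hz => ?_
    have hz' := pos z (hsub hz)
    have h0 := Real.rpow_nonneg hz'.le (ε - 1 / 2)
    have k0 := mul_nonneg (energyDensity_nonneg p w z) (Real.rpow_nonneg hz'.le ε)
    have kR : 0 ≤ R z := by simp only [hR]; positivity
    have kS : 0 ≤ S z := mul_nonneg (by positivity) (Real.rpow_nonneg hz'.le _)
    rw [← ENNReal.ofReal_add kR kS, ← ENNReal.ofReal_mul hK₂]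
    refine ENNReal.ofReal_le_ofReal (mul_le_mul_of_nonneg_left ?_ hK₂)
    have k2 : 0 ≤ |similarityResidual p w z| * |dS w z| * (1 - ‖z.1‖ ^ 2) ^ (ε - 1 / 2) := by
      positivity
    simp only [hR, hS]
    linarith
  refine e2.trans ?_
  rw [lintegral_add_left mR.ennreal_ofReal, ENNReal.ofReal_add hK₂ (by positivity),
    ENNReal.ofReal_mul hK₂, add_mul, mul_add, mul_assoc]
  gcongr

end IntegralEstimates

/-! ### The equation in similarity variables. -/

noncomputable section SimilarityVariables

variable {N : ℕ}

/-- The change to similarity variables. -/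
def simMap (x : Space N) (T : ℝ) (z : Space N × ℝ) : Space N × ℝ :=
  (x + Real.exp (-z.2) • z.1, T - Real.exp (-z.2))

/-- `(T - t) ^ b V` in similarity variables. -/
def simTransform (b : ℝ) (x : Space N) (T : ℝ) (V : Space N × ℝ → ℝ) (z : Space N × ℝ) : ℝ :=
  Real.exp (-z.2) ^ b * V (simMap x T z)

lemma contDiff_simMap {n : WithTop ℕ∞} (x : Space N) (T : ℝ) : ContDiff ℝ n (simMap x T) := by
  have h : ContDiff ℝ n (fun z : Space N × ℝ => Real.exp (-z.2)) := contDiff_snd.neg.exp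
  exact (contDiff_const.add (h.smul contDiff_fst)).prodMk (contDiff_const.sub h)

lemma ContDiff.simTransform {n : WithTop ℕ∞} {V : Space N × ℝ → ℝ} (hV : ContDiff ℝ n V)
    (b : ℝ) (x : Space N) (T : ℝ) : ContDiff ℝ n (simTransform b x T V) := by
  have h : ContDiff ℝ n (fun z : Space N × ℝ => Real.exp (-z.2)) := contDiff_snd.neg.exp
  exact (h.rpow_const_of_ne fun z => (Real.exp_pos _).ne').mul (hV.comp (contDiff_simMap x T))

lemma hasFDerivAt_exp_neg_snd (z : Space N × ℝ) :
    HasFDerivAt (fun z : Space N × ℝ => Real.exp (-z.2))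
      (Real.exp (-z.2) • -ContinuousLinearMap.snd ℝ (Space N) ℝ) z :=
  hasFDerivAt_snd.neg.exp

lemma hasFDerivAt_simTransform {V : Space N × ℝ → ℝ} (hV : ContDiff ℝ 1 V)
    (b : ℝ) (x : Space N) (T : ℝ) (z : Space N × ℝ) :
    ∃ L : Space N × ℝ →L[ℝ] ℝ, HasFDerivAt (simTransform b x T V) L z ∧
      ∀ h : Space N × ℝ, L h = -(b * h.2) * simTransform b x T V z
        + Real.exp (-z.2) ^ (b + 1) * fderiv ℝ V (simMap x T z) (h.1 - h.2 • z.1, h.2) := by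
  have he := hasFDerivAt_exp_neg_snd z
  have h1 := (he.rpow_const (p := b) (Or.inl (Real.exp_pos _).ne'))
  have h2 := ((he.smul (hasFDerivAt_fst (p := z))).const_add x).prodMk (he.const_sub T)
  have h3 := (hV.differentiable one_ne_zero (simMap x T z)).hasFDerivAt.comp z h2
  refine ⟨_, h1.mul h3, fun h => ?_⟩
  have e1 : Real.exp (-z.2) ^ (b + 1) = Real.exp (-z.2) ^ b * Real.exp (-z.2) := by
    rw [Real.rpow_add (Real.exp_pos _), Real.rpow_one]
  have e2 : Real.exp (-z.2) ^ (b - 1) * Real.exp (-z.2) = Real.exp (-z.2) ^ b := by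
    rw [Real.rpow_sub (Real.exp_pos _), Real.rpow_one, div_mul_cancel₀ _ (Real.exp_pos _).ne']
  have e3 : ((Real.exp (-z.2) • h.1 + -((Real.exp (-z.2) * h.2) • z.1), Real.exp (-z.2) * h.2) :
      Space N × ℝ) = Real.exp (-z.2) • (h.1 - h.2 • z.1, h.2) := by
    refine Prod.ext ?_ ?_
    · simp only [Prod.smul_fst]
      module
    · simp
  have e4 : fderiv ℝ V (simMap x T z)
      (Real.exp (-z.2) • h.1 + -((Real.exp (-z.2) * h.2) • z.1), Real.exp (-z.2) * h.2) =
      Real.exp (-z.2) * fderiv ℝ V (simMap x T z) (h.1 - h.2 • z.1, h.2) := by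
    rw [e3, map_smul, smul_eq_mul]
  simp [simTransform, e1, simMap] at e4 ⊢
  rw [e4]
  linear_combination (-(b * h.2) * V (x + Real.exp (-z.2) • z.1, T - Real.exp (-z.2))) * e2

section

variable {V : Space N × ℝ → ℝ} (b : ℝ) (x : Space N) (T : ℝ)

lemma dI_simTransform (hV : ContDiff ℝ 1 V) (i : Fin N) :
    dI i (simTransform b x T V) = simTransform (b + 1) x T (dI i V) := by
  funext z
  obtain ⟨L, hL, h⟩ := hasFDerivAt_simTransform hV b x T z
  rw [dI, hL.fderiv, h]
  simp [simTransform, dI]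

lemma dR_simTransform (hV : ContDiff ℝ 1 V) (z : Space N × ℝ) :
    dR (simTransform b x T V) z =
      Real.exp (-z.2) ^ (b + 1) * fderiv ℝ V (simMap x T z) (z.1, 0) := by
  obtain ⟨L, hL, h⟩ := hasFDerivAt_simTransform hV b x T z
  rw [dR, hL.fderiv, h]
  simp

/-- At fixed y the point (x + e^{-s}y, T - e^{-s}) moves with velocity e^{-s}(-y, 1), whence the
radial derivative. -/
lemma dS_simTransform (hV : ContDiff ℝ 1 V) (z : Space N × ℝ) :
    dS (simTransform b x T V) z = -b * simTransform b x T V z +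
      simTransform (b + 1) x T (dS V) z - dR (simTransform b x T V) z := by
  rw [dR_simTransform b x T hV]
  obtain ⟨L, hL, h⟩ := hasFDerivAt_simTransform hV b x T z
  rw [dS, hL.fderiv, h]
  have : ((0 - (1 : ℝ) • z.1, 1) : Space N × ℝ) = (0, 1) - (z.1, 0) := by
    refine Prod.ext ?_ ?_ <;> simp
  simp only [this, map_sub, simTransform, dS]
  ring

lemma lap_simTransform (hV : ContDiff ℝ 2 V) :
    lap (simTransform b x T V) = simTransform (b + 2) x T (lap V) := by
  funext z
  simp only [lap, dI_simTransform b x T (hV.of_le (by norm_num : (1 : WithTop ℕ∞) ≤ 2)),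
    dI_simTransform (b + 1) x T (hV.dI_of_two _)]
  rw [show b + 1 + 1 = b + 2 by ring]
  simp [simTransform, Finset.mul_sum, lap]

/-- The residual of the equation transforms as expected. -/
lemma similarityResidual_simTransform {p : ℝ} (hp : 1 < p) (hV : ContDiff ℝ 2 V) :
    similarityResidual p (simTransform (2 / (p - 1)) x T V) =
      simTransform (2 / (p - 1) + 2) x T
        (fun z => dS (dS V) z - lap V z - |V z| ^ (p - 1) * V z) := by
  set a := 2 / (p - 1) with ha
  have hV1 : ContDiff ℝ 1 V := hV.of_le (by norm_num)
  set w := simTransform a x T V with hw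
  have cw : ContDiff ℝ 2 w := hV.simTransform a x T
  -- ∂_t acts as ∂_s + y·∇ + a and raises the exponent by one. Applied again, with a + 1, it turns
  -- ∂_t² into (∂_s + y·∇ + a + 1)(∂_s + y·∇ + a).
  have e1 : simTransform (a + 1) x T (dS V) = fun z => dS w z + dR w z + a * w z := by
    funext z
    rw [dS_simTransform a x T hV1 z]
    ring
  funext z
  have e2 := dS_simTransform (a + 1) x T hV.dS_of_two z
  have d0 := (cw.differentiable two_ne_zero z).hasFDerivAt
  have ds := (cw.dS_of_two.differentiable one_ne_zero z).hasFDerivAt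
  have dr := (cw.dR_of_two.differentiable one_ne_zero z).hasFDerivAt
  have dd : fderiv ℝ (fun z => dS w z + dR w z + a * w z) z = _ :=
    ((ds.fun_add dr).fun_add (d0.const_mul a)).fderiv
  rw [e1, dS, dR, dd] at e2
  simp only [add_apply, smul_apply, smul_eq_mul] at e2
  simp only [← dS.eq_1, ← dR.eq_1] at e2
  -- Because a(p-1) = 2, the nonlinearity scales like two derivatives.
  have e3 : |w z| ^ (p - 1) * w z =
      simTransform (a + 2) x T (fun z => |V z| ^ (p - 1) * V z) z := by
    have hE := Real.exp_pos (-z.2)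
    have hEa : 0 < Real.exp (-z.2) ^ a := Real.rpow_pos_of_pos hE a
    simp only [hw, simTransform]
    rw [abs_mul, abs_of_pos hEa, Real.mul_rpow hEa.le (abs_nonneg _), ← Real.rpow_mul hE.le,
      show a * (p - 1) = 2 by rw [ha]; field_simp [(by linarith : p - 1 ≠ 0)],
      Real.rpow_add hE]
    ring
  rw [similarityResidual, e3]
  have e4 : lap w z = simTransform (a + 2) x T (lap V) z := by
    rw [hw, lap_simTransform a x T hV]
  have e5 : simTransform (a + 2) x T (fun z => dS (dS V) z - lap V z - |V z| ^ (p - 1) * V z) z =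
      simTransform (a + 2) x T (dS (dS V)) z - simTransform (a + 2) x T (lap V) z -
        simTransform (a + 2) x T (fun z => |V z| ^ (p - 1) * V z) z := by
    simp only [simTransform]; ring
  rw [e5, waveOp, e4, dS_dR cw]
  rw [dS_dR cw, show a + 1 + 1 = a + 2 by ring] at e2
  linear_combination e2

end

section ClassicalField

variable {v : Space N → ℝ → ℝ}

lemma hasFDerivAt_slice (hv : ContDiff ℝ 1 (fun z : Space N × ℝ => v z.1 z.2)) (ξ : Space N)
    (t : ℝ) : HasFDerivAt (fun ξ => v ξ t)
      ((fderiv ℝ (fun z : Space N × ℝ => v z.1 z.2) (ξ, t)).comp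
        (ContinuousLinearMap.inl ℝ (Space N) ℝ)) ξ := by
  have h := (hv.differentiable one_ne_zero (ξ, t)).hasFDerivAt
  exact HasFDerivAt.comp (g := fun z : Space N × ℝ => v z.1 z.2) ξ h
    (hasFDerivAt_prodMk_left (𝕜 := ℝ) ξ t)

lemma hasDerivAt_slice (hv : ContDiff ℝ 1 (fun z : Space N × ℝ => v z.1 z.2)) (ξ : Space N)
    (t : ℝ) : HasDerivAt (fun t => v ξ t) (dS (fun z : Space N × ℝ => v z.1 z.2) (ξ, t)) t := by
  have h := (hv.differentiable one_ne_zero (ξ, t)).hasFDerivAt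
  exact (HasFDerivAt.comp (g := fun z : Space N × ℝ => v z.1 z.2) t h
    (hasFDerivAt_prodMk_right ξ t)).hasDerivAt.congr_deriv (by simp [dS])

lemma classicalField_dt (hv : ContDiff ℝ 1 (fun z : Space N × ℝ => v z.1 z.2)) (ξ : Space N)
    (t : ℝ) : (classicalField v).dt ξ t = dS (fun z : Space N × ℝ => v z.1 z.2) (ξ, t) :=
  (hasDerivAt_slice hv ξ t).deriv

lemma inner_classicalField_grad (hv : ContDiff ℝ 1 (fun z : Space N × ℝ => v z.1 z.2))
    (y ξ : Space N) (t : ℝ) : inner ℝ y ((classicalField v).grad ξ t) =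
      fderiv ℝ (fun z : Space N × ℝ => v z.1 z.2) (ξ, t) (y, 0) := by
  rw [real_inner_comm]
  change inner ℝ (gradient (fun ξ => v ξ t) ξ) y = _
  rw [gradient, InnerProductSpace.toDual_symm_apply, (hasFDerivAt_slice hv ξ t).fderiv]
  simp

lemma classicalField_grad_apply (hv : ContDiff ℝ 1 (fun z : Space N × ℝ => v z.1 z.2))
    (i : Fin N) (ξ : Space N) (t : ℝ) : (classicalField v).grad ξ t i =
      dI i (fun z : Space N × ℝ => v z.1 z.2) (ξ, t) := by
  rw [dI, ← inner_classicalField_grad hv]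
  simp [EuclideanSpace.inner_single_left]

lemma waveResidual_eq (p : ℝ) (hv : ContDiff ℝ 2 (fun z : Space N × ℝ => v z.1 z.2))
    (ξ : Space N) (t : ℝ) : waveResidual p v ξ t =
      dS (dS (fun z : Space N × ℝ => v z.1 z.2)) (ξ, t) - lap (fun z : Space N × ℝ => v z.1 z.2)
        (ξ, t) - |v ξ t| ^ (p - 1) * v ξ t := by
  have hv1 : ContDiff ℝ 1 (fun z : Space N × ℝ => v z.1 z.2) := hv.of_le (by norm_num)
  have e1 : iteratedDeriv 2 (fun τ => v ξ τ) t =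
      dS (dS (fun z : Space N × ℝ => v z.1 z.2)) (ξ, t) := by
    rw [iteratedDeriv_succ, iteratedDeriv_one]
    rw [show deriv (fun τ => v ξ τ) = fun τ => dS (fun z : Space N × ℝ => v z.1 z.2) (ξ, τ) from
      funext fun τ => (hasDerivAt_slice hv1 ξ τ).deriv]
    exact (hasDerivAt_slice (v := fun ξ τ => dS (fun z : Space N × ℝ => v z.1 z.2) (ξ, τ))
      hv.dS_of_two ξ t).deriv
  have e2 : (Δ (fun ξ => v ξ t)) ξ = lap (fun z : Space N × ℝ => v z.1 z.2) (ξ, t) := by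
    rw [InnerProductSpace.laplacian_eq_iteratedFDeriv_orthonormalBasis _
      (EuclideanSpace.basisFun (Fin N) ℝ), lap]
    refine Finset.sum_congr rfl fun i _ => ?_
    rw [iteratedFDeriv_two_apply]
    have hs : ContDiff ℝ 2 (fun ξ => v ξ t) := hv.comp (contDiff_id.prodMk contDiff_const)
    have hd := ((hs.fderiv_right (m := 1) (by norm_num)).differentiable one_ne_zero ξ).hasFDerivAt
    have h1 := (hd.clm_apply (hasFDerivAt_const (EuclideanSpace.single i (1 : ℝ)) ξ)).fderiv
    have h2 : (fun ξ' => fderiv ℝ (fun ξ => v ξ t) ξ' (EuclideanSpace.single i (1 : ℝ))) =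
        fun ξ' => dI i (fun z : Space N × ℝ => v z.1 z.2) (ξ', t) := by
      funext ξ'
      rw [(hasFDerivAt_slice hv1 ξ' t).fderiv]
      simp [dI]
    have h3 := (hasFDerivAt_slice
      (v := fun ξ τ => dI i (fun z : Space N × ℝ => v z.1 z.2) (ξ, τ)) (hv.dI_of_two i) ξ t).fderiv
    rw [h2, h3] at h1
    have h4 := congrArg (fun L : Space N →L[ℝ] ℝ => L (EuclideanSpace.single i 1)) h1
    simp at h4 ⊢
    exact h4.symm
  rw [waveResidual, e1, e2]

/-- The similarity transform of a function of class `C²`, in terms of its derivatives. -/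
lemma selfSimilar_classicalField {p : ℝ} (x : Space N) (T : ℝ)
    (hv : ContDiff ℝ 2 (fun z : Space N × ℝ => v z.1 z.2)) (z : Space N × ℝ) :
    let w := simTransform (2 / (p - 1)) x T (fun z : Space N × ℝ => v z.1 z.2)
    let W := selfSimilar p (classicalField v) x T
    W.val z.1 z.2 = w z ∧ ‖W.grad z.1 z.2‖ ^ 2 = gradSq w z ∧ W.dt z.1 z.2 = dS w z := by
  intro w W
  have hv1 : ContDiff ℝ 1 (fun z : Space N × ℝ => v z.1 z.2) := hv.of_le (by norm_num)
  have hE := Real.exp_pos (-z.2)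
  refine ⟨rfl, ?_, ?_⟩
  · rw [EuclideanSpace.norm_sq_eq, gradSq]
    refine Finset.sum_congr rfl fun i _ => ?_
    rw [dI_simTransform _ x T hv1]
    simp only [W, selfSimilar, simTransform, PiLp.smul_apply, smul_eq_mul, Real.norm_eq_abs, sq_abs,
      classicalField_grad_apply hv1, Real.rpow_add hE, Real.rpow_one, simMap]
  · rw [dS_simTransform _ x T hv1, dR_simTransform _ x T hv1]
    simp only [W, selfSimilar, simTransform, Real.rpow_add hE, Real.rpow_one, simMap,
      inner_classicalField_grad hv1, classicalField_dt hv1]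
    simp only [classicalField]
    ring

end ClassicalField

end SimilarityVariables

/-! ### Energy densities of fields and of their differences. -/

noncomputable section FieldDensity

variable {N : ℕ}

/-- The difference of two fields. -/
def WaveField.diff (V U : WaveField N) : WaveField N where
  val := fun x t => V.val x t - U.val x t
  grad := fun x t => V.grad x t - U.grad x t
  dt := fun x t => V.dt x t - U.dt x t

/-- The energy density of a field. -/
def fieldDensity (p : ℝ) (W : WaveField N) (z : Space N × ℝ) : ℝ :=
  ‖W.grad z.1 z.2‖ ^ 2 + W.dt z.1 z.2 ^ 2 + W.val z.1 z.2 ^ 2 + |W.val z.1 z.2| ^ (p + 1)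

lemma fieldDensity_nonneg (p : ℝ) (W : WaveField N) (z : Space N × ℝ) :
    0 ≤ fieldDensity p W z := by
  rw [fieldDensity]; positivity

lemma selfSimilar_diff (p : ℝ) (V U : WaveField N) (x : Space N) (T : ℝ) :
    selfSimilar p (V.diff U) x T = (selfSimilar p V x T).diff (selfSimilar p U x T) := by
  simp only [selfSimilar, WaveField.diff, WaveField.mk.injEq]
  refine ⟨?_, ?_, ?_⟩
  · funext y s; ring
  · funext y s; rw [smul_sub]
  · funext y s; rw [inner_sub_right]; ring

lemma energyDist_eq {p : ℝ} (hp : 1 < p) (V U : WaveField N) (x : Space N) (r t : ℝ) :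
    energyDist p V U x r t =
      ∫⁻ ξ in Metric.ball x r, ENNReal.ofReal (fieldDensity p (V.diff U) (ξ, t)) := by
  refine lintegral_congr fun ξ => ?_
  simp only [fieldDensity, WaveField.diff]
  rw [ENNReal.ofReal_add (by positivity) (by positivity),
    ENNReal.ofReal_add (by positivity) (by positivity),
    ENNReal.ofReal_add (by positivity) (by positivity),
    ENNReal.ofReal_pow (norm_nonneg _), ofReal_norm, ← ENNReal.ofReal_rpow_of_nonneg
      (abs_nonneg _) (by linarith), ← Real.norm_eq_abs, ofReal_norm, ← sq_abs (V.dt ξ t - U.dt ξ t),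
    ← sq_abs (V.val ξ t - U.val ξ t), ENNReal.ofReal_pow (abs_nonneg _),
    ENNReal.ofReal_pow (abs_nonneg _), ← Real.norm_eq_abs, ← Real.norm_eq_abs, ofReal_norm,
    ofReal_norm]

lemma abs_rpow_le_of_abs_le_add {a b c q : ℝ} (hq : 0 ≤ q) (h : |a| ≤ |b| + |c|) :
    |a| ^ q ≤ 2 ^ q * (|b| ^ q + |c| ^ q) := by
  have h1 : |a| ≤ 2 * max |b| |c| := by
    linarith [le_max_left |b| |c|, le_max_right |b| |c|]
  have h2 : (max |b| |c|) ^ q ≤ |b| ^ q + |c| ^ q := by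
    have hb := Real.rpow_nonneg (abs_nonneg b) q
    have hc := Real.rpow_nonneg (abs_nonneg c) q
    rcases max_cases |b| |c| with h | h <;> rw [h.1] <;> linarith
  calc |a| ^ q ≤ (2 * max |b| |c|) ^ q := Real.rpow_le_rpow (abs_nonneg _) h1 hq
    _ = 2 ^ q * (max |b| |c|) ^ q :=
        Real.mul_rpow (by norm_num) (le_max_of_le_left (abs_nonneg b))
    _ ≤ _ := mul_le_mul_of_nonneg_left h2 (by positivity)

/-- The constant 2^{p+1} required by the power term is at least 2, so it also serves the quadratic
terms. -/
lemma density_le_of_norm_le {p : ℝ} (hp : 1 < p) {ga gb gc ta tb tc va vb vc : ℝ} (hga : 0 ≤ ga)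
    (hg : ga ≤ gb + gc) (ht : |ta| ≤ |tb| + |tc|) (hv : |va| ≤ |vb| + |vc|) :
    ga ^ 2 + ta ^ 2 + va ^ 2 + |va| ^ (p + 1) ≤ 2 ^ (p + 1) *
      ((gb ^ 2 + tb ^ 2 + vb ^ 2 + |vb| ^ (p + 1)) + (gc ^ 2 + tc ^ 2 + vc ^ 2 + |vc| ^ (p + 1))) := by
  have h2 : (2 : ℝ) ≤ 2 ^ (p + 1) := by
    conv_lhs => rw [← Real.rpow_one 2]
    exact Real.rpow_le_rpow_of_exponent_le (by norm_num) (by linarith)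
  have hq := abs_rpow_le_of_abs_le_add (q := p + 1) (by linarith) hv
  have sqs : ∀ {a b c : ℝ}, |a| ≤ |b| + |c| → a ^ 2 ≤ 2 * (b ^ 2 + c ^ 2) := by
    intro a b c h
    rw [← sq_abs a, ← sq_abs b, ← sq_abs c]
    nlinarith [sq_nonneg (|b| - |c|), abs_nonneg a]
  have h3 := sqs ht
  have h4 := sqs hv
  have h5 : ga ^ 2 ≤ 2 * (gb ^ 2 + gc ^ 2) := by nlinarith [sq_nonneg (gb - gc)]
  have h6 := mul_le_mul_of_nonneg_right h2 (by positivity :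
    0 ≤ (gb ^ 2 + gc ^ 2) + (tb ^ 2 + tc ^ 2) + (vb ^ 2 + vc ^ 2))
  linarith

lemma fieldDensity_le_right {p : ℝ} (hp : 1 < p) (A B : WaveField N) (z : Space N × ℝ) :
    fieldDensity p A z ≤ 2 ^ (p + 1) * (fieldDensity p B z + fieldDensity p (A.diff B) z) := by
  refine density_le_of_norm_le hp (norm_nonneg _) ?_ ?_ ?_
  · exact (norm_add_le _ _).trans_eq' (by simp [WaveField.diff])
  · exact (abs_add_le _ _).trans_eq' (by simp [WaveField.diff])
  · exact (abs_add_le _ _).trans_eq' (by simp [WaveField.diff])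

lemma fieldDensity_le_left {p : ℝ} (hp : 1 < p) (A B : WaveField N) (z : Space N × ℝ) :
    fieldDensity p B z ≤ 2 ^ (p + 1) * (fieldDensity p A z + fieldDensity p (A.diff B) z) := by
  refine density_le_of_norm_le hp (norm_nonneg _) ?_ ?_ ?_
  · exact (norm_sub_le _ _).trans_eq' (by simp [WaveField.diff])
  · exact (abs_sub _ _).trans_eq' (by simp [WaveField.diff])
  · exact (abs_sub _ _).trans_eq' (by simp [WaveField.diff])

/-- The density of the similarity transform is controlled locally in time. -/
lemma exists_fieldDensity_selfSimilar_le {p : ℝ} (hp : 1 < p) (α : ℝ) :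
    ∃ M : ℝ, 0 ≤ M ∧ ∀ (U : WaveField N) (x : Space N) (T : ℝ) (z : Space N × ℝ), α ≤ z.2 →
      ‖z.1‖ ≤ 1 → fieldDensity p (selfSimilar p U x T) z ≤ M * fieldDensity p U (simMap x T z) := by
  set a := 2 / (p - 1) with ha
  have ha0 : 0 < a := div_pos two_pos (by linarith)
  set E₀ := Real.exp (-α)
  set k₀ := E₀ ^ a
  have hE₀ : 0 < E₀ := Real.exp_pos _
  have hk₀ : 0 < k₀ := Real.rpow_pos_of_pos hE₀ _
  -- The factors 3 come from squaring the three-term sum ∂_s w. In 4 = 1 + 3 the 1 is |∇w|², and the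
  -- inner product with y is bounded through |y| ≤ 1.
  refine ⟨k₀ ^ (p + 1) + k₀ ^ 2 * (1 + 3 * a ^ 2) + 4 * (k₀ * E₀) ^ 2, by positivity,
    fun U x T z hz hy => ?_⟩
  set E := Real.exp (-z.2)
  set k := E ^ a
  have hE : 0 < E := Real.exp_pos _
  have hEE : E ≤ E₀ := Real.exp_le_exp.2 (by linarith)
  have hk : 0 < k := Real.rpow_pos_of_pos hE _
  have hkk : k ≤ k₀ := Real.rpow_le_rpow hE.le hEE ha0.le
  have hkE : k * E ≤ k₀ * E₀ := mul_le_mul hkk hEE hE.le hk₀.le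
  obtain ⟨v, hv⟩ : ∃ v, v = U.val (simMap x T z).1 (simMap x T z).2 := ⟨_, rfl⟩
  obtain ⟨g, hg⟩ : ∃ g, g = U.grad (simMap x T z).1 (simMap x T z).2 := ⟨_, rfl⟩
  obtain ⟨d, hd⟩ : ∃ d, d = U.dt (simMap x T z).1 (simMap x T z).2 := ⟨_, rfl⟩
  have e1 : (selfSimilar p U x T).val z.1 z.2 = k * v := by rw [hv]; rfl
  have e2 : (selfSimilar p U x T).grad z.1 z.2 = (k * E) • g := by rw [hg]; rfl
  have e3 : (selfSimilar p U x T).dt z.1 z.2 = k * (-a * v + E * (d - inner ℝ z.1 g)) := by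
    rw [hg, hd, hv]; rfl
  rw [fieldDensity, fieldDensity, e1, e2, e3, ← hv, ← hg, ← hd, norm_smul, Real.norm_eq_abs,
    abs_of_pos (by positivity : 0 < k * E), abs_mul, abs_of_pos hk,
    Real.mul_rpow hk.le (abs_nonneg v)]
  obtain ⟨i, hi⟩ : ∃ i, i = inner ℝ z.1 g := ⟨_, rfl⟩
  rw [← hi]
  have hig : i ^ 2 ≤ ‖g‖ ^ 2 := by
    rw [← sq_abs, hi]
    refine pow_le_pow_left₀ (abs_nonneg _) ((abs_real_inner_le_norm _ _).trans ?_) 2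
    exact mul_le_of_le_one_left (norm_nonneg _) hy
  have q1 : k ^ 2 ≤ k₀ ^ 2 := pow_le_pow_left₀ hk.le hkk 2
  have q2 : (k * E) ^ 2 ≤ (k₀ * E₀) ^ 2 := pow_le_pow_left₀ (by positivity) hkE 2
  have q3 : k ^ (p + 1) ≤ k₀ ^ (p + 1) := Real.rpow_le_rpow hk.le hkk (by linarith)
  have r1 : (k * (-a * v + E * (d - i))) ^ 2 ≤
      k ^ 2 * (3 * a ^ 2 * v ^ 2) + (k * E) ^ 2 * (3 * d ^ 2 + 3 * i ^ 2) := by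
    have : k ^ 2 * (3 * a ^ 2 * v ^ 2) + (k * E) ^ 2 * (3 * d ^ 2 + 3 * i ^ 2) -
      (k * (-a * v + E * (d - i))) ^ 2 = k ^ 2 * ((a * v + E * d) ^ 2 + (a * v - E * i) ^ 2
        + (E * d + E * i) ^ 2) := by ring
    have h0 : 0 ≤ k ^ 2 * ((a * v + E * d) ^ 2 + (a * v - E * i) ^ 2
        + (E * d + E * i) ^ 2) := by positivity
    linarith
  obtain ⟨Q, hQ⟩ : ∃ Q, Q = |v| ^ (p + 1) := ⟨_, rfl⟩
  obtain ⟨κ, hκ⟩ : ∃ κ, κ = k₀ ^ (p + 1) := ⟨_, rfl⟩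
  have hQ0 : 0 ≤ Q := by rw [hQ]; positivity
  have hκ0 : 0 ≤ κ := by rw [hκ]; positivity
  rw [← hκ] at q3
  rw [← hQ, ← hκ]
  obtain ⟨F, hF⟩ : ∃ F, F = ‖g‖ ^ 2 + d ^ 2 + v ^ 2 + Q := ⟨_, rfl⟩
  have m1 : k ^ 2 * ((1 + 3 * a ^ 2) * v ^ 2) ≤ k₀ ^ 2 * ((1 + 3 * a ^ 2) * v ^ 2) :=
    mul_le_mul_of_nonneg_right q1 (by positivity)
  have m2 : (k * E) ^ 2 * (4 * ‖g‖ ^ 2 + 4 * d ^ 2) ≤ (k₀ * E₀) ^ 2 * (4 * ‖g‖ ^ 2 + 4 * d ^ 2) :=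
    mul_le_mul_of_nonneg_right q2 (by positivity)
  have m3 : k ^ (p + 1) * Q ≤ κ * Q := mul_le_mul_of_nonneg_right q3 hQ0
  have m4 : (k * E) ^ 2 * i ^ 2 ≤ (k * E) ^ 2 * ‖g‖ ^ 2 :=
    mul_le_mul_of_nonneg_left hig (by positivity)
  have n1 : 0 ≤ κ * (‖g‖ ^ 2 + d ^ 2 + v ^ 2) := by positivity
  have n2 : 0 ≤ k₀ ^ 2 * (1 + 3 * a ^ 2) * (‖g‖ ^ 2 + d ^ 2 + Q) := by positivity
  have n3 : 0 ≤ 4 * (k₀ * E₀) ^ 2 * (v ^ 2 + Q) := by positivity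
  have n4 : 0 ≤ (k * E) ^ 2 * d ^ 2 := by positivity
  linarith

lemma continuous_simMap (x : Space N) (T : ℝ) : Continuous (simMap x T) :=
  (contDiff_simMap (n := 0) x T).continuous

lemma WaveField.IsMeasurable.selfSimilar {U : WaveField N} (hU : U.IsMeasurable) (p : ℝ)
    (x : Space N) (T : ℝ) : (selfSimilar p U x T).IsMeasurable := by
  have hm := (continuous_simMap x T).measurable
  have hE : Measurable (fun z : Space N × ℝ => Real.exp (-z.2)) :=
    Real.measurable_exp.comp measurable_snd.neg
  have m1 := hU.1.comp hm
  have m2 := hU.2.1.comp hm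
  have m3 := hU.2.2.comp hm
  exact ⟨(hE.pow_const _).mul m1, ((hE.pow_const _).mul hE).smul m2,
    (hE.pow_const _).mul ((m1.const_mul _).add (hE.mul (m3.sub (measurable_fst.inner m2))))⟩

lemma WaveField.IsMeasurable.diff {V U : WaveField N} (hV : V.IsMeasurable)
    (hU : U.IsMeasurable) : (V.diff U).IsMeasurable :=
  ⟨hV.1.sub hU.1, hV.2.1.sub hU.2.1, hV.2.2.sub hU.2.2⟩

lemma WaveField.IsMeasurable.fieldDensity {U : WaveField N} (hU : U.IsMeasurable) (p : ℝ) :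
    Measurable (fieldDensity p U) := by
  have m1 : Measurable (fun z : Space N × ℝ => |U.val z.1 z.2|) := hU.1.abs
  exact (((hU.2.1.norm.pow_const 2).add (hU.2.2.pow_const 2)).add (hU.1.pow_const 2)).add
    (m1.pow_const (p + 1))

lemma classicalField_isMeasurable {v : Space N → ℝ → ℝ}
    (hv : ContDiff ℝ 1 (fun z : Space N × ℝ => v z.1 z.2)) : (classicalField v).IsMeasurable := by
  refine ⟨hv.continuous.measurable, ?_, ?_⟩
  · have : (fun z : Space N × ℝ => (classicalField v).grad z.1 z.2) = fun z =>
        ∑ i, dI i (fun z : Space N × ℝ => v z.1 z.2) z • EuclideanSpace.single i (1 : ℝ) := by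
      funext z
      ext j
      rw [classicalField_grad_apply hv]
      simp [Finset.sum_apply, Pi.single_apply]
    rw [this]
    exact (continuous_finsetSum _ fun i _ =>
      (hv.continuous_dI i).smul continuous_const).measurable
  · simp only [classicalField_dt hv]
    exact hv.continuous_dS.measurable

lemma fieldDensity_classicalField (p : ℝ) {v : Space N → ℝ → ℝ}
    (hv : ContDiff ℝ 1 (fun z : Space N × ℝ => v z.1 z.2)) (z : Space N × ℝ) :
    fieldDensity p (classicalField v) z =
      energyDensity p (fun z : Space N × ℝ => v z.1 z.2) z := by
  rw [fieldDensity, energyDensity, classicalField_dt hv, EuclideanSpace.norm_sq_eq]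
  simp only [classicalField_grad_apply hv, Real.norm_eq_abs, sq_abs]
  rfl

lemma fieldDensity_selfSimilar_classicalField (p : ℝ) {v : Space N → ℝ → ℝ} (x : Space N) (T : ℝ)
    (hv : ContDiff ℝ 2 (fun z : Space N × ℝ => v z.1 z.2)) (z : Space N × ℝ) :
    fieldDensity p (selfSimilar p (classicalField v) x T) z =
      energyDensity p (simTransform (2 / (p - 1)) x T (fun z : Space N × ℝ => v z.1 z.2)) z := by
  obtain ⟨h1, h2, h3⟩ := selfSimilar_classicalField (p := p) x T hv z
  rw [fieldDensity, energyDensity, h1, h2, h3]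

end FieldDensity

/-! ### Change of variables between the cylinder and the backward cone. -/

noncomputable section ChangeOfVariables

variable {N : ℕ}

lemma lintegral_comp_add_smul (x : Space N) {c : ℝ} (hc : 0 < c) (G : Space N → ℝ≥0∞) :
    ∫⁻ y, G (x + c • y) = ENNReal.ofReal ((c ^ N)⁻¹) * ∫⁻ ξ, G ξ := by
  have h1 := (measurableEmbedding_const_smul₀ (α := Space N) hc.ne').lintegral_map
    (μ := volume) (fun y => G (x + y))
  rw [Measure.map_addHaar_smul volume hc.ne', lintegral_smul_measure,
    lintegral_add_left_eq_self G x, finrank_euclideanSpace_fin,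
    abs_of_pos (inv_pos.2 (pow_pos hc N))] at h1
  exact h1.symm

lemma setLIntegral_innerCylinder {F : Space N × ℝ → ℝ≥0∞} (hF : Measurable F) (δ α β : ℝ) :
    ∫⁻ z in innerCylinder N δ α β, F z =
      ∫⁻ τ in Icc α β, ∫⁻ y in {y : Space N | δ ≤ 1 - ‖y‖ ^ 2}, F (y, τ) := by
  have : innerCylinder N δ α β = {y : Space N | δ ≤ 1 - ‖y‖ ^ 2} ×ˢ Icc α β := by
    ext z
    exact and_comm
  rw [this]
  exact setLIntegral_prod_symm F hF.aemeasurable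

/-- Integrals over a cylinder in similarity variables are bounded by integrals over the slices of
a backward cone in the original variables. -/
lemma lintegral_simMap_le {G : Space N × ℝ → ℝ≥0∞} (hG : Measurable G) (x : Space N)
    {T t₀ δ α β : ℝ}
    (hgeo : ∀ τ ∈ Icc α β, ∀ y : Space N, δ ≤ 1 - ‖y‖ ^ 2 →
      Real.exp (-τ) * ‖y‖ < t₀ - (T - Real.exp (-τ))) :
    ∫⁻ z in innerCylinder N δ α β, G (simMap x T z) ≤
      ENNReal.ofReal (Real.exp β ^ N) * ∫⁻ τ in Icc α β,
        ∫⁻ ξ in Metric.ball x (t₀ - (T - Real.exp (-τ))), G (ξ, T - Real.exp (-τ)) := by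
  rw [setLIntegral_innerCylinder (F := fun z => G (simMap x T z))
    (hG.comp (continuous_simMap x T).measurable),
    ← lintegral_const_mul' _ _ ENNReal.ofReal_ne_top]
  refine setLIntegral_mono' measurableSet_Icc fun τ hτ => ?_
  set B := Metric.ball x (t₀ - (T - Real.exp (-τ)))
  have hE := Real.exp_pos (-τ)
  have mA : MeasurableSet {y : Space N | δ ≤ 1 - ‖y‖ ^ 2} :=
    measurableSet_le measurable_const (measurable_const.sub (measurable_norm.pow_const 2))
  calc ∫⁻ y in {y : Space N | δ ≤ 1 - ‖y‖ ^ 2}, G (simMap x T (y, τ))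
      ≤ ∫⁻ y, B.indicator (fun ξ => G (ξ, T - Real.exp (-τ))) (x + Real.exp (-τ) • y) := by
        rw [← lintegral_indicator mA]
        refine lintegral_mono fun y => ?_
        by_cases hy : y ∈ {y : Space N | δ ≤ 1 - ‖y‖ ^ 2}
        · have hB : x + Real.exp (-τ) • y ∈ B := by
            rw [Metric.mem_ball, dist_eq_norm, add_sub_cancel_left, norm_smul, Real.norm_eq_abs,
              abs_of_pos hE]
            exact hgeo τ hτ y hy
          rw [indicator_of_mem hy, indicator_of_mem hB]
          rfl
        · rw [indicator_of_notMem hy]; exact zero_le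
    _ = ENNReal.ofReal ((Real.exp (-τ) ^ N)⁻¹) * ∫⁻ ξ in B, G (ξ, T - Real.exp (-τ)) := by
        rw [lintegral_comp_add_smul x hE, lintegral_indicator Metric.isOpen_ball.measurableSet]
    _ ≤ _ := by
        gcongr
        rw [Real.exp_neg, inv_pow, inv_inv]
        exact pow_le_pow_left₀ (Real.exp_pos _).le (Real.exp_le_exp.2 hτ.2) N

/-- The substitution `t = T - exp (-τ)`. -/
lemma lintegral_time_change_le (h : ℝ → ℝ≥0∞) {T t₀ α β : ℝ}
    (hmem : ∀ τ ∈ Icc α β, T - Real.exp (-τ) ∈ Icc 0 t₀) :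
    ∫⁻ τ in Icc α β, h (T - Real.exp (-τ)) ≤
      ENNReal.ofReal (Real.exp β) * ∫⁻ t in Icc 0 t₀, h t := by
  have hd : ∀ τ ∈ Icc α β, HasDerivWithinAt (fun τ => T - Real.exp (-τ)) (Real.exp (-τ))
      (Icc α β) τ := fun τ _ =>
    (((hasDerivAt_neg τ).exp.const_sub T).congr_deriv (by ring)).hasDerivWithinAt
  have hinj : InjOn (fun τ => T - Real.exp (-τ)) (Icc α β) := fun a _ b _ hab => by
    have : Real.exp (-a) = Real.exp (-b) := by simpa using hab
    simpa using Real.exp_injective this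
  have h1 := lintegral_image_eq_lintegral_abs_deriv_mul measurableSet_Icc hd hinj h
  have h2 : ∫⁻ t in (fun τ => T - Real.exp (-τ)) '' Icc α β, h t ≤ ∫⁻ t in Icc 0 t₀, h t :=
    lintegral_mono_set (image_subset_iff.2 hmem)
  rw [h1] at h2
  refine le_trans ?_ (mul_le_mul_right h2 (ENNReal.ofReal (Real.exp β)))
  rw [← lintegral_const_mul' _ _ ENNReal.ofReal_ne_top]
  refine setLIntegral_mono' measurableSet_Icc fun τ hτ => ?_
  rw [← mul_assoc, ← ENNReal.ofReal_mul (Real.exp_pos _).le, abs_of_pos (Real.exp_pos _),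
    ← Real.exp_add]
  -- The Jacobian e^{-τ} is at least e^{-β} on the interval.
  refine le_mul_of_one_le_left zero_le ?_
  rw [ENNReal.one_le_ofReal]
  exact Real.one_le_exp (by linarith [hτ.2])

/-- The energies of the approximations are bounded uniformly. -/
lemma exists_energy_bound {p : ℝ} (hp : 1 < p) {U : WaveField N} (hU : U.IsMeasurable)
    {x : Space N} {t₀ : ℝ} {v : ℕ → Space N → ℝ → ℝ}
    (hv : ∀ n, ContDiff ℝ 2 (fun z : Space N × ℝ => v n z.1 z.2))
    (hconv : Tendsto (fun n => ⨆ t ∈ Icc (0 : ℝ) t₀,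
      energyDist p (classicalField (v n)) U x (t₀ - t) t) atTop (𝓝 0)) :
    ∃ M : ℝ≥0∞, M ≠ ⊤ ∧ ∀ᶠ n in atTop, ∀ t ∈ Icc (0 : ℝ) t₀,
      ∫⁻ ξ in Metric.ball x (t₀ - t),
        ENNReal.ofReal (fieldDensity p (classicalField (v n)) (ξ, t)) ≤ M := by
  have hv1 : ∀ n, ContDiff ℝ 1 (fun z : Space N × ℝ => v n z.1 z.2) :=
    fun n => (hv n).of_le (by norm_num)
  have ev : ∀ᶠ n in atTop, ∀ t ∈ Icc (0 : ℝ) t₀,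
      energyDist p (classicalField (v n)) U x (t₀ - t) t ≤ 1 := by
    filter_upwards [hconv.eventually_lt_const (show (0 : ℝ≥0∞) < 1 by simp)] with n hn t ht
    exact (le_iSup₂ (f := fun t (_ : t ∈ Icc (0 : ℝ) t₀) =>
      energyDist p (classicalField (v n)) U x (t₀ - t) t) t ht).trans hn.le
  -- A single C² approximation has bounded energy on the compact closure of the cone. U is within
  -- distance 1 of it, and every later approximation is within distance 1 of U.
  obtain ⟨m, hm⟩ := ev.exists
  have comp : IsCompact (Metric.closedBall x t₀ ×ˢ Icc (0 : ℝ) t₀) :=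
    (isCompact_closedBall x t₀).prod isCompact_Icc
  obtain ⟨b, hb⟩ := comp.exists_bound_of_continuousOn
    (continuous_energyDensity hp (hv m)).continuousOn
  set c := ENNReal.ofReal (2 ^ (p + 1))
  have mf : ∀ W : WaveField N, W.IsMeasurable → ∀ t : ℝ,
      Measurable (fun ξ : Space N => ENNReal.ofReal (fieldDensity p W (ξ, t))) := fun W hW t =>
    ((hW.fieldDensity p).comp (measurable_id.prodMk measurable_const)).ennreal_ofReal
  have key : ∀ A B D : WaveField N, A.IsMeasurable → D.IsMeasurable → (∀ z, fieldDensity p B z ≤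
      2 ^ (p + 1) * (fieldDensity p A z + fieldDensity p D z)) → ∀ (s : Set (Space N)) (t : ℝ),
      ∫⁻ ξ in s, ENNReal.ofReal (fieldDensity p B (ξ, t)) ≤
        c * ((∫⁻ ξ in s, ENNReal.ofReal (fieldDensity p A (ξ, t))) +
          (∫⁻ ξ in s, ENNReal.ofReal (fieldDensity p D (ξ, t)))) := by
    intro A B D hA hD h s t
    rw [← lintegral_add_left (mf A hA t), ← lintegral_const_mul' _ _ ENNReal.ofReal_ne_top]
    refine lintegral_mono fun ξ => ?_
    rw [← ENNReal.ofReal_add (fieldDensity_nonneg _ _ _) (fieldDensity_nonneg _ _ _),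
      ← ENNReal.ofReal_mul (by positivity)]
    exact ENNReal.ofReal_le_ofReal (h _)
  refine ⟨c * (c * (ENNReal.ofReal b * volume (Metric.closedBall x t₀) + 1) + 1), ?_, ?_⟩
  · have hvol : volume (Metric.closedBall x t₀) ≠ ⊤ := measure_closedBall_lt_top.ne
    finiteness
  · filter_upwards [ev] with n hn t ht
    have hc : ∀ n, (classicalField (v n)).IsMeasurable := fun n =>
      classicalField_isMeasurable (hv1 n)
    refine (key U _ _ hU ((hc n).diff hU) (fieldDensity_le_right hp _ U) _ t).trans ?_
    gcongr
    · refine (key (classicalField (v m)) _ _ (hc m) ((hc m).diff hU)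
        (fieldDensity_le_left hp _ U) _ t).trans ?_
      gcongr
      · calc ∫⁻ ξ in Metric.ball x (t₀ - t),
              ENNReal.ofReal (fieldDensity p (classicalField (v m)) (ξ, t))
            ≤ ∫⁻ _ in Metric.ball x (t₀ - t), ENNReal.ofReal b := by
              refine setLIntegral_mono' Metric.isOpen_ball.measurableSet fun ξ hξ => ?_
              refine ENNReal.ofReal_le_ofReal ?_
              rw [fieldDensity_classicalField p (hv1 m)]
              refine (le_abs_self _).trans (hb (ξ, t) ⟨?_, ht⟩)
              exact (Metric.ball_subset_closedBall.trans
                (Metric.closedBall_subset_closedBall (by linarith [ht.1]))) hξ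
          _ = ENNReal.ofReal b * volume (Metric.ball x (t₀ - t)) := setLIntegral_const _ _
          _ ≤ _ := by
              gcongr
              exact Metric.ball_subset_closedBall.trans
                (Metric.closedBall_subset_closedBall (by linarith [ht.1]))
      · rw [← energyDist_eq hp]; exact hm t ht
    · rw [← energyDist_eq hp]; exact hn t ht

end ChangeOfVariables

/-! ### Estimates with approximation errors. -/

noncomputable section Approximation

variable {N : ℕ}

/-- Meant for the error terms only, whose constants may depend on δ. -/
lemma rpow_le_of_mem_innerCylinder {δ α β ε : ℝ} (hε : 0 < ε) (hδ : 0 < δ)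
    {z : Space N × ℝ} (hz : z ∈ innerCylinder N δ α β) :
    (1 - ‖z.1‖ ^ 2) ^ (ε - 1 / 2) ≤ δ ^ (-(1 / 2) : ℝ) := by
  have h0 : 0 < 1 - ‖z.1‖ ^ 2 := hδ.trans_le hz.2
  calc (1 - ‖z.1‖ ^ 2) ^ (ε - 1 / 2) ≤ (1 - ‖z.1‖ ^ 2) ^ (-(1 / 2) : ℝ) :=
        Real.rpow_le_rpow_of_exponent_ge h0 (by linarith [sq_nonneg ‖z.1‖]) (by linarith)
    _ ≤ _ := Real.rpow_le_rpow_of_nonpos hδ hz.2 (by norm_num)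

/-- The main estimate for a field approximated by a function of class `C²`. -/
lemma singular_estimate_of_approx (N : ℕ) {p ε : ℝ} (hp : 1 < p) (hε : 0 < ε) :
    ∃ C : ℝ, 0 ≤ C ∧ ∀ δ : ℝ, 0 < δ → ∃ A : ℝ≥0∞, A ≠ ⊤ ∧
      ∀ (U : WaveField N) (x : Space N) (T s : ℝ) (v : Space N → ℝ → ℝ), U.IsMeasurable →
        ContDiff ℝ 2 (fun z : Space N × ℝ => v z.1 z.2) →
        let w := simTransform (2 / (p - 1)) x T (fun z : Space N × ℝ => v z.1 z.2)
        ∫⁻ z in innerCylinder N (4 * δ) s (s + 1), ENNReal.ofReal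
          (|(selfSimilar p U x T).val z.1 z.2| ^ (p + 1) * (1 - ‖z.1‖ ^ 2) ^ (ε - 1 / 2)) ≤
        ENNReal.ofReal C * (∫⁻ z in innerCylinder N δ (s - 2) (s + 3), ENNReal.ofReal
          (fieldDensity p (selfSimilar p U x T) z * (1 - ‖z.1‖ ^ 2) ^ ε)) +
        A * ((∫⁻ z in innerCylinder N δ (s - 2) (s + 3), ENNReal.ofReal
            (fieldDensity p (selfSimilar p ((classicalField v).diff U) x T) z)) +
          (∫⁻ z in innerCylinder N δ (s - 2) (s + 3), ENNReal.ofReal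
            (|similarityResidual p w z| * (|w z| + |dR w z| + |dS w z|)))) := by
  obtain ⟨K, hK, hmain⟩ := singular_estimate_of_contDiff N hp hε
  set c : ℝ := 2 ^ (p + 1) with hc
  have hc0 : 0 ≤ c := by positivity
  -- The order of quantifiers matters: the constant of the energy is fixed before δ, with one factor
  -- c for each passage between the field and its approximation. The factor A of the errors is
  -- chosen after δ.
  refine ⟨c * (K * c), by positivity, fun δ hδ => ?_⟩
  set Z := δ ^ (-(1 / 2) : ℝ) with hZ
  have hZ0 : 0 ≤ Z := by positivity
  refine ⟨ENNReal.ofReal (c * (K * (c + Z) + Z)), ENNReal.ofReal_ne_top,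
    fun U x T s v hU hv => ?_⟩
  intro w
  have hv1 : ContDiff ℝ 1 (fun z : Space N × ℝ => v z.1 z.2) := hv.of_le (by norm_num)
  have hw : ContDiff ℝ 2 w := hv.simTransform _ x T
  have hw1 : ContDiff ℝ 1 w := hw.of_le (by norm_num)
  set W := selfSimilar p U x T with hW
  set V := selfSimilar p (classicalField v) x T with hV
  set D := selfSimilar p ((classicalField v).diff U) x T with hD
  have hDV : D = V.diff W := selfSimilar_diff p _ _ x T
  have mU : W.IsMeasurable := hU.selfSimilar p x T
  have mD : D.IsMeasurable := ((classicalField_isMeasurable hv1).diff hU).selfSimilar p x T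
  have fV : ∀ z, fieldDensity p V z = energyDensity p w z :=
    fieldDensity_selfSimilar_classicalField p x T hv
  have m2 := (continuous_similarityResidual hp hw).measurable
  have mM : Measurable (fun z => |w z| + |dR w z| + |dS w z|) :=
    (hw1.continuous.measurable.abs.add hw1.continuous_dR.measurable.abs).add
      hw1.continuous_dS.measurable.abs
  set S := innerCylinder N (4 * δ) s (s + 1)
  set Q := innerCylinder N δ (s - 2) (s + 3)
  have mQ : MeasurableSet Q := measurableSet_innerCylinder _ _ _
  have mS : MeasurableSet S := measurableSet_innerCylinder _ _ _
  have hSQ : S ⊆ Q := innerCylinder_subset (by linarith) (by linarith) (by linarith)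
  have pos : ∀ z ∈ Q, 0 < 1 - ‖z.1‖ ^ 2 := fun z hz => hδ.trans_le hz.2
  have wgt : ∀ z ∈ Q, (1 - ‖z.1‖ ^ 2) ^ (ε - 1 / 2) ≤ Z := fun z hz =>
    rpow_le_of_mem_innerCylinder hε hδ hz
  set IU := ∫⁻ z in Q, ENNReal.ofReal (fieldDensity p W z * (1 - ‖z.1‖ ^ 2) ^ ε) with hIU
  set ID := ∫⁻ z in Q, ENNReal.ofReal (fieldDensity p D z) with hID
  set IR := ∫⁻ z in Q, ENNReal.ofReal (|similarityResidual p w z| *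
    (|w z| + |dR w z| + |dS w z|)) with hIR
  -- from the field to its approximation
  have step1 : ∫⁻ z in S, ENNReal.ofReal
      (|W.val z.1 z.2| ^ (p + 1) * (1 - ‖z.1‖ ^ 2) ^ (ε - 1 / 2)) ≤
      ENNReal.ofReal c * ((∫⁻ z in S, ENNReal.ofReal
        (|w z| ^ (p + 1) * (1 - ‖z.1‖ ^ 2) ^ (ε - 1 / 2))) + ENNReal.ofReal Z * ID) := by
    have e : ENNReal.ofReal Z * (∫⁻ z in S, ENNReal.ofReal (fieldDensity p D z)) ≤
        ENNReal.ofReal Z * ID :=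
      mul_le_mul_right (lintegral_mono_set hSQ) _
    refine le_trans ?_ (mul_le_mul_right (add_le_add_right e _) _)
    have mw : Measurable (fun z : Space N × ℝ => ENNReal.ofReal
        (|w z| ^ (p + 1) * (1 - ‖z.1‖ ^ 2) ^ (ε - 1 / 2))) :=
      ((hw1.continuous.measurable.abs.pow_const _).mul (measurable_weight _)).ennreal_ofReal
    rw [← lintegral_const_mul' _ _ ENNReal.ofReal_ne_top, ← lintegral_add_left mw,
      ← lintegral_const_mul' _ _ ENNReal.ofReal_ne_top]
    refine setLIntegral_mono' mS fun z hz => ?_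
    have h0 := Real.rpow_nonneg (pos z (hSQ hz)).le (ε - 1 / 2)
    rw [← ENNReal.ofReal_mul hZ0, ← ENNReal.ofReal_add (by positivity)
      (mul_nonneg hZ0 (fieldDensity_nonneg _ _ _)), ← ENNReal.ofReal_mul hc0]
    refine ENNReal.ofReal_le_ofReal ?_
    have h1 : |W.val z.1 z.2| ^ (p + 1) ≤ c * (|w z| ^ (p + 1) + |D.val z.1 z.2| ^ (p + 1)) := by
      refine abs_rpow_le_of_abs_le_add (by linarith) ?_
      have : W.val z.1 z.2 = w z - D.val z.1 z.2 := by
        rw [hDV]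
        change W.val z.1 z.2 = V.val z.1 z.2 - (V.val z.1 z.2 - W.val z.1 z.2)
        ring
      rw [this]
      exact abs_sub _ _
    have h2 : |D.val z.1 z.2| ^ (p + 1) ≤ fieldDensity p D z := by
      rw [fieldDensity]
      have : 0 ≤ ‖D.grad z.1 z.2‖ ^ 2 + D.dt z.1 z.2 ^ 2 + D.val z.1 z.2 ^ 2 := by positivity
      linarith
    have h3 : |D.val z.1 z.2| ^ (p + 1) * (1 - ‖z.1‖ ^ 2) ^ (ε - 1 / 2) ≤
        fieldDensity p D z * Z :=
      mul_le_mul h2 (wgt z (hSQ hz)) h0 (fieldDensity_nonneg _ _ _)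
    have h4 := mul_le_mul_of_nonneg_right h1 h0
    have h5 := mul_le_mul_of_nonneg_left h3 hc0
    linarith
  -- the estimate for the approximation
  have step2 : ∫⁻ z in S, ENNReal.ofReal
        (|w z| ^ (p + 1) * (1 - ‖z.1‖ ^ 2) ^ (ε - 1 / 2)) ≤
      ENNReal.ofReal K * ((∫⁻ z in Q, ENNReal.ofReal
        (energyDensity p w z * (1 - ‖z.1‖ ^ 2) ^ ε)) + ENNReal.ofReal Z * IR) := by
    have h := hmain w hw δ (s - 2) (s + 3) hδ
    rw [sub_add_cancel, show s + 3 - 2 = s + 1 by ring] at h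
    refine h.trans (mul_le_mul_right ?_ _)
    have me : Measurable (fun z : Space N × ℝ => ENNReal.ofReal
        (energyDensity p w z * (1 - ‖z.1‖ ^ 2) ^ ε)) :=
      ((continuous_energyDensity hp hw).measurable.mul (measurable_weight _)).ennreal_ofReal
    rw [← lintegral_const_mul' _ _ ENNReal.ofReal_ne_top, ← lintegral_add_left me]
    refine setLIntegral_mono' mQ fun z hz => ?_
    have h0 := Real.rpow_nonneg (pos z hz).le ε
    rw [← ENNReal.ofReal_mul hZ0, ← ENNReal.ofReal_add
      (mul_nonneg (energyDensity_nonneg _ _ _) h0) (by positivity)]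
    refine ENNReal.ofReal_le_ofReal ?_
    have := mul_le_mul_of_nonneg_left (wgt z hz) (by positivity :
      0 ≤ |similarityResidual p w z| * (|w z| + |dR w z| + |dS w z|))
    linarith
  -- back to the field
  have step3 : ∫⁻ z in Q, ENNReal.ofReal (energyDensity p w z * (1 - ‖z.1‖ ^ 2) ^ ε) ≤
      ENNReal.ofReal c * (IU + ID) := by
    have mu : Measurable (fun z : Space N × ℝ => ENNReal.ofReal
        (fieldDensity p W z * (1 - ‖z.1‖ ^ 2) ^ ε)) :=
      ((mU.fieldDensity p).mul (measurable_weight _)).ennreal_ofReal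
    rw [← lintegral_add_left mu, ← lintegral_const_mul' _ _ ENNReal.ofReal_ne_top]
    refine setLIntegral_mono' mQ fun z hz => ?_
    have h0 := Real.rpow_nonneg (pos z hz).le ε
    have h1 : (1 - ‖z.1‖ ^ 2) ^ ε ≤ 1 :=
      Real.rpow_le_one (pos z hz).le (by linarith [sq_nonneg ‖z.1‖]) hε.le
    have nU := fieldDensity_nonneg p W z
    have nD := fieldDensity_nonneg p D z
    rw [← ENNReal.ofReal_add (by positivity) nD, ← ENNReal.ofReal_mul hc0]
    refine ENNReal.ofReal_le_ofReal ?_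
    rw [← fV]
    have h2 := fieldDensity_le_right hp V W z
    rw [← hDV] at h2
    have h3 := mul_le_mul_of_nonneg_right h2 h0
    have h4 := mul_le_mul_of_nonneg_left h1 (by positivity : 0 ≤ c * fieldDensity p D z)
    linarith
  calc _ ≤ _ := step1
    _ ≤ ENNReal.ofReal c * (ENNReal.ofReal K * (ENNReal.ofReal c * (IU + ID)
        + ENNReal.ofReal Z * IR) + ENNReal.ofReal Z * ID) := by
      gcongr
      exact step2.trans (by gcongr)
    _ = ENNReal.ofReal (c * (K * c)) * IU + (ENNReal.ofReal (c * (K * c + Z)) * ID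
        + ENNReal.ofReal (c * (K * Z)) * IR) := by
      rw [ENNReal.ofReal_mul hc0, ENNReal.ofReal_mul hK, ENNReal.ofReal_mul hc0,
        ENNReal.ofReal_add (by positivity) hZ0, ENNReal.ofReal_mul hK, ENNReal.ofReal_mul hc0,
        ENNReal.ofReal_mul hK]
      ring
    _ ≤ _ := by
      rw [mul_add (ENNReal.ofReal (c * (K * (c + Z) + Z)))]
      have k1 : 0 ≤ c * K * Z := by positivity
      have k2 : 0 ≤ c * K * c := by positivity
      have k3 : 0 ≤ c * Z := by positivity
      refine add_le_add_right (add_le_add ?_ ?_) _ <;> gcongr ENNReal.ofReal ?_ * _ <;> linarith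

/-- The contribution of the residual is controlled by the residual in `L¹L²`. -/
lemma residual_contribution_le {p : ℝ} (hp : 1 < p) (x : Space N) {T t₀ δ α β : ℝ}
    (hδ : 0 < δ)
    (hmem : ∀ τ ∈ Icc α β, T - Real.exp (-τ) ∈ Icc 0 t₀)
    (hgeo : ∀ τ ∈ Icc α β, ∀ y : Space N, δ ≤ 1 - ‖y‖ ^ 2 →
      Real.exp (-τ) * ‖y‖ < t₀ - (T - Real.exp (-τ))) :
    ∃ A : ℝ≥0∞, A ≠ ⊤ ∧ ∀ (v : Space N → ℝ → ℝ) (M : ℝ≥0∞),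
      ContDiff ℝ 2 (fun z : Space N × ℝ => v z.1 z.2) → M ≠ ⊤ →
      (∀ t ∈ Icc (0 : ℝ) t₀, ∫⁻ ξ in Metric.ball x (t₀ - t),
        ENNReal.ofReal (fieldDensity p (classicalField v) (ξ, t)) ≤ M) →
      let w := simTransform (2 / (p - 1)) x T (fun z : Space N × ℝ => v z.1 z.2)
      ∫⁻ z in innerCylinder N δ α β, ENNReal.ofReal
            (|similarityResidual p w z| * (|w z| + |dR w z| + |dS w z|)) ≤
        A * M ^ (1 / 2 : ℝ) * ∫⁻ t in Icc (0 : ℝ) t₀,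
          (∫⁻ ξ in Metric.ball x (t₀ - t), ‖waveResidual p v ξ t‖ₑ ^ 2) ^ (1 / 2 : ℝ) := by
  obtain ⟨L, hL, hdens⟩ := exists_fieldDensity_selfSimilar_le (N := N) hp α
  set a := 2 / (p - 1) with ha
  have ha0 : 0 < a := div_pos two_pos (by linarith)
  set k := Real.exp (-α) ^ (a + 2) with hk
  have hk0 : 0 ≤ k := by positivity
  refine ⟨ENNReal.ofReal (k * Real.sqrt (3 * L)) * (ENNReal.ofReal (Real.exp β ^ N) *
    ENNReal.ofReal (Real.exp β)), by finiteness, fun v M hv hMt hM => ?_⟩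
  intro w
  have hv1 : ContDiff ℝ 1 (fun z : Space N × ℝ => v z.1 z.2) := hv.of_le (by norm_num)
  have hw : ContDiff ℝ 2 w := hv.simTransform _ x T
  set res : Space N × ℝ → ℝ := fun z => waveResidual p v z.1 z.2 with hres
  have cres : Continuous res := by
    have : res = fun z => dS (dS (fun z : Space N × ℝ => v z.1 z.2)) z -
        lap (fun z : Space N × ℝ => v z.1 z.2) z - |v z.1 z.2| ^ (p - 1) * v z.1 z.2 :=
      funext fun z => waveResidual_eq p hv z.1 z.2
    rw [this]
    exact (hv.dS_of_two.continuous_dS.sub hv.continuous_lap).sub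
      ((hv.continuous.abs.rpow_const fun _ => Or.inr (by linarith)).mul hv.continuous)
  have mf : Measurable (fieldDensity p (classicalField v)) :=
    (classicalField_isMeasurable hv1).fieldDensity p
  set G : Space N × ℝ → ℝ≥0∞ := fun z =>
    ‖res z‖ₑ * ENNReal.ofReal (fieldDensity p (classicalField v) z) ^ (1 / 2 : ℝ) with hG
  have mG : Measurable G := cres.measurable.enorm.mul (mf.ennreal_ofReal.pow_const _)
  have pointwise : ∀ z ∈ innerCylinder N δ α β, ENNReal.ofReal
      (|similarityResidual p w z| * (|w z| + |dR w z| + |dS w z|)) ≤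
      ENNReal.ofReal (k * Real.sqrt (3 * L)) * G (simMap x T z) := by
    intro z hz
    have hy : ‖z.1‖ ^ 2 ≤ 1 := by linarith [hz.2]
    have hy1 : ‖z.1‖ ≤ 1 := by nlinarith [norm_nonneg z.1]
    set Φ := fieldDensity p (classicalField v) (simMap x T z)
    have hΦ : 0 ≤ Φ := fieldDensity_nonneg _ _ _
    have h1 : |similarityResidual p w z| ≤ k * |res (simMap x T z)| := by
      have : similarityResidual p w z = Real.exp (-z.2) ^ (a + 2) * res (simMap x T z) := by
        have := congrFun (similarityResidual_simTransform x T hp hv) z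
        rw [this]
        simp only [simTransform, hres]
        rw [waveResidual_eq p hv]
      rw [this, abs_mul, abs_of_pos (Real.rpow_pos_of_pos (Real.exp_pos _) _)]
      exact mul_le_mul_of_nonneg_right (Real.rpow_le_rpow (Real.exp_pos _).le
        (Real.exp_le_exp.2 (by linarith [hz.1.1])) (by linarith)) (abs_nonneg _)
    have h2 : |w z| + |dR w z| + |dS w z| ≤ Real.sqrt (3 * L) * Real.sqrt Φ := by
      rw [← Real.sqrt_mul (by positivity)]
      refine Real.le_sqrt_of_sq_le ?_
      have hd := hdens (classicalField v) x T z hz.1.1 hy1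
      rw [fieldDensity_selfSimilar_classicalField p x T hv] at hd
      have hE : gradSq w z + dS w z ^ 2 + w z ^ 2 ≤ L * Φ := by
        refine le_trans ?_ hd
        rw [energyDensity]
        have : 0 ≤ |w z| ^ (p + 1) := by positivity
        linarith
      have hr : dR w z ^ 2 ≤ gradSq w z :=
        (sq_dR_le w z).trans (mul_le_of_le_one_left (gradSq_nonneg w z) hy)
      rw [← sq_abs (w z), ← sq_abs (dS w z)] at hE
      rw [← sq_abs (dR w z)] at hr
      have q1 := sq_nonneg (|w z| - |dR w z|)
      have q2 := sq_nonneg (|w z| - |dS w z|)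
      have q3 := sq_nonneg (|dS w z| - |dR w z|)
      linarith
    calc ENNReal.ofReal (|similarityResidual p w z| * (|w z| + |dR w z| + |dS w z|))
        ≤ ENNReal.ofReal ((k * |res (simMap x T z)|) * (Real.sqrt (3 * L) * Real.sqrt Φ)) :=
          ENNReal.ofReal_le_ofReal (mul_le_mul h1 h2 (by positivity) (by positivity))
      _ = ENNReal.ofReal (k * Real.sqrt (3 * L)) *
          (ENNReal.ofReal |res (simMap x T z)| * ENNReal.ofReal (Real.sqrt Φ)) := by
          rw [← ENNReal.ofReal_mul (abs_nonneg _), ← ENNReal.ofReal_mul (by positivity)]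
          congr 1; ring
      _ = _ := by
          rw [← Real.norm_eq_abs, ofReal_norm, Real.sqrt_eq_rpow Φ,
            ← ENNReal.ofReal_rpow_of_nonneg hΦ (by norm_num)]
  -- Cauchy-Schwarz in space only. The energy is bounded uniformly in time, so L¹ in time suffices
  -- for the residual.
  have slice : ∀ t ∈ Icc (0 : ℝ) t₀, ∫⁻ ξ in Metric.ball x (t₀ - t), G (ξ, t) ≤
      (∫⁻ ξ in Metric.ball x (t₀ - t), ‖waveResidual p v ξ t‖ₑ ^ 2) ^ (1 / 2 : ℝ) *
        M ^ (1 / 2 : ℝ) := by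
    intro t ht
    have ms : Measurable (fun ξ : Space N => (ξ, t)) := measurable_id.prodMk measurable_const
    have h := ENNReal.lintegral_mul_le_Lp_mul_Lq
      (volume.restrict (Metric.ball x (t₀ - t))) Real.HolderConjugate.two_two
      (f := fun ξ => ‖res (ξ, t)‖ₑ)
      (g := fun ξ => ENNReal.ofReal (fieldDensity p (classicalField v) (ξ, t)) ^ (1 / 2 : ℝ))
      ((cres.measurable.comp ms).enorm).aemeasurable
      (((mf.comp ms).ennreal_ofReal.pow_const _)).aemeasurable
    refine h.trans ?_
    have e1 : ∀ r : ℝ≥0∞, (r ^ (1 / 2 : ℝ)) ^ (2 : ℝ) = r := fun r => by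
      rw [← ENNReal.rpow_mul]; norm_num
    simp only [e1, ENNReal.rpow_two]
    gcongr
    exact hM t ht
  calc ∫⁻ z in innerCylinder N δ α β, ENNReal.ofReal
            (|similarityResidual p w z| * (|w z| + |dR w z| + |dS w z|))
      ≤ ∫⁻ z in innerCylinder N δ α β,
          ENNReal.ofReal (k * Real.sqrt (3 * L)) * G (simMap x T z) :=
        setLIntegral_mono' (measurableSet_innerCylinder _ _ _) pointwise
    _ = ENNReal.ofReal (k * Real.sqrt (3 * L)) *
          ∫⁻ z in innerCylinder N δ α β, G (simMap x T z) :=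
        lintegral_const_mul' _ _ ENNReal.ofReal_ne_top
    _ ≤ ENNReal.ofReal (k * Real.sqrt (3 * L)) * (ENNReal.ofReal (Real.exp β ^ N) *
          ∫⁻ τ in Icc α β, (fun t => (∫⁻ ξ in Metric.ball x (t₀ - t),
            ‖waveResidual p v ξ t‖ₑ ^ 2) ^ (1 / 2 : ℝ) * M ^ (1 / 2 : ℝ))
            (T - Real.exp (-τ))) := by
        refine mul_le_mul_right ((lintegral_simMap_le mG x hgeo).trans (mul_le_mul_right ?_ _)) _
        exact setLIntegral_mono' measurableSet_Icc fun τ hτ => slice _ (hmem τ hτ)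
    _ ≤ ENNReal.ofReal (k * Real.sqrt (3 * L)) * (ENNReal.ofReal (Real.exp β ^ N) *
          (ENNReal.ofReal (Real.exp β) * ∫⁻ t in Icc (0 : ℝ) t₀,
            ((∫⁻ ξ in Metric.ball x (t₀ - t), ‖waveResidual p v ξ t‖ₑ ^ 2) ^ (1 / 2 : ℝ) *
              M ^ (1 / 2 : ℝ)))) := by
        gcongr
        exact lintegral_time_change_le _ hmem
    _ = _ := by
        rw [lintegral_mul_const' _ _ (ENNReal.rpow_ne_top_of_nonneg (by norm_num) hMt)]
        ring

end Approximation

/-! ### Passage to the limit in the approximation, at fixed δ. -/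

noncomputable section StrongSolution

variable {N : ℕ}

/-- The bound on s says that the window τ ≥ s - 2 begins at a time t ≥ 0. -/
lemma similarity_time_mem {T δ s : ℝ} (hT : 0 < T) (hs : -Real.log T + 2 ≤ s) (hδ : δ ≤ 1) :
    ∀ τ ∈ Icc (s - 2) (s + 3),
      T - Real.exp (-τ) ∈ Icc 0 (T - Real.exp (-(s + 3)) * (δ / 4)) := by
  intro τ hτ
  have h1 : Real.exp (-τ) ≤ T := by
    rw [← Real.le_log_iff_exp_le hT]
    linarith [hτ.1]
  have h2 : Real.exp (-(s + 3)) ≤ Real.exp (-τ) := Real.exp_le_exp.2 (by linarith [hτ.2])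
  have h3 := Real.exp_pos (-(s + 3))
  constructor
  · linarith
  · nlinarith

/-- From 1 - |y|² ≥ δ follows 1 - |y| ≥ δ/2, so the slice lies at distance at least e^{-τ}δ/2 inside
the cone with vertex time T. Lowering the vertex by e^{-(s+3)}δ/4 keeps the inclusion strict. -/
lemma similarity_cone_subset {T δ s : ℝ} (hδ : 0 < δ) :
    ∀ τ ∈ Icc (s - 2) (s + 3), ∀ y : Space N, δ ≤ 1 - ‖y‖ ^ 2 → Real.exp (-τ) * ‖y‖ <
      (T - Real.exp (-(s + 3)) * (δ / 4)) - (T - Real.exp (-τ)) := by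
  intro τ hτ y hy
  have h2 : Real.exp (-(s + 3)) ≤ Real.exp (-τ) := Real.exp_le_exp.2 (by linarith [hτ.2])
  have h3 := Real.exp_pos (-τ)
  have h4 : δ / 2 ≤ 1 - ‖y‖ := by nlinarith [sq_nonneg (1 - ‖y‖)]
  nlinarith [mul_le_mul_of_nonneg_left h4 h3.le, mul_le_mul_of_nonneg_right h2 hδ.le,
    mul_pos h3 hδ]

/-- The energy of the difference in similarity variables tends to zero when the energy distance
does, uniformly in time. -/
lemma exists_lintegral_fieldDensity_diff_le {p : ℝ} (hp : 1 < p) (x : Space N) {T t₀ δ α β : ℝ}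
    (hδ : 0 < δ) (hmem : ∀ τ ∈ Icc α β, T - Real.exp (-τ) ∈ Icc 0 t₀)
    (hgeo : ∀ τ ∈ Icc α β, ∀ y : Space N, δ ≤ 1 - ‖y‖ ^ 2 →
      Real.exp (-τ) * ‖y‖ < t₀ - (T - Real.exp (-τ))) :
    ∃ A : ℝ≥0∞, A ≠ ⊤ ∧ ∀ V U : WaveField N, V.IsMeasurable → U.IsMeasurable →
      ∫⁻ z in innerCylinder N δ α β,
          ENNReal.ofReal (fieldDensity p (selfSimilar p (V.diff U) x T) z) ≤
        A * ⨆ t ∈ Icc (0 : ℝ) t₀, energyDist p V U x (t₀ - t) t := by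
  obtain ⟨M, hM, hdens⟩ := exists_fieldDensity_selfSimilar_le (N := N) hp α
  refine ⟨ENNReal.ofReal M * (ENNReal.ofReal (Real.exp β ^ N) * volume (Icc α β)),
    by rw [Real.volume_Icc]; finiteness, fun V U hV hU => ?_⟩
  set G : Space N × ℝ → ℝ≥0∞ := fun z => ENNReal.ofReal (fieldDensity p (V.diff U) z)
  have mG : Measurable G := ((hV.diff hU).fieldDensity p).ennreal_ofReal
  calc ∫⁻ z in innerCylinder N δ α β,
          ENNReal.ofReal (fieldDensity p (selfSimilar p (V.diff U) x T) z)
      ≤ ∫⁻ z in innerCylinder N δ α β, ENNReal.ofReal M * G (simMap x T z) := by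
        refine setLIntegral_mono' (measurableSet_innerCylinder _ _ _) fun z hz => ?_
        have hy1 : ‖z.1‖ ≤ 1 := by nlinarith [norm_nonneg z.1, hz.2]
        rw [← ENNReal.ofReal_mul hM]
        exact ENNReal.ofReal_le_ofReal (hdens _ x T z hz.1.1 hy1)
    _ = ENNReal.ofReal M * ∫⁻ z in innerCylinder N δ α β, G (simMap x T z) :=
        lintegral_const_mul' _ _ ENNReal.ofReal_ne_top
    _ ≤ ENNReal.ofReal M * (ENNReal.ofReal (Real.exp β ^ N) * ∫⁻ _ in Icc α β,
          ⨆ t ∈ Icc (0 : ℝ) t₀, energyDist p V U x (t₀ - t) t) := by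
        refine mul_le_mul_right ((lintegral_simMap_le mG x hgeo).trans (mul_le_mul_right ?_ _)) _
        refine setLIntegral_mono' measurableSet_Icc fun τ hτ => ?_
        rw [← energyDist_eq hp]
        exact le_iSup₂ (f := fun t (_ : t ∈ Icc (0 : ℝ) t₀) => energyDist p V U x (t₀ - t) t)
          _ (hmem τ hτ)
    _ = _ := by
        rw [setLIntegral_const]
        ring

/-- The main estimate for strong solutions, away from the lateral boundary of the cylinder. -/
lemma singular_estimate_innerCylinder (N : ℕ) {p ε : ℝ} (hp : 1 < p) (hε : 0 < ε) :
    ∃ C : ℝ, 0 ≤ C ∧ ∀ (U : WaveField N) (x : Space N) (T s : ℝ), U.IsMeasurable → 0 < T →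
      -Real.log T + 2 ≤ s →
      (∀ t₀, 0 < t₀ → t₀ < T → IsStrongSolutionOnCone p U x t₀) →
      ∀ δ : ℝ, 0 < δ → δ ≤ 1 →
        ∫⁻ z in innerCylinder N (4 * δ) s (s + 1), ENNReal.ofReal
          (|(selfSimilar p U x T).val z.1 z.2| ^ (p + 1) * (1 - ‖z.1‖ ^ 2) ^ (ε - 1 / 2)) ≤
        ENNReal.ofReal C * (∫⁻ z in innerCylinder N δ (s - 2) (s + 3), ENNReal.ofReal
          (fieldDensity p (selfSimilar p U x T) z * (1 - ‖z.1‖ ^ 2) ^ ε)) := by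
  obtain ⟨C, hC, happ⟩ := singular_estimate_of_approx N hp hε
  refine ⟨C, hC, fun U x T s hU hT hs hsol δ hδ hδ1 => ?_⟩
  obtain ⟨A, hA, happ⟩ := happ δ hδ
  have hmem := similarity_time_mem hT hs hδ1
  have hgeo := similarity_cone_subset (N := N) (T := T) (s := s) hδ
  set t₀ := T - Real.exp (-(s + 3)) * (δ / 4)
  have hexp : Real.exp (-(s + 3)) ≤ T := by
    rw [← Real.le_log_iff_exp_le hT]
    linarith
  have hpos := Real.exp_pos (-(s + 3))
  have ht₀ : 0 < t₀ := sub_pos.2 (by nlinarith)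
  have ht₁ : t₀ < T := sub_lt_self _ (by positivity)
  obtain ⟨v, hv, hdist, hres⟩ := hsol t₀ ht₀ ht₁
  obtain ⟨M, hM, hbound⟩ := exists_energy_bound hp hU hv hdist
  obtain ⟨A₁, hA₁, hdiff⟩ := exists_lintegral_fieldDensity_diff_le hp x hδ hmem hgeo
  obtain ⟨A₂, hA₂, hcontr⟩ := residual_contribution_le hp x hδ hmem hgeo
  have hMp : M ^ (1 / 2 : ℝ) ≠ ⊤ := ENNReal.rpow_ne_top_of_nonneg (by norm_num) hM
  have hAM : A₂ * M ^ (1 / 2 : ℝ) ≠ ⊤ := ENNReal.mul_ne_top hA₂ hMp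
  -- With δ fixed, all error factors are finite constants, so both errors vanish in the limit.
  have lim := (ENNReal.Tendsto.const_mul ((ENNReal.Tendsto.const_mul hdist (Or.inr hA₁)).add
    (ENNReal.Tendsto.const_mul hres (Or.inr hAM))) (Or.inr hA)).const_add (ENNReal.ofReal C *
      (∫⁻ z in innerCylinder N δ (s - 2) (s + 3), ENNReal.ofReal
          (fieldDensity p (selfSimilar p U x T) z * (1 - ‖z.1‖ ^ 2) ^ ε)))
  simp only [mul_zero, add_zero] at lim
  refine ge_of_tendsto lim ?_
  filter_upwards [hbound] with n hn
  refine (happ U x T s (v n) hU (hv n)).trans (add_le_add_right (mul_le_mul_right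
    (add_le_add ?_ ?_) _) _)
  · exact hdiff _ _ (classicalField_isMeasurable ((hv n).of_le (by norm_num))) hU
  · exact hcontr (v n) M (hv n) hM hn

end StrongSolution

/-! ### Exhaustion of the cylinder and conclusion. -/

noncomputable section Exhaustion

variable {N : ℕ}

lemma lintegral_ball_prod {F : Space N × ℝ → ℝ≥0∞} (hF : Measurable F) (a b : ℝ) :
    ∫⁻ τ in Icc a b, ∫⁻ y in Metric.ball (0 : Space N) 1, F (y, τ) =
      ∫⁻ z in Metric.ball (0 : Space N) 1 ×ˢ Icc a b, F z :=
  (setLIntegral_prod_symm F hF.aemeasurable).symm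

lemma innerCylinder_subset_ball_prod {δ : ℝ} (hδ : 0 < δ) (a b : ℝ) :
    innerCylinder N δ a b ⊆ Metric.ball (0 : Space N) 1 ×ˢ Icc a b := by
  intro z hz
  refine ⟨?_, hz.1⟩
  rw [mem_ball_zero_iff]
  nlinarith [norm_nonneg z.1, hz.2]

lemma iUnion_innerCylinder (a b : ℝ) :
    ⋃ n : ℕ, innerCylinder N (4 * (1 / ((n : ℝ) + 1))) a b =
      Metric.ball (0 : Space N) 1 ×ˢ Icc a b := by
  refine Subset.antisymm (iUnion_subset fun n =>
    innerCylinder_subset_ball_prod (by positivity) a b) fun z hz => ?_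
  have h1 : ‖z.1‖ < 1 := mem_ball_zero_iff.1 hz.1
  have h2 : 0 < (1 - ‖z.1‖ ^ 2) / 4 := by nlinarith [norm_nonneg z.1]
  obtain ⟨n, hn⟩ := exists_nat_one_div_lt h2
  exact mem_iUnion.2 ⟨n, hz.2, by linarith⟩

lemma singularIntegral_eq {p ε : ℝ} {W : WaveField N} (hW : W.IsMeasurable) (a b : ℝ) :
    singularIntegral p ε W a b = ∫⁻ z in Metric.ball (0 : Space N) 1 ×ˢ Icc a b,
      ENNReal.ofReal (|W.val z.1 z.2| ^ (p + 1) * (1 - ‖z.1‖ ^ 2) ^ (ε - 1 / 2)) := by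
  have hm : Measurable fun z : Space N × ℝ =>
      ENNReal.ofReal (|W.val z.1 z.2| ^ (p + 1) * (1 - ‖z.1‖ ^ 2) ^ (ε - 1 / 2)) :=
    ((hW.1.abs.pow_const _).mul (measurable_weight _)).ennreal_ofReal
  rw [← lintegral_ball_prod hm]
  refine lintegral_congr fun τ => setLIntegral_congr_fun measurableSet_ball fun y hy => ?_
  have h1 : ‖y‖ < 1 := mem_ball_zero_iff.1 hy
  have h2 : 0 < 1 - ‖y‖ ^ 2 := by nlinarith [norm_nonneg y]
  simp only [rho]
  rw [Real.sqrt_eq_rpow, Real.rpow_sub h2]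

lemma weightedEnergyIntegral_eq {p ε : ℝ} {W : WaveField N} (hW : W.IsMeasurable) (a b : ℝ) :
    weightedEnergyIntegral p ε W a b = ∫⁻ z in Metric.ball (0 : Space N) 1 ×ˢ Icc a b,
      ENNReal.ofReal (fieldDensity p W z * (1 - ‖z.1‖ ^ 2) ^ ε) :=
  lintegral_ball_prod (((hW.fieldDensity p).mul (measurable_weight _)).ennreal_ofReal) a b

/-- Since the constant is independent of δ, monotone convergence along δ = 1/(n+1) reaches the full
ball. -/
lemma singularIntegral_le (N : ℕ) {p ε : ℝ} (hp : 1 < p) (hε : 0 < ε) :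
    ∃ C : ℝ, 0 < C ∧ ∀ (U : WaveField N) (x : Space N) (T s : ℝ), U.IsMeasurable → 0 < T →
      -Real.log T + 2 ≤ s →
      (∀ t₀, 0 < t₀ → t₀ < T → IsStrongSolutionOnCone p U x t₀) →
      singularIntegral p ε (selfSimilar p U x T) s (s + 1) ≤
        ENNReal.ofReal C * weightedEnergyIntegral p ε (selfSimilar p U x T) (s - 2) (s + 3) := by
  obtain ⟨C, hC, h⟩ := singular_estimate_innerCylinder N hp hε
  refine ⟨C + 1, by positivity, fun U x T s hU hT hs hsol => ?_⟩
  have mW := hU.selfSimilar p x T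
  have mono : Monotone fun n : ℕ => innerCylinder N (4 * (1 / ((n : ℝ) + 1))) s (s + 1) :=
    fun m n hmn => innerCylinder_subset
      (mul_le_mul_of_nonneg_left (Nat.one_div_le_one_div hmn) (by norm_num)) le_rfl le_rfl
  rw [singularIntegral_eq mW, weightedEnergyIntegral_eq mW, ← iUnion_innerCylinder,
    setLIntegral_iUnion_of_directed _ mono.directed_le]
  refine iSup_le fun n => (h U x T s hU hT hs hsol (1 / ((n : ℝ) + 1)) (by positivity)
    ((div_le_one (by positivity)).2 (by linarith [n.cast_nonneg (α := ℝ)]))).trans ?_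
  exact mul_le_mul' (ENNReal.ofReal_le_ofReal (by linarith))
    (lintegral_mono_set (innerCylinder_subset_ball_prod (by positivity) _ _))

end Exhaustion

theorem proposition1 (N : ℕ) (hN : 2 ≤ N) (p : ℝ) (hpc : 1 + 4 / ((N : ℝ) - 1) < p)
    (hpS : 3 ≤ N → p < 1 + 4 / ((N : ℝ) - 2)) (ε : ℝ) (hε : 0 < ε) :
    ∃ C : ℝ, 0 < C ∧
      ∀ (u₀ u₁ : Space N → ℝ) (U : WaveField N) (T : Space N → ℝ),
        IsBlowupSolution p u₀ u₁ U T →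
      ∀ (x₀ : Space N) (δ₀ : ℝ), IsNonCharacteristic T x₀ δ₀ →
      ∀ T₀ : ℝ, 0 < T₀ → T₀ ≤ T x₀ →
        (∀ s : ℝ, -Real.log T₀ + 2 ≤ s →
          singularIntegral p ε (selfSimilar p U x₀ T₀) s (s + 1) ≤
            ENNReal.ofReal C *
              weightedEnergyIntegral p ε (selfSimilar p U x₀ T₀) (s - 2) (s + 3)) ∧
        (∀ (x : Space N) (s : ℝ),
          0 < T₀ - δ₀ * ‖x - x₀‖ → T₀ - δ₀ * ‖x - x₀‖ ≤ T x →
          -Real.log (T₀ - δ₀ * ‖x - x₀‖) + 2 ≤ s → ‖x - x₀‖ ≤ Real.exp (-s) / δ₀ →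
          singularIntegral p ε (selfSimilar p U x (T₀ - δ₀ * ‖x - x₀‖)) s (s + 1) ≤
            ENNReal.ofReal C *
              weightedEnergyIntegral p ε (selfSimilar p U x (T₀ - δ₀ * ‖x - x₀‖))
                (s - 2) (s + 3)) := by
  have hp : 1 < p := by
    have h2 : (2 : ℝ) ≤ N := by exact_mod_cast hN
    have : 0 < 4 / ((N : ℝ) - 1) := div_pos (by norm_num) (by linarith)
    linarith
  obtain ⟨C, hC, h⟩ := singularIntegral_le N hp hε
  refine ⟨C, hC, fun u₀ u₁ U T hU x₀ δ₀ _ T₀ hT₀ hT₀x => ⟨fun s hs => ?_, fun x s hpos hle hs _ => ?_⟩⟩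
  -- Both parts are the same estimate at different vertices: as the vertex lies on or below the
  -- graph, every strictly smaller cone carries the solution.
  · exact h U x₀ T₀ s hU.measurable hT₀ hs fun t₀ h0 h1 =>
      (hU.solves x₀ t₀ h0 (h1.trans_le hT₀x)).1
  · exact h U x _ s hU.measurable hpos hs fun t₀ h0 h1 => (hU.solves x t₀ h0 (h1.trans_le hle)).1
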